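/- **Setting.** Let $M$ be a conformal Dubrovin manifold $(M,\nabla^z,e,E,r)$, smooth over $\mathbb R$ or holomorphic over $\mathbb C$: $\nabla^z=\nabla+z\mathcal A$ is a pencil of connections on $T^*M$ with $\mathcal A\in\Omega^1(M,\mathrm{End}(T^*M))$, torsion-free and flat for all $z$; $e$ is a vector field with $\nabla e=0$ and $\mathcal A_e=\mathrm{id}$; $X\circ Y=(\mathcal A_X)^*Y$; $E$ is a vector field such that $\nabla E$ is flat and $[E,X\circ Y]=[E,X]\circ Y+X\circ[E,Y]+X\circ Y$; and $r\in\mathbb R$. Put $\mathcal U=\mathcal A_E$ and $\mu=1-\tfrac r2+\nabla_E-\mathcal L_E$, endomorphisms of $T^*M$. Work over the domain of a chart of $M$ with flat coordinates $u^a$, i.e. $\nabla(du^a)=0$. Let $u^a_\ell$ ($\ell\ge0$, $u^a_0=u^a$) be the induced coordinates on the jet-space $J^\infty M$, so that a jet is $u^a(t)=\sum_\ell \frac{t^\ell}{\ell!}u^a_\ell$; put $\partial_{\ell,a}=\partial/\partial u^a_\ell$, $\partial_\ell=du^a\,\partial_{\ell,a}$, $\partial=\sum_\ell u^a_{\ell+1}\partial_{\ell,a}$,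 $\mathcal Q=\sum_\ell \ell u^a_\ell\partial_{\ell,a}$, and let these act on tensors componentwise. Let $\mathcal X=u_1^a\mathcal A_{\partial_a}$, let $J^\infty_0M$ be the open set where $\mathcal X$ is invertible, and let $\mathcal O_{\infty,0}$ be the algebra of smooth functions on $J^\infty_0M$ of finitely many of the $u^a_\ell$. Define $$\sigma(z)=\sum_{\ell\ge0}\bigl((\partial+z\mathcal X)^{\ell}\mathcal X\bigr)\partial_\ell,\qquad \sigma_a(z)=\langle\partial_a,\sigma(z)\rangle,\qquad \delta_z=\partial_z+z^{-1}\bigl(\mu+\tfrac12\bigr)+\mathcal U,$$ $$s(z)=\sum_{k\in\mathbb Z}z^{-k-1}s_k,\qquad s_k=-\bigl((\mathcal X^*)^{-1}\partial\bigr)^{k-1}(\mathcal X^*)^{-1}e\quad(k>0),\qquad s_k=0\quad(k\le0),$$ and, for integers $k\ge-1$, the vector field on $J^\infty_0M$ $$L_k=\operatorname{Res}_{z=0}\bigl\langle s(z),\,z\,\delta_z^{k+1}\sigma(z)\bigr\rangle .$$ **Theorem.** 1. $s(z)$ is the unique series $\sum_{k\in\mathbb Z}z^{-k-1}s_k$,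 with coefficients sections over $J^\infty_0M$ of the pull-back of $TM$ whose components are in $\mathcal O_{\infty,0}$, such that $\mathcal Q\,s(z)=-s(z)$ and $$\sigma_a(y)\,s(z)=\frac{\partial_a}{z-y}+z\,\bigl(\mathcal X_a^b\mathcal A_{\partial_b}\bigr)^*s(z),\qquad \frac1{z-y}=\sum_{k\ge0}y^kz^{-k-1}.$$ 2. For all $k\ge-1$, the vector field $L_k$ maps $\mathcal O_{\infty,0}$ to itself. 3. For all $j,k\ge-1$, as operators on $\mathcal O_{\infty,0}$, $$[L_j,L_k]=(j-k)\,L_{j+k}$$ (for $j=k=-1$ the right-hand side is $0$). 4. With $E^{\circ0}=e$, for all integers $j,k\ge0$ one has on all of $M$ $$[E^{\circ j},E^{\circ k}]=(k-j)\,E^{\circ(j+k-1)}$$ (for $j=k=0$ the right-hand side is $0$). -/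

import Mathlib

open scoped Manifold ContDiff Matrix
open Bundle

noncomputable section

/-! ## Conformal Dubrovin manifolds

`𝕜` is `ℝ` (smooth manifolds) or `ℂ` (holomorphic manifolds), and `M` is a manifold of dimension
`N` over `𝕜`, modelled on `Fin N → 𝕜`. -/

/-- Vector fields on `M` (no regularity imposed). -/
abbrev VField (𝕜 : Type*) [RCLike 𝕜] (N : ℕ) (M : Type*) [TopologicalSpace M]
    [ChartedSpace (Fin N → 𝕜) M] : Type _ :=
  Π x : M, TangentSpace 𝓘(𝕜, Fin N → 𝕜) x

/-- The vector field `X` is smooth near the point `x`. -/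
def SmoothVFieldAt {𝕜 : Type*} [RCLike 𝕜] {N : ℕ} {M : Type*} [TopologicalSpace M]
    [ChartedSpace (Fin N → 𝕜) M] [IsManifold 𝓘(𝕜, Fin N → 𝕜) ∞ M]
    (X : VField 𝕜 N M) (x : M) : Prop :=
  ContMDiffAt 𝓘(𝕜, Fin N → 𝕜) (𝓘(𝕜, Fin N → 𝕜).prod 𝓘(𝕜, Fin N → 𝕜)) ∞
    (fun y => (⟨y, X y⟩ : TangentBundle 𝓘(𝕜, Fin N → 𝕜) M)) x

/-- A Dubrovin manifold `(M, ∇^z, e)`. Connections on the cotangent bundle are written here as the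
dual connections on the tangent bundle, and the one-form `𝒜` with values in `End(T^*M)` as its
adjoint `X ∘ Y = (𝒜_X)^* Y`; the pencil `∇^z = ∇ + z𝒜` on `T^*M` thus becomes the pencil
`∇^z_X Y = ∇_X Y - z X ∘ Y` on `TM`. It has to be torsion-free and flat for all `z`. -/
structure DubrovinManifold (𝕜 : Type*) [RCLike 𝕜] (N : ℕ) (M : Type*) [TopologicalSpace M]
    [ChartedSpace (Fin N → 𝕜) M] [IsManifold 𝓘(𝕜, Fin N → 𝕜) ∞ M] where
  /-- the connection `∇ = ∇^0`; `nabla Y x (X x)` is `(∇_X Y)(x)` -/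
  nabla : CovariantDerivative 𝓘(𝕜, Fin N → 𝕜) (Fin N → 𝕜)
    (fun x : M => TangentSpace 𝓘(𝕜, Fin N → 𝕜) x)
  /-- the product `X ∘ Y` on tangent vectors -/
  mul : Π x : M, TangentSpace 𝓘(𝕜, Fin N → 𝕜) x →L[𝕜]
    TangentSpace 𝓘(𝕜, Fin N → 𝕜) x →L[𝕜] TangentSpace 𝓘(𝕜, Fin N → 𝕜) x
  /-- the identity vector field `e` -/
  one : VField 𝕜 N M
  smooth_nabla : ∀ (X Y : VField 𝕜 N M) (x : M), SmoothVFieldAt X x → SmoothVFieldAt Y x →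
    SmoothVFieldAt (fun y => nabla Y y (X y)) x
  smooth_mul : ∀ (X Y : VField 𝕜 N M) (x : M), SmoothVFieldAt X x → SmoothVFieldAt Y x →
    SmoothVFieldAt (fun y => mul y (X y) (Y y)) x
  smooth_one : ∀ x : M, SmoothVFieldAt one x
  /-- `∇^z_X Y - ∇^z_Y X = [X, Y]` for all `z` -/
  torsion_free : ∀ (z : 𝕜) (X Y : VField 𝕜 N M) (x : M),
    SmoothVFieldAt X x → SmoothVFieldAt Y x →
    (nabla Y x (X x) - z • mul x (X x) (Y x)) - (nabla X x (Y x) - z • mul x (Y x) (X x))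
      = VectorField.mlieBracket 𝓘(𝕜, Fin N → 𝕜) X Y x
  /-- `∇^z_X ∇^z_Y Z - ∇^z_Y ∇^z_X Z - ∇^z_{[X, Y]} Z = 0` for all `z` -/
  flat : ∀ (z : 𝕜) (X Y Z : VField 𝕜 N M) (x : M),
    SmoothVFieldAt X x → SmoothVFieldAt Y x → SmoothVFieldAt Z x →
    let D : VField 𝕜 N M → VField 𝕜 N M → VField 𝕜 N M :=
      fun V W y => nabla W y (V y) - z • mul y (V y) (W y)
    D X (D Y Z) x - D Y (D X Z) x - D (VectorField.mlieBracket 𝓘(𝕜, Fin N → 𝕜) X Y) Z x = 0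
  flat_one : ∀ (x : M) (v : TangentSpace 𝓘(𝕜, Fin N → 𝕜) x), nabla one x v = 0
  /-- `𝒜_e` is the identity -/
  one_mul : ∀ (x : M) (v : TangentSpace 𝓘(𝕜, Fin N → 𝕜) x), mul x (one x) v = v

/-- A conformal Dubrovin manifold `(M, ∇^z, e, E, r)`: a Dubrovin manifold together with an Euler
vector field `E` and a real number `r`. -/
structure ConformalDubrovinManifold (𝕜 : Type*) [RCLike 𝕜] (N : ℕ) (M : Type*)
    [TopologicalSpace M] [ChartedSpace (Fin N → 𝕜) M] [IsManifold 𝓘(𝕜, Fin N → 𝕜) ∞ M]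
    extends DubrovinManifold 𝕜 N M where
  /-- the Euler vector field `E` -/
  euler : VField 𝕜 N M
  /-- the real number `r` -/
  r : ℝ
  smooth_euler : ∀ x : M, SmoothVFieldAt euler x
  /-- `E` is linear: the endomorphism `∇E` of `TM` is flat, `∇_X(∇_Y E) = ∇_{∇_X Y} E` -/
  linear_euler : ∀ (X Y : VField 𝕜 N M) (x : M), SmoothVFieldAt X x → SmoothVFieldAt Y x →
    nabla (fun y => nabla euler y (Y y)) x (X x) = nabla euler x (nabla Y x (X x))
  /-- `[E, X ∘ Y] = [E, X] ∘ Y + X ∘ [E, Y] + X ∘ Y` -/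
  euler_mul : ∀ (X Y : VField 𝕜 N M) (x : M), SmoothVFieldAt X x → SmoothVFieldAt Y x →
    VectorField.mlieBracket 𝓘(𝕜, Fin N → 𝕜) euler (fun y => mul y (X y) (Y y)) x
      = mul x (VectorField.mlieBracket 𝓘(𝕜, Fin N → 𝕜) euler X x) (Y x)
        + mul x (X x) (VectorField.mlieBracket 𝓘(𝕜, Fin N → 𝕜) euler Y x)
        + mul x (X x) (Y x)

/-- The powers `E^{∘ n}` of the Euler vector field, with `E^{∘ 0} = e`. -/
def eulerPow {𝕜 : Type*} [RCLike 𝕜] {N : ℕ} {M : Type*} [TopologicalSpace M]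
    [ChartedSpace (Fin N → 𝕜) M] [IsManifold 𝓘(𝕜, Fin N → 𝕜) ∞ M]
    (D : ConformalDubrovinManifold 𝕜 N M) : ℕ → VField 𝕜 N M
  | 0 => D.one
  | n + 1 => fun x => D.mul x (D.euler x) (eulerPow D n x)

/-! ## Flat coordinates -/

/-- The coordinate vector field `∂_a` of the chart `φ` (only meaningful on `φ.source`). -/
def chartFrame {𝕜 : Type*} [RCLike 𝕜] {N : ℕ} {M : Type*} [TopologicalSpace M]
    [ChartedSpace (Fin N → 𝕜) M] (φ : OpenPartialHomeomorph M (Fin N → 𝕜)) (a : Fin N) :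
    VField 𝕜 N M :=
  fun x => mfderiv 𝓘(𝕜, Fin N → 𝕜) 𝓘(𝕜, Fin N → 𝕜) φ.symm (φ x) (Pi.single a (1 : 𝕜) : Fin N → 𝕜)

/-- The components in the chart `φ` of a tangent vector `v` at `x ∈ φ.source`. -/
def chartComp {𝕜 : Type*} [RCLike 𝕜] {N : ℕ} {M : Type*} [TopologicalSpace M]
    [ChartedSpace (Fin N → 𝕜) M] (φ : OpenPartialHomeomorph M (Fin N → 𝕜)) (x : M)
    (v : TangentSpace 𝓘(𝕜, Fin N → 𝕜) x) : Fin N → 𝕜 :=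
  mfderiv 𝓘(𝕜, Fin N → 𝕜) 𝓘(𝕜, Fin N → 𝕜) φ x v

/-- A chart of `M` with coordinates `(u^a)` is flat if the one-forms `du^a` are parallel;
equivalently, if the dual frame `(∂_a)` is parallel. -/
def IsFlatChart {𝕜 : Type*} [RCLike 𝕜] {N : ℕ} {M : Type*} [TopologicalSpace M]
    [ChartedSpace (Fin N → 𝕜) M] [IsManifold 𝓘(𝕜, Fin N → 𝕜) ∞ M]
    (D : DubrovinManifold 𝕜 N M) (φ : OpenPartialHomeomorph M (Fin N → 𝕜)) : Prop :=
  φ ∈ IsManifold.maximalAtlas 𝓘(𝕜, Fin N → 𝕜) ∞ M ∧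
    ∀ (a : Fin N), ∀ x ∈ φ.source, ∀ v : TangentSpace 𝓘(𝕜, Fin N → 𝕜) x,
      D.nabla (chartFrame φ a) x v = 0

/-- What the jet calculus needs of a conformal Dubrovin manifold in a flat chart: the range of the
coordinates and the components of the tensors as functions of the coordinates `u`. Endomorphisms
`B` of the cotangent bundle are matrices `B_b^c`, with `b` the row and `c` the column, so that
`(B ω)_b = B_b^c ω_c`; composition is the matrix product. The adjoint is `X ↦ X ᵥ* B`. -/
structure FlatData (𝕜 : Type*) [RCLike 𝕜] (N : ℕ) where
  /-- the range of the coordinates -/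
  dom : Set (Fin N → 𝕜)
  /-- `A u a b c` is `𝒜_{ab}^c(u)`, where `∂_a ∘ ∂_b = 𝒜_{ab}^c ∂_c` -/
  A : (Fin N → 𝕜) → Fin N → Matrix (Fin N) (Fin N) 𝕜
  /-- the components of `e` -/
  e : (Fin N → 𝕜) → Fin N → 𝕜
  /-- the components of `E` -/
  E : (Fin N → 𝕜) → Fin N → 𝕜
  /-- the number `r` -/
  r : ℝ

/-- The conformal Dubrovin manifold `D` in the chart `φ`. -/
def ConformalDubrovinManifold.inChart {𝕜 : Type*} [RCLike 𝕜] {N : ℕ} {M : Type*}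
    [TopologicalSpace M] [ChartedSpace (Fin N → 𝕜) M] [IsManifold 𝓘(𝕜, Fin N → 𝕜) ∞ M]
    (D : ConformalDubrovinManifold 𝕜 N M) (φ : OpenPartialHomeomorph M (Fin N → 𝕜)) :
    FlatData 𝕜 N where
  dom := φ.target
  A u a := Matrix.of fun b c =>
    chartComp φ (φ.symm u)
      (D.mul (φ.symm u) (chartFrame φ a (φ.symm u)) (chartFrame φ b (φ.symm u))) c
  e u := chartComp φ (φ.symm u) (D.one (φ.symm u))
  E u := chartComp φ (φ.symm u) (D.euler (φ.symm u))
  r := D.r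

/-! ## The jet-space -/

/-- Coordinates `u ℓ a = u^a_ℓ` on the space of infinite jets, `u^a(t) = ∑_ℓ (t^ℓ / ℓ!) u^a_ℓ`. -/
abbrev Jet (𝕜 : Type*) (N : ℕ) : Type _ := ℕ → Fin N → 𝕜

/-- The vector field `∂_{ℓ,a} = ∂/∂u^a_ℓ`. -/
def jetPartial {𝕜 : Type*} [RCLike 𝕜] {N : ℕ} (l : ℕ) (a : Fin N) (f : Jet 𝕜 N → 𝕜) :
    Jet 𝕜 N → 𝕜 :=
  fun u => lineDeriv 𝕜 f u (Pi.single l (Pi.single a 1))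

/-- The vector field `∂ = ∑_ℓ u^a_{ℓ+1} ∂_{ℓ,a}`; the sum is finite on functions of finitely many
jet coordinates. -/
def jetD {𝕜 : Type*} [RCLike 𝕜] {N : ℕ} (f : Jet 𝕜 N → 𝕜) : Jet 𝕜 N → 𝕜 :=
  fun u => ∑ᶠ l : ℕ, ∑ a, u (l + 1) a * jetPartial l a f u

/-- The dilaton vector field `𝒬 = ∑_ℓ ℓ u^a_ℓ ∂_{ℓ,a}`. -/
def dilaton {𝕜 : Type*} [RCLike 𝕜] {N : ℕ} (f : Jet 𝕜 N → 𝕜) : Jet 𝕜 N → 𝕜 :=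
  fun u => ∑ᶠ l : ℕ, ∑ a, (l : 𝕜) * u l a * jetPartial l a f u

/-- The covariant derivative along `∂`, in flat coordinates, of a section of the pull-back of the
endomorphism bundle to the jet-space. -/
def jetDMat {𝕜 : Type*} [RCLike 𝕜] {N : ℕ} (B : Jet 𝕜 N → Matrix (Fin N) (Fin N) 𝕜) :
    Jet 𝕜 N → Matrix (Fin N) (Fin N) 𝕜 :=
  fun u => Matrix.of fun b c => jetD (fun v => B v b c) u

/-- The covariant derivative along `∂`, in flat coordinates, of a section of the pull-back of the
tangent bundle to the jet-space. -/
def jetDVec {𝕜 : Type*} [RCLike 𝕜] {N : ℕ} (V : Jet 𝕜 N → Fin N → 𝕜) : Jet 𝕜 N → Fin N → 𝕜 :=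
  fun u a => jetD (fun v => V v a) u

namespace FlatData

variable {𝕜 : Type*} [RCLike 𝕜] {N : ℕ} (G : FlatData 𝕜 N)

/-- `𝒳 = 𝒜_∂ = u^a_1 𝒜_a`. -/
def X (u : Jet 𝕜 N) : Matrix (Fin N) (Fin N) 𝕜 := ∑ a, u 1 a • G.A (u 0) a

/-- The open subset `J^∞_0 M` (over the chart) on which `𝒳` is invertible. -/
def J0 : Set (Jet 𝕜 N) := {u | u 0 ∈ G.dom ∧ IsUnit (G.X u).det}

/-- The algebra `𝒪_{∞,0}`: smooth functions on `J^∞_0 M` of finitely many jet coordinates. The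
values of `f` outside `J^∞_0 M` are irrelevant. -/
def IsJetFunction (f : Jet 𝕜 N → 𝕜) : Prop :=
  ∃ (n : ℕ) (g : (Fin (n + 1) → Fin N → 𝕜) → 𝕜),
    ContDiffOn 𝕜 ∞ g ((fun (u : Jet 𝕜 N) (i : Fin (n + 1)) => u i) '' G.J0) ∧
      ∀ u ∈ G.J0, f u = g (fun i => u i)

/-- `μ = 1 - r/2 + ∇_E - ℒ_E` on one-forms. In flat coordinates `∇_E(du^b) = 0` and
`ℒ_E(du^b) = ∂_a E^b du^a`. -/
def mu (u : Fin N → 𝕜) : Matrix (Fin N) (Fin N) 𝕜 :=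
  Matrix.of fun a b =>
    (if a = b then 1 - ((G.r : ℝ) : 𝕜) / 2 else 0)
      - fderiv 𝕜 (fun v => G.E v b) u (Pi.single a 1)

/-- `𝒰 = 𝒜_E`. -/
def U (u : Fin N → 𝕜) : Matrix (Fin N) (Fin N) 𝕜 := ∑ a, G.E u a • G.A u a

/-- `G.P l m` is the coefficient of `z^m` in the noncommutative Faà di Bruno polynomial
`𝒫_{l+1}(z) = (∂ + z𝒳)^l 𝒳`. -/
def P : ℕ → ℤ → Jet 𝕜 N → Matrix (Fin N) (Fin N) 𝕜
  | 0 => fun m => if m = 0 then G.X else 0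
  | l + 1 => fun m u => jetDMat (P l m) u + G.X u * P l (m - 1) u

/-- The generating function `σ(z) = ∑_ℓ 𝒫_{ℓ+1}(z) ∂_ℓ` of vector fields, `∂_ℓ = du^a ∂_{ℓ,a}`:
`G.sigma f m u a` is the component along `du^a` of the coefficient of `z^m` in the cotangent
vector `σ(z) f` at `u`. In other words, `G.sigma f m u a = (σ_{m,a} f)(u)`. -/
def sigma (f : Jet 𝕜 N → 𝕜) (m : ℤ) (u : Jet 𝕜 N) : Fin N → 𝕜 :=
  ∑ᶠ l : ℕ, G.P l m u *ᵥ (fun b => jetPartial l b f u)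

/-- The operator `δ_z = ∂_z + z^{-1}(μ + 1/2) + 𝒰` on series `∑_m z^m h_m` with cotangent
coefficients. -/
def delta (h : ℤ → Jet 𝕜 N → Fin N → 𝕜) : ℤ → Jet 𝕜 N → Fin N → 𝕜 :=
  fun m u =>
    ((m : 𝕜) + 1) • h (m + 1) u
      + (G.mu (u 0) + (1 / 2 : 𝕜) • (1 : Matrix (Fin N) (Fin N) 𝕜)) *ᵥ h (m + 1) u
      + G.U (u 0) *ᵥ h m u

/-- The recursion `s_1 = -(𝒳^*)^{-1} e`, `s_{k+1} = (𝒳^*)^{-1} ∂ s_k`; `G.sPos k` is `s_{k+1}`. -/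
def sPos : ℕ → Jet 𝕜 N → Fin N → 𝕜
  | 0 => fun u => -(G.e (u 0) ᵥ* (G.X u)⁻¹)
  | k + 1 => fun u => jetDVec (sPos k) u ᵥ* (G.X u)⁻¹

/-- The coefficients `s_k` of `s(z) = ∑_k z^{-k-1} s_k`, namely
`s_k = -((𝒳^*)^{-1} ∂)^{k-1} (𝒳^*)^{-1} e` for `k > 0`, and `s_k = 0` for `k ≤ 0`. -/
def s (k : ℤ) : Jet 𝕜 N → Fin N → 𝕜 :=
  if 0 < k then G.sPos (k - 1).toNat else 0

/-- The characterization of the generating function `s(z) = Θ^*(z) t(z)`: it is a series with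
coefficients in `TM_{∞,0}` such that `𝒬 s(z) = -s(z)` and
`σ_a(y) s(z) = ∂_a / (z - y) + z (𝒜_{σ_a(y)})^* s(z)`, where `1/(z-y) = ∑_{k ≥ 0} y^k z^{-k-1}`
and `𝒜_{σ_a(y)} = 𝒳_a^b 𝒜_b`. As a fundamental solution `Θ` satisfies
`X(Θ(z)) = z Θ(z) 𝒜_X`, this says that `t(z) = Θ^*(z)^{-1} s(z)` has `𝒬 t(z) = -t(z)` and
`Θ(y) σ(y) t(z) = Θ(y) Θ(z)^{-1} / (z - y)`. The equation is written as the equality of the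
coefficients of `y^k z^{-m-1}`. -/
structure IsPotential (s : ℤ → Jet 𝕜 N → Fin N → 𝕜) : Prop where
  isJetFunction : ∀ (m : ℤ) (c : Fin N), G.IsJetFunction (fun u => s m u c)
  dilaton : ∀ (m : ℤ) (c : Fin N), ∀ u ∈ G.J0, dilaton (fun v => s m v c) u = -s m u c
  sigma : ∀ (k : ℕ) (m : ℤ) (a c : Fin N), ∀ u ∈ G.J0,
    G.sigma (fun v => s m v c) k u a
      = (if (k : ℤ) = m ∧ a = c then 1 else 0)
        + (if k = 0 then (s (m + 1) u ᵥ* ∑ b, G.X u a b • G.A (u 0) b) c else 0)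

/-- The vector field `L_k = Res_{z=0} ⟨s(z), z δ_z^{k+1} σ(z)⟩`, for `k ≥ -1`. Here
`z h(z) = ∑_m z^{m+1} h_m`, so that the coefficient of `z^{-1}` in `⟨s(z), z h(z)⟩` is
`∑_m ⟨s_{m+1}, h_m⟩`, a finite sum when `h(z) = δ_z^{k+1} σ(z) f` with `f` a function of finitely
many jet coordinates. -/
def L (k : ℤ) (f : Jet 𝕜 N → 𝕜) : Jet 𝕜 N → 𝕜 :=
  fun u => ∑ᶠ m : ℤ, G.s (m + 1) u ⬝ᵥ (G.delta^[(k + 1).toNat] (G.sigma f)) m u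

end FlatData

end

/-! The jet-space part is the geometry of the pencil pulled back to $J^\infty_0M$. To a series
$w(z)=\sum_n z^{-n-1}w_n$ of tangent vectors attach the vector field `flow w`
$=\operatorname{Res}_{z=0}\langle w(z),\sigma(z)\rangle$, and for a vector field $D$ let `cov D` be
$\nabla_D=D-z(\mathcal A_D)^*$. Flatness of the pencil becomes
$[\nabla_D,\nabla_{D'}]=\nabla_{[D,D']}$ (`IsVF.cov_lie`), and the recursion defining $\sigma$
becomes $[\partial,\mathrm{flow}\,w]=\mathrm{flow}(\nabla_\partial w)$ (`tot_lie_flow`).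

Two identities carry everything. First, the flows have no torsion:
$[\mathrm{flow}\,v,\mathrm{flow}\,w]=\mathrm{flow}(\nabla_{\mathrm{flow}\,v}w-\nabla_{\mathrm{flow}\,w}v)$
(`flow_lie_flow`). Second, $\nabla_{\mathrm{flow}\,w}s$ is the part of $w$ in negative powers of $z$
(`cov_flow_s`); on basis series $w$ this is the equation for $\sigma_a(y)s(z)$. Both have the same
proof: the defect is compatible with $\partial$, so its vanishing at the lowest level spreads to all
levels.

Moving $\delta_z$ to the other side of the pairing, $L_k$ is the flow of
$w_{k+1}=(\delta_z^*)^{k+1}(zs)$. Since $\delta_z^*$ commutes with every $\nabla_D$ and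
$[\delta_z^*,z]=-1$, one finds $\nabla_{\mathrm{flow}\,w_j}w_k=zw_{j+k}-kw_{j+k-1}$.
Antisymmetrizing cancels the first term, and absence of torsion gives the Virasoro relations
(`virasoro_lie`).

Uniqueness of $s$: a component of the difference of two solutions is killed by all $\sigma_k$,
$k\ge1$. As the leading coefficient $\mathcal X^{\ell+1}$ of $(\partial+z\mathcal X)^\ell\mathcal X$
is invertible, it depends on $u_0$ only; then $\mathcal Q$ kills it, while it has dilaton degree
$-1$.

This algebra takes place in an abstract `JetCalculus`; `FlatData.calculus` shows that $\mathcal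
O_{\infty,0}$ is an instance, using the structure equations of $M$ in a flat chart
(`isConformal_inChart`).

The last claim is separate. Smooth vector fields form a commutative ring under $\circ$, and the part
of the curvature linear in $z$ says that $(\nabla_X\circ)(Y,Z)$ is symmetric in $X,Y$. This implies
the Hertling–Manin identity (`lieMul_mul`), hence $\mathcal L_{E^{\circ
n}}(\circ)=nE^{\circ(n-1)}\circ(\cdot\circ\cdot)$, and the brackets of powers follow by induction.
-/

noncomputable section

/-! ## Derivations acting on vectors and matrices -/

namespace Derivation

variable {𝕜 R : Type*} [CommRing 𝕜] [CommRing R] [Algebra 𝕜 R] {N : ℕ}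

/-- Componentwise action of a derivation on vectors. -/
def vec (D : Derivation 𝕜 R R) (v : Fin N → R) : Fin N → R := fun a => D (v a)

/-- Componentwise action of a derivation on matrices. -/
def mat (D : Derivation 𝕜 R R) (B : Matrix (Fin N) (Fin N) R) : Matrix (Fin N) (Fin N) R :=
  Matrix.of fun a b => D (B a b)

variable (D D' : Derivation 𝕜 R R) (v w : Fin N → R) (B C : Matrix (Fin N) (Fin N) R)

@[simp] lemma vec_apply (a : Fin N) : D.vec v a = D (v a) := rfl

@[simp] lemma mat_apply (a b : Fin N) : D.mat B a b = D (B a b) := rfl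

@[simp] lemma vec_zero : D.vec (0 : Fin N → R) = 0 := by ext; simp

lemma vec_add : D.vec (v + w) = D.vec v + D.vec w := by ext; simp

lemma vec_sub : D.vec (v - w) = D.vec v - D.vec w := by ext; simp

lemma vec_neg : D.vec (-v) = -D.vec v := by ext; simp

lemma vec_vecMul : D.vec (v ᵥ* B) = D.vec v ᵥ* B + v ᵥ* D.mat B := by
  ext b
  simp only [vec_apply, Matrix.vecMul, dotProduct, map_sum, leibniz, Pi.add_apply, mat_apply,
    smul_eq_mul, Finset.sum_add_distrib]
  rw [add_comm]
  congr 1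
  exact Finset.sum_congr rfl fun a _ => mul_comm _ _

lemma mat_mul : D.mat (B * C) = D.mat B * C + B * D.mat C := by
  ext a b
  simp only [mat_apply, Matrix.mul_apply, map_sum, leibniz, Matrix.add_apply,
    smul_eq_mul, Finset.sum_add_distrib]
  rw [add_comm]
  congr 1
  exact Finset.sum_congr rfl fun a _ => mul_comm _ _

lemma vec_lie : (⁅D, D'⁆ : Derivation 𝕜 R R).vec v = D.vec (D'.vec v) - D'.vec (D.vec v) := by
  ext a
  simp [commutator_apply]

lemma vec_intCast_smul (n : ℤ) : D.vec ((n : R) • v) = (n : R) • D.vec v := by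
  ext a
  simp [leibniz]

lemma vec_finset_sum {ι : Type*} (s : Finset ι) (f : ι → Fin N → R) :
    D.vec (∑ i ∈ s, f i) = ∑ i ∈ s, D.vec (f i) := by
  ext a
  simp

end Derivation

/-! ## Abstract jet calculus -/

/-- An algebra of functions of infinitely many jet coordinates `x l a` with commuting partial
derivatives `p l a`, together with the tensors of a conformal Dubrovin manifold in flat
coordinates; `nu` stands for `μ + 1/2`. -/
structure JetCalculus (𝕜 R : Type*) [CommRing 𝕜] [CommRing R] [Algebra 𝕜 R] (N : ℕ) where
  p : ℕ → Fin N → Derivation 𝕜 R R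
  x : ℕ → Fin N → R
  p_comm : ∀ l a l' a' f, p l a (p l' a' f) = p l' a' (p l a f)
  p_fin : ∀ f, ∃ n, ∀ l, n ≤ l → ∀ a, p l a f = 0
  p_x : ∀ l a l' a', p l a (x l' a') = if l = l' ∧ a = a' then 1 else 0
  A : Fin N → Matrix (Fin N) (Fin N) R
  A_comm : ∀ a b c, A a b c = A b a c
  A_mul_comm : ∀ a b, A a * A b = A b * A a
  A_base : ∀ l d a b c, p (l + 1) d (A a b c) = 0
  A_flat : ∀ d a b c, p 0 d (A a b c) = p 0 a (A d b c)
  e : Fin N → R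
  e_const : ∀ l a c, p l a (e c) = 0
  e_unit : ∑ a, e a • A a = 1
  U : Matrix (Fin N) (Fin N) R
  nu : Matrix (Fin N) (Fin N) R
  U_base : ∀ l d b c, p (l + 1) d (U b c) = 0
  nu_const : ∀ l d b c, p l d (nu b c) = 0
  U_comm : ∀ a, U * A a = A a * U
  U_flat : ∀ c, (p 0 c).mat U = A c + (nu * A c - A c * nu)
  Xi : Matrix (Fin N) (Fin N) R
  X_mul_Xi : (∑ a, x 1 a • A a) * Xi = 1

namespace JetCalculus

variable {𝕜 R : Type*} [CommRing 𝕜] [CommRing R] [Algebra 𝕜 R] {N : ℕ} (J : JetCalculus 𝕜 R N)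

/-! ### Vector fields on the jet-space -/

lemma support_subset (c : ℕ → Fin N → R) {f : R} {n : ℕ} (h : ∀ l, n ≤ l → ∀ a, J.p l a f = 0) :
    (Function.support fun l => ∑ a, c l a * J.p l a f) ⊆ (Finset.range n : Set ℕ) := by
  intro l hl
  by_contra hn
  refine hl (Finset.sum_eq_zero fun a _ => ?_)
  rw [h l (by simpa using hn), mul_zero]

lemma finsum_eq_sum_range (c : ℕ → Fin N → R) {f : R} {n : ℕ}
    (h : ∀ l, n ≤ l → ∀ a, J.p l a f = 0) :
    ∑ᶠ l, ∑ a, c l a * J.p l a f = ∑ l ∈ Finset.range n, ∑ a, c l a * J.p l a f :=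
  finsum_eq_sum_of_support_subset _ (J.support_subset c h)

/-- The vector field `∑_l c_l^a ∂_{l,a}`. -/
def vf (c : ℕ → Fin N → R) : Derivation 𝕜 R R :=
  Derivation.mk'
    { toFun := fun f => ∑ᶠ l, ∑ a, c l a * J.p l a f
      map_add' := fun f g => by
        obtain ⟨n, hn⟩ := J.p_fin f
        obtain ⟨m, hm⟩ := J.p_fin g
        have h1 : ∀ l, max n m ≤ l → ∀ a, J.p l a f = 0 := fun l hl => hn l (le_of_max_le_left hl)
        have h2 : ∀ l, max n m ≤ l → ∀ a, J.p l a g = 0 := fun l hl => hm l (le_of_max_le_right hl)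
        rw [J.finsum_eq_sum_range c h1, J.finsum_eq_sum_range c h2,
          J.finsum_eq_sum_range c (n := max n m)
            (fun l hl a => by rw [map_add, h1 l hl, h2 l hl, add_zero])]
        simp only [map_add, mul_add, Finset.sum_add_distrib]
      map_smul' := fun r f => by
        obtain ⟨n, hn⟩ := J.p_fin f
        rw [J.finsum_eq_sum_range c hn, J.finsum_eq_sum_range c (n := n)
            (fun l hl a => by rw [Derivation.map_smul, hn l hl, smul_zero])]
        simp only [Derivation.map_smul, mul_smul_comm, ← Finset.smul_sum, RingHom.id_apply] }
    (fun f g => by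
      obtain ⟨n, hn⟩ := J.p_fin f
      obtain ⟨m, hm⟩ := J.p_fin g
      have h1 : ∀ l, max n m ≤ l → ∀ a, J.p l a f = 0 := fun l hl => hn l (le_of_max_le_left hl)
      have h2 : ∀ l, max n m ≤ l → ∀ a, J.p l a g = 0 := fun l hl => hm l (le_of_max_le_right hl)
      change ∑ᶠ l, ∑ a, c l a * J.p l a (f * g) = f • ∑ᶠ l, ∑ a, c l a * J.p l a g
        + g • ∑ᶠ l, ∑ a, c l a * J.p l a f
      rw [J.finsum_eq_sum_range c h1, J.finsum_eq_sum_range c h2,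
        J.finsum_eq_sum_range c (n := max n m) (fun l hl a => by simp [h1 l hl, h2 l hl])]
      simp only [smul_eq_mul, Finset.mul_sum, ← Finset.sum_add_distrib, Derivation.leibniz]
      refine Finset.sum_congr rfl fun l _ => Finset.sum_congr rfl fun a _ => ?_
      ring)

lemma vf_apply (c : ℕ → Fin N → R) (f : R) : J.vf c f = ∑ᶠ l, ∑ a, c l a * J.p l a f := rfl

lemma vf_eq_sum (c : ℕ → Fin N → R) {f : R} {n : ℕ} (h : ∀ l, n ≤ l → ∀ a, J.p l a f = 0) :
    J.vf c f = ∑ l ∈ Finset.range n, ∑ a, c l a * J.p l a f :=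
  J.finsum_eq_sum_range c h

lemma p_x_of_lt {l l' : ℕ} (h : l' < l) (a a' : Fin N) : J.p l a (J.x l' a') = 0 := by
  rw [J.p_x, if_neg (by omega)]

@[simp] lemma vf_x (c : ℕ → Fin N → R) (l : ℕ) (a : Fin N) : J.vf c (J.x l a) = c l a := by
  rw [J.vf_eq_sum c (n := l + 1) (fun l' hl' a' => J.p_x_of_lt (by omega) a' a)]
  rw [Finset.sum_eq_single l, Finset.sum_eq_single a]
  · simp [J.p_x]
  · intro b _ hb
    simp [J.p_x, hb]
  · simp
  · intro l' _ hl'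
    simp [J.p_x, hl']
  · simp

/-- A derivation which is of the form `∑_l c_l^a ∂_{l,a}`. -/
def IsVF (D : Derivation 𝕜 R R) : Prop := D = J.vf fun l a => D (J.x l a)

lemma isVF_vf (c : ℕ → Fin N → R) : J.IsVF (J.vf c) := by
  unfold IsVF
  simp

variable {J}

/-- A derivation of an abstract algebra need not be determined by its values on coordinates, which
is why `IsVF` is carried along. -/
lemma IsVF.ext {D D' : Derivation 𝕜 R R} (h : J.IsVF D) (h' : J.IsVF D')
    (hx : ∀ l a, D (J.x l a) = D' (J.x l a)) : D = D' := by
  rw [h, h']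
  simp only [hx]

lemma IsVF.apply_eq_sum {D : Derivation 𝕜 R R} (h : J.IsVF D) {f : R} {n : ℕ}
    (hf : ∀ l, n ≤ l → ∀ a, J.p l a f = 0) :
    D f = ∑ l ∈ Finset.range n, ∑ a, D (J.x l a) * J.p l a f := by
  conv_lhs => rw [h]
  exact J.vf_eq_sum _ hf

lemma isVF_of_apply_eq_sum {D : Derivation 𝕜 R R}
    (h : ∀ (f : R) (n : ℕ), (∀ l, n ≤ l → ∀ a, J.p l a f = 0) →
      D f = ∑ l ∈ Finset.range n, ∑ a, D (J.x l a) * J.p l a f) : J.IsVF D := by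
  refine Derivation.ext fun f => ?_
  obtain ⟨n, hn⟩ := J.p_fin f
  rw [h f n hn, J.vf_eq_sum _ hn]

lemma IsVF.sub {D D' : Derivation 𝕜 R R} (h : J.IsVF D) (h' : J.IsVF D') : J.IsVF (D - D') := by
  refine isVF_of_apply_eq_sum fun f n hf => ?_
  simp only [Derivation.sub_apply, sub_mul, Finset.sum_sub_distrib, h.apply_eq_sum hf,
    h'.apply_eq_sum hf]

/-- The second-order terms of the two compositions agree, because partial derivatives commute; only
first-order terms survive in the bracket. -/
lemma IsVF.lie {D D' : Derivation 𝕜 R R} (h : J.IsVF D) (h' : J.IsVF D') : J.IsVF ⁅D, D'⁆ := by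
  refine isVF_of_apply_eq_sum fun f n hf => ?_
  have key : ∀ {D D' : Derivation 𝕜 R R}, J.IsVF D → J.IsVF D' → D (D' f)
      = ∑ l ∈ Finset.range n, ∑ a, D (D' (J.x l a)) * J.p l a f
        + ∑ l ∈ Finset.range n, ∑ a, ∑ l' ∈ Finset.range n, ∑ a',
          D' (J.x l a) * D (J.x l' a') * J.p l' a' (J.p l a f) := by
    intro D D' h h'
    rw [h'.apply_eq_sum hf]
    simp only [map_sum, Derivation.leibniz, smul_eq_mul, Finset.sum_add_distrib]
    rw [add_comm]
    congr 1
    · refine Finset.sum_congr rfl fun l _ => Finset.sum_congr rfl fun a _ => mul_comm _ _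
    · refine Finset.sum_congr rfl fun l _ => Finset.sum_congr rfl fun a _ => ?_
      rw [h.apply_eq_sum (f := J.p l a f) (n := n)
        (fun l' hl' a' => by rw [J.p_comm, hf l' hl', map_zero])]
      simp only [Finset.mul_sum, mul_assoc]
  rw [Derivation.commutator_apply, key h h', key h' h]
  have swap : ∑ l ∈ Finset.range n, ∑ a, ∑ l' ∈ Finset.range n, ∑ a',
        D' (J.x l a) * D (J.x l' a') * J.p l' a' (J.p l a f)
      = ∑ l ∈ Finset.range n, ∑ a, ∑ l' ∈ Finset.range n, ∑ a',
        D (J.x l a) * D' (J.x l' a') * J.p l' a' (J.p l a f) := by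
    simp only [← Finset.sum_product']
    exact Finset.sum_nbij' (fun q => (q.2.2.1, q.2.2.2, q.1, q.2.1))
      (fun q => (q.2.2.1, q.2.2.2, q.1, q.2.1)) (by simp +contextual) (by simp +contextual)
      (by simp) (by simp) (fun q _ => by rw [J.p_comm]; ring)
  rw [swap, add_sub_add_right_eq_sub, ← Finset.sum_sub_distrib]
  simp only [← Finset.sum_sub_distrib, ← sub_mul, Derivation.commutator_apply]

lemma IsVF.apply_base {D : Derivation 𝕜 R R} (h : J.IsVF D) {f : R}
    (hf : ∀ l a, J.p (l + 1) a f = 0) : D f = ∑ a, D (J.x 0 a) * J.p 0 a f := by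
  rw [h.apply_eq_sum (n := 1) (fun l hl a => by
    obtain ⟨l, rfl⟩ := Nat.exists_eq_add_of_le' hl
    exact hf l a)]
  simp

lemma IsVF.apply_const {D : Derivation 𝕜 R R} (h : J.IsVF D) {f : R}
    (hf : ∀ l a, J.p l a f = 0) : D f = 0 := by
  rw [h.apply_eq_sum (n := 0) (fun l _ a => hf l a)]
  simp

variable (J)

/-! ### The product -/

/-- The adjoint of the multiplication by the tangent vector `v`. -/
def mul (v : Fin N → R) : Matrix (Fin N) (Fin N) R := ∑ a, v a • J.A a

lemma mul_apply (v : Fin N → R) (b c : Fin N) : J.mul v b c = ∑ a, v a * J.A a b c := by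
  simp [mul, Matrix.sum_apply]

lemma mul_sub (v w : Fin N → R) : J.mul (v - w) = J.mul v - J.mul w := by
  simp [mul, sub_smul, Finset.sum_sub_distrib]

lemma mul_e : J.mul J.e = 1 := J.e_unit

lemma vecMul_mul_comm (v w : Fin N → R) : v ᵥ* J.mul w = w ᵥ* J.mul v := by
  ext c
  simp only [Matrix.vecMul, dotProduct, mul_apply, Finset.mul_sum]
  rw [Finset.sum_comm]
  refine Finset.sum_congr rfl fun a _ => Finset.sum_congr rfl fun b _ => ?_
  rw [J.A_comm]
  ring

lemma e_vecMul_mul (w : Fin N → R) : J.e ᵥ* J.mul w = w := by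
  rw [vecMul_mul_comm, mul_e, Matrix.vecMul_one]

/-- Associativity in structure constants: symmetry of the lower indices together with commuting
multiplications. -/
lemma sum_A_smul_A (a b : Fin N) : ∑ c, J.A b a c • J.A c = J.A a * J.A b := by
  ext d f
  have h1 : (∑ c, J.A b a c • J.A c) d f = (J.A b * J.A d) a f := by
    simp only [Matrix.sum_apply, Matrix.smul_apply, smul_eq_mul, Matrix.mul_apply]
    exact Finset.sum_congr rfl fun c _ => by rw [J.A_comm c d]
  have h2 : (J.A d * J.A b) a f = (J.A a * J.A b) d f := by
    simp only [Matrix.mul_apply]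
    exact Finset.sum_congr rfl fun c _ => by rw [J.A_comm d a]
  rw [h1, J.A_mul_comm, h2]

lemma mul_vecMul_mul (v w : Fin N → R) : J.mul (v ᵥ* J.mul w) = J.mul v * J.mul w := by
  have h : J.mul v * J.mul w = ∑ a, ∑ b, (v a * w b) • (J.A a * J.A b) := by
    simp only [mul, Finset.sum_mul, Finset.mul_sum, Matrix.smul_mul, Matrix.mul_smul, smul_smul]
    rw [Finset.sum_comm]
    exact Finset.sum_congr rfl fun a _ => Finset.sum_congr rfl fun b _ => by rw [mul_comm]
  rw [h]
  simp only [← sum_A_smul_A, Finset.smul_sum, smul_smul]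
  simp only [mul, Matrix.vecMul, dotProduct, Matrix.sum_apply, Matrix.smul_apply, smul_eq_mul,
    Finset.mul_sum, Finset.sum_smul, mul_assoc]
  rw [Finset.sum_comm]
  refine Finset.sum_congr rfl fun a _ => ?_
  rw [Finset.sum_comm]

lemma mul_commute (v w : Fin N → R) : J.mul v * J.mul w = J.mul w * J.mul v := by
  rw [← mul_vecMul_mul, vecMul_mul_comm, mul_vecMul_mul]

lemma mat_mul_apply (D : Derivation 𝕜 R R) (v : Fin N → R) :
    D.mat (J.mul v) = J.mul (D.vec v) + ∑ a, v a • D.mat (J.A a) := by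
  ext b c
  simp only [Derivation.mat_apply, mul_apply, map_sum, Derivation.leibniz, smul_eq_mul,
    Matrix.add_apply, Matrix.sum_apply, Matrix.smul_apply, Derivation.vec_apply,
    Finset.sum_add_distrib]
  rw [add_comm]
  congr 1
  exact Finset.sum_congr rfl fun a _ => mul_comm _ _

variable {J}

lemma IsVF.sum_smul_mat_comm {D D' : Derivation 𝕜 R R} (h : J.IsVF D) (h' : J.IsVF D') :
    ∑ a, D' (J.x 0 a) • D.mat (J.A a) = ∑ a, D (J.x 0 a) • D'.mat (J.A a) := by
  ext b c
  simp only [Matrix.sum_apply, Matrix.smul_apply, Derivation.mat_apply, smul_eq_mul]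
  simp only [h.apply_base (fun l d => J.A_base l d _ b c),
    h'.apply_base (fun l d => J.A_base l d _ b c), Finset.mul_sum]
  rw [Finset.sum_comm]
  refine Finset.sum_congr rfl fun a _ => Finset.sum_congr rfl fun d _ => ?_
  rw [J.A_flat]
  ring

/-- `A_flat` says that the matrix-valued one-form $\mathcal A$ is closed; this is $d\mathcal
A(D,D')=0$ for its pull-back to the jet-space. -/
lemma IsVF.mat_mul_sub {D D' : Derivation 𝕜 R R} (h : J.IsVF D) (h' : J.IsVF D') :
    D.mat (J.mul (D'.vec (J.x 0))) - D'.mat (J.mul (D.vec (J.x 0)))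
      = J.mul ((⁅D, D'⁆ : Derivation 𝕜 R R).vec (J.x 0)) := by
  rw [mat_mul_apply, mat_mul_apply, Derivation.vec_lie, mul_sub]
  simp only [Derivation.vec_apply, h.sum_smul_mat_comm h']
  abel

/-! ### The pencil of flat connections -/

variable (J)

/-- The covariant derivative `D - z (𝒜_D)^*` on series `∑_n z^{-n-1} v_n` with tangent
coefficients. -/
def cov (D : Derivation 𝕜 R R) (v : ℤ → Fin N → R) : ℤ → Fin N → R :=
  fun n => D.vec (v n) - v (n + 1) ᵥ* J.mul (D.vec (J.x 0))

lemma cov_sub (D : Derivation 𝕜 R R) (v w : ℤ → Fin N → R) :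
    J.cov D (v - w) = J.cov D v - J.cov D w := by
  ext n : 1
  simp only [cov, Pi.sub_apply, Derivation.vec_sub, Matrix.sub_vecMul]
  abel

variable {J}

/-- Flatness of the pulled-back pencil: the terms linear in $z$ cancel because $\mathcal A$ is
closed, the quadratic ones because multiplications commute. -/
lemma IsVF.cov_lie {D D' : Derivation 𝕜 R R} (h : J.IsVF D) (h' : J.IsVF D')
    (v : ℤ → Fin N → R) :
    J.cov ⁅D, D'⁆ v = J.cov D (J.cov D' v) - J.cov D' (J.cov D v) := by
  ext n : 1
  unfold cov
  rw [← h.mat_mul_sub h', Derivation.vec_lie]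
  simp only [Pi.sub_apply, Derivation.vec_sub, Derivation.vec_vecMul,
    Matrix.sub_vecMul, Matrix.vecMul_sub, Matrix.vecMul_vecMul]
  rw [J.mul_commute (D'.vec (J.x 0))]
  abel

/-! ### Flows of the generating function and their torsion. -/

variable (J)

/-- The derivation `∂`. -/
def tot : Derivation 𝕜 R R := J.vf fun l => J.x (l + 1)

lemma isVF_tot : J.IsVF J.tot := J.isVF_vf _

@[simp] lemma tot_x (l : ℕ) (a : Fin N) : J.tot (J.x l a) = J.x (l + 1) a := J.vf_x _ l a

lemma tot_vec_x (l : ℕ) : J.tot.vec (J.x l) = J.x (l + 1) := by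
  ext a
  simp

/-- The endomorphism `𝒳`. -/
abbrev X : Matrix (Fin N) (Fin N) R := J.mul (J.x 1)

lemma X_mul : J.X * J.Xi = 1 := J.X_mul_Xi

lemma eq_of_vecMul_X {v w : Fin N → R} (h : v ᵥ* J.X = w ᵥ* J.X) : v = w := by
  have := congrArg (· ᵥ* J.Xi) h
  simpa [Matrix.vecMul_vecMul, J.X_mul] using this

/-- The components of the vector field `∑_m ⟨w_m, σ_m⟩`. -/
def coef : ℕ → (ℤ → Fin N → R) → Fin N → R
  | 0, w => w 0 ᵥ* J.X
  | l + 1, w => J.tot.vec (coef l w) - coef l (J.cov J.tot w)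

/-- The vector field `∑_m ⟨w_m, σ_m⟩` where `σ(z) = ∑_m z^m σ_m`. -/
def flow (w : ℤ → Fin N → R) : Derivation 𝕜 R R := J.vf fun l => J.coef l w

lemma isVF_flow (w : ℤ → Fin N → R) : J.IsVF (J.flow w) := J.isVF_vf _

lemma flow_vec_x (w : ℤ → Fin N → R) (l : ℕ) : (J.flow w).vec (J.x l) = J.coef l w := by
  ext a
  exact J.vf_x _ l a

lemma flow_x (w : ℤ → Fin N → R) (l : ℕ) (a : Fin N) : J.flow w (J.x l a) = J.coef l w a :=
  J.vf_x _ l a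

/-- The recursion in `coef` is this identity evaluated on the coordinates. -/
lemma tot_lie_flow (w : ℤ → Fin N → R) : ⁅J.tot, J.flow w⁆ = J.flow (J.cov J.tot w) := by
  refine (J.isVF_tot.lie (J.isVF_flow w)).ext (J.isVF_flow _) fun l a => ?_
  rw [Derivation.commutator_apply, flow_x, tot_x, flow_x, flow_x, coef]
  simp

lemma coef_sub (l : ℕ) (v w : ℤ → Fin N → R) :
    J.coef l (v - w) = J.coef l v - J.coef l w := by
  induction l generalizing v w with
  | zero => simp [coef, Matrix.sub_vecMul]
  | succ l ih =>
    simp only [coef, cov_sub, ih, Derivation.vec_sub]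
    abel

lemma flow_sub (v w : ℤ → Fin N → R) : J.flow (v - w) = J.flow v - J.flow w :=
  (J.isVF_flow _).ext ((J.isVF_flow _).sub (J.isVF_flow _)) fun l a => by
    simp [flow_x, coef_sub]

/-- Torsion of the flows. -/
def torsion (v w : ℤ → Fin N → R) : Derivation 𝕜 R R :=
  ⁅J.flow v, J.flow w⁆ - J.flow (J.cov (J.flow v) w - J.cov (J.flow w) v)

lemma isVF_torsion (v w : ℤ → Fin N → R) : J.IsVF (J.torsion v w) :=
  ((J.isVF_flow v).lie (J.isVF_flow w)).sub (J.isVF_flow _)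

/-- Jacobi's identity for the bracket term and flatness along $\partial$ and a flow for the other:
bracketing with $\partial$ acts on the torsion by the Leibniz rule. -/
lemma tot_lie_torsion (v w : ℤ → Fin N → R) :
    ⁅J.tot, J.torsion v w⁆ = J.torsion (J.cov J.tot v) w + J.torsion v (J.cov J.tot w) := by
  have h1 := J.isVF_tot.cov_lie (J.isVF_flow v) w
  have h2 := J.isVF_tot.cov_lie (J.isVF_flow w) v
  rw [tot_lie_flow] at h1 h2
  simp only [torsion, lie_sub, tot_lie_flow, h1, h2, flow_sub,
    leibniz_lie J.tot (J.flow v)]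
  abel

/-- Closedness of $\mathcal A$ on the pair $\partial$, `flow w`, solved for the derivative of
$\mathcal X=\mathcal A_\partial$. -/
lemma mat_flow_X (w : ℤ → Fin N → R) :
    (J.flow w).mat J.X = (∑ a, w 0 a • J.tot.mat (J.A a)) * J.X + J.mul (w 0) * J.tot.mat J.X
      + J.mul (w 1) * J.X * J.X := by
  have h0 : J.tot.vec (J.x 0) = J.x 1 := J.tot_vec_x 0
  have h := J.isVF_tot.mat_mul_sub (J.isVF_flow w)
  rw [tot_lie_flow, flow_vec_x, flow_vec_x, h0] at h
  simp only [coef, cov, h0, mul_vecMul_mul, mul_sub, Derivation.mat_mul, mat_mul_apply J _ (w 0),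
    zero_add, add_mul, sub_mul] at h
  rw [sub_eq_iff_eq_add, ← sub_eq_iff_eq_add'] at h
  rw [← h]
  abel

/-- Expanded by `mat_flow_X`, each half of the torsion on $u_0$ (`key`) is symmetric in $v$ and $w$,
so the halves cancel. -/
lemma torsion_x_zero (v w : ℤ → Fin N → R) : (J.torsion v w).vec (J.x 0) = 0 := by
  have key : ∀ v w : ℤ → Fin N → R,
      (J.flow v).vec (J.coef 0 w) - J.cov (J.flow v) w 0 ᵥ* J.X
        = w 0 ᵥ* (∑ a, v 0 a • J.tot.mat (J.A a)) ᵥ* J.X + w 0 ᵥ* J.mul (v 0) ᵥ* J.tot.mat J.X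
          + w 0 ᵥ* J.mul (v 1) ᵥ* (J.X * J.X) + w 1 ᵥ* J.mul (v 0) ᵥ* (J.X * J.X) := by
    intro v w
    simp only [coef, cov, Derivation.vec_vecMul, mat_flow_X, flow_vec_x, mul_vecMul_mul,
      Matrix.sub_vecMul, Matrix.vecMul_add, Matrix.vecMul_vecMul, Matrix.mul_assoc, zero_add]
    abel
  have hs : w 0 ᵥ* (∑ a, v 0 a • J.tot.mat (J.A a)) = v 0 ᵥ* (∑ a, w 0 a • J.tot.mat (J.A a)) := by
    ext c
    simp only [Matrix.vecMul, dotProduct, Matrix.sum_apply, Matrix.smul_apply, smul_eq_mul,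
      Derivation.mat_apply, Finset.mul_sum]
    rw [Finset.sum_comm]
    refine Finset.sum_congr rfl fun a _ => Finset.sum_congr rfl fun b _ => ?_
    rw [J.A_comm]
    ring
  have h : (J.torsion v w).vec (J.x 0) = ((J.flow v).vec (J.coef 0 w) - J.cov (J.flow v) w 0 ᵥ* J.X)
      - ((J.flow w).vec (J.coef 0 v) - J.cov (J.flow w) v 0 ᵥ* J.X) := by
    have : (J.torsion v w).vec (J.x 0) = (⁅J.flow v, J.flow w⁆ : Derivation 𝕜 R R).vec (J.x 0)
        - (J.flow (J.cov (J.flow v) w - J.cov (J.flow w) v)).vec (J.x 0) := by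
      ext a
      simp [torsion]
    rw [this, Derivation.vec_lie, flow_vec_x, flow_vec_x, flow_vec_x, coef_sub]
    simp only [coef]
    abel
  rw [h, key, key, hs, J.vecMul_mul_comm (w 0) (v 0), J.vecMul_mul_comm (w 0) (v 1),
    J.vecMul_mul_comm (w 1) (v 0)]
  abel

/-- Induction on the jet order, for all $v,w$ at once: $u_{\ell+1}=\partial u_\ell$, and commuting
the torsion past $\partial$ produces only torsions with other arguments, again applied to $u_\ell$.
-/
lemma torsion_eq_zero (v w : ℤ → Fin N → R) : J.torsion v w = 0 := by
  have key : ∀ (l : ℕ) (v w : ℤ → Fin N → R) (a : Fin N), J.torsion v w (J.x l a) = 0 := by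
    intro l
    induction l with
    | zero => exact fun v w a => congrFun (J.torsion_x_zero v w) a
    | succ l ih =>
      intro v w a
      have h := DFunLike.congr_fun (J.tot_lie_torsion v w) (J.x l a)
      simp only [Derivation.commutator_apply, Derivation.add_apply, ih, map_zero, tot_x,
        add_zero, zero_sub, neg_eq_zero] at h
      exact h
  rw [J.isVF_torsion v w]
  simp only [key]
  refine Derivation.ext fun f => ?_
  simp [vf_apply]

/-- The pencil of connections on the flows has no torsion. -/
theorem flow_lie_flow (v w : ℤ → Fin N → R) :
    ⁅J.flow v, J.flow w⁆ = J.flow (J.cov (J.flow v) w - J.cov (J.flow w) v) :=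
  sub_eq_zero.1 (J.torsion_eq_zero v w)

end JetCalculus

namespace JetCalculus

variable {𝕜 R : Type*} [CommRing 𝕜] [CommRing R] [Algebra 𝕜 R] {N : ℕ} (J : JetCalculus 𝕜 R N)

/-! ### The potential -/

/-- The coefficients `s_{k+1}`. -/
def sPos : ℕ → Fin N → R
  | 0 => -(J.e ᵥ* J.Xi)
  | k + 1 => J.tot.vec (sPos k) ᵥ* J.Xi

/-- The coefficients `s_k` of the series `s(z) = ∑_k z^{-k-1} s_k`. -/
def s (k : ℤ) : Fin N → R := if 0 < k then J.sPos (k - 1).toNat else 0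

lemma s_of_nonpos {k : ℤ} (hk : k ≤ 0) : J.s k = 0 := if_neg (by omega)

lemma s_succ (k : ℕ) : J.s (k + 1) = J.sPos k := by
  rw [s, if_pos (by omega)]
  simp

lemma Xi_mul : J.Xi * J.X = 1 := mul_eq_one_comm.1 J.X_mul

lemma vec_e {D : Derivation 𝕜 R R} (hD : J.IsVF D) : D.vec J.e = 0 := by
  ext c
  exact hD.apply_const fun l a => J.e_const l a c

/-- The recursion for the $s_k$ makes $s$ parallel along $\partial$ except for $z^{-1}e$, which
comes from the initial value $s_1$. -/
lemma cov_tot_s : J.cov J.tot J.s = Pi.single 0 J.e := by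
  ext n : 1
  rw [cov, J.tot_vec_x 0]
  rcases lt_trichotomy n 0 with h | rfl | h
  · rw [J.s_of_nonpos (by omega), J.s_of_nonpos (by omega), Pi.single_eq_of_ne h.ne]
    simp
  · rw [J.s_of_nonpos le_rfl, zero_add, show (1 : ℤ) = ((0 : ℕ) : ℤ) + 1 by simp, s_succ, sPos]
    simp [Matrix.neg_vecMul, Matrix.vecMul_vecMul, Xi_mul]
  · obtain ⟨k, rfl⟩ : ∃ k : ℕ, n = k + 1 := ⟨(n - 1).toNat, by omega⟩
    rw [s_succ, show (k : ℤ) + 1 + 1 = ((k + 1 : ℕ) : ℤ) + 1 by simp, s_succ, sPos,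
      Pi.single_eq_of_ne h.ne', Matrix.vecMul_vecMul, Xi_mul, Matrix.vecMul_one, sub_self]

/-- The part `∑_{n ≥ 0} z^{-n-1} w_n` of the series `∑_n z^{-n-1} w_n`. -/
def trunc (w : ℤ → Fin N → R) : ℤ → Fin N → R := fun n => if 0 ≤ n then w n else 0

/-- The defect in `cov_flow_s` intertwines $\nabla_\partial$ with itself. By flatness the only extra
term is $\nabla_{\mathrm{flow}\,w}(z^{-1}e)$, which matches the failure of truncation to commute
with $\nabla_\partial$. -/
lemma cov_tot_cov_flow_s (w : ℤ → Fin N → R) :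
    J.cov J.tot (J.cov (J.flow w) J.s - trunc w)
      = J.cov (J.flow (J.cov J.tot w)) J.s - trunc (J.cov J.tot w) := by
  have h := J.isVF_tot.cov_lie (J.isVF_flow w) J.s
  rw [tot_lie_flow, cov_tot_s, eq_sub_iff_add_eq] at h
  rw [cov_sub, ← h, add_sub_assoc, sub_eq_add_neg _ (trunc (J.cov J.tot w))]
  congr 1
  ext n : 1
  simp only [Pi.sub_apply, Pi.neg_apply, cov, trunc, J.tot_vec_x 0, flow_vec_x, coef, zero_add]
  rcases lt_trichotomy n (-1) with h | rfl | h
  · rw [if_neg (by omega), if_neg (by omega), if_neg (by omega),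
      Pi.single_eq_of_ne (by omega), Pi.single_eq_of_ne (by omega)]
    simp
  -- The coefficient of $z^0$, the only one where both corrections are nonzero: each involves
  -- $w_0\mathcal X$, one through $\nabla_\partial$ of the truncation, the other through
  -- multiplication of $e$.
  · rw [if_neg (by omega), if_pos (by omega), if_neg (by omega),
      Pi.single_eq_of_ne (by omega), neg_add_cancel, Pi.single_eq_same, e_vecMul_mul]
    simp
  · rw [if_pos (by omega), if_pos (by omega), if_pos (by omega),
      Pi.single_eq_of_ne (i' := n + 1) (by omega)]
    rcases eq_or_ne n 0 with rfl | h0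
    · simp [J.vec_e (J.isVF_flow w)]
    · simp [Pi.single_eq_of_ne h0]

/-- The defining property of the potential `s(z)`. -/
theorem cov_flow_s (w : ℤ → Fin N → R) : J.cov (J.flow w) J.s = trunc w := by
  have neg : ∀ (w : ℤ → Fin N → R) (n : ℤ), n < 0 → (J.cov (J.flow w) J.s - trunc w) n = 0 := by
    intro w n hn
    rw [Pi.sub_apply, cov, trunc, if_neg (by omega), J.s_of_nonpos (by omega),
      J.s_of_nonpos (by omega)]
    simp
  have nonneg : ∀ (n : ℕ) (w : ℤ → Fin N → R), (J.cov (J.flow w) J.s - trunc w) n = 0 := by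
    -- In degree $n$ the intertwining relation contains the defect in degree $n+1$ only through
    -- $\mathcal X^*$, which is injective.
    have step : ∀ (n : ℤ), (∀ w, (J.cov (J.flow w) J.s - trunc w) n = 0) →
        ∀ w, (J.cov (J.flow w) J.s - trunc w) (n + 1) = 0 := by
      intro n ih w
      have h := congrFun (J.cov_tot_cov_flow_s w) n
      rw [ih, cov, ih, J.tot_vec_x 0] at h
      refine J.eq_of_vecMul_X ?_
      simpa using h
    intro n
    induction n with
    | zero =>
      intro w
      have h := step (-1) (fun w => neg w _ (by omega)) w
      rwa [neg_add_cancel] at h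
    | succ n ih =>
      intro w
      rw [Nat.cast_succ]
      exact step n ih w
  refine sub_eq_zero.1 (funext fun n => ?_)
  rcases lt_or_ge n 0 with h | h
  · exact neg w n h
  · obtain ⟨k, rfl⟩ := Int.eq_ofNat_of_zero_le h
    exact nonneg k w

/-! ### The Virasoro operators -/

/-- The adjoint of the operator `δ_z`. -/
def deltaAdj (v : ℤ → Fin N → R) : ℤ → Fin N → R :=
  fun n => (n : R) • v (n - 1) + v (n - 1) ᵥ* J.nu + v n ᵥ* J.U

/-- Multiplication by `z`. -/
def zmul (v : ℤ → Fin N → R) : ℤ → Fin N → R := fun n => v (n + 1)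

lemma mat_U {D : Derivation 𝕜 R R} (hD : J.IsVF D) :
    D.mat J.U = J.mul (D.vec (J.x 0))
      + (J.nu * J.mul (D.vec (J.x 0)) - J.mul (D.vec (J.x 0)) * J.nu) := by
  have h : D.mat J.U = ∑ c, D (J.x 0 c) • (J.p 0 c).mat J.U := by
    ext a b
    simp only [Derivation.mat_apply, hD.apply_base (fun l d => J.U_base l d a b),
      Matrix.sum_apply, Matrix.smul_apply, smul_eq_mul]
  rw [h]
  simp only [J.U_flat, mul, smul_add, smul_sub, Finset.sum_add_distrib, Finset.sum_sub_distrib,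
    Finset.mul_sum, Finset.sum_mul, Matrix.mul_smul, Matrix.smul_mul, Derivation.vec_apply]

lemma U_mul_comm (v : Fin N → R) : J.U * J.mul v = J.mul v * J.U := by
  simp only [mul, Finset.mul_sum, Finset.sum_mul, Matrix.mul_smul, Matrix.smul_mul, J.U_comm]

/-- `U_flat` is designed for this: the derivative $\mathcal A_D+[\nu,\mathcal A_D]$ of $\mathcal U$
compensates the commutators of $z\mathcal A_D$ with $\partial_z$ and with $z^{-1}\nu$. -/
lemma cov_deltaAdj {D : Derivation 𝕜 R R} (hD : J.IsVF D) (v : ℤ → Fin N → R) :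
    J.cov D (J.deltaAdj v) = J.deltaAdj (J.cov D v) := by
  have hnu : D.mat J.nu = 0 := by
    ext a b
    exact hD.apply_const fun l d => J.nu_const l d a b
  ext n : 1
  simp only [cov, deltaAdj, Derivation.vec_add, Derivation.vec_vecMul, hnu, J.mat_U hD,
    Derivation.vec_intCast_smul, add_sub_cancel_right, sub_add_cancel, Matrix.vecMul_zero,
    add_zero, Matrix.vecMul_add, Matrix.vecMul_sub, Matrix.add_vecMul, Matrix.sub_vecMul,
    Matrix.vecMul_vecMul, Matrix.smul_vecMul, smul_sub, U_mul_comm, Int.cast_add, Int.cast_one,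
    add_smul, one_smul]
  abel

lemma cov_zmul (D : Derivation 𝕜 R R) (v : ℤ → Fin N → R) :
    J.cov D (zmul v) = zmul (J.cov D v) := rfl

lemma deltaAdj_sub (v w : ℤ → Fin N → R) :
    J.deltaAdj (v - w) = J.deltaAdj v - J.deltaAdj w := by
  ext n : 1
  simp only [deltaAdj, Pi.sub_apply, smul_sub, Matrix.sub_vecMul]
  abel

lemma deltaAdj_natCast_smul (k : ℕ) (v : ℤ → Fin N → R) :
    J.deltaAdj ((k : R) • v) = (k : R) • J.deltaAdj v := by
  ext n : 1
  simp only [deltaAdj, Pi.smul_apply, smul_add, Matrix.smul_vecMul, smul_comm (k : R) ((n : ℤ) : R)]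

lemma deltaAdj_zmul (v : ℤ → Fin N → R) : J.deltaAdj (zmul v) = zmul (J.deltaAdj v) - v := by
  ext n : 1
  simp only [deltaAdj, zmul, Pi.sub_apply, sub_add_cancel, add_sub_cancel_right, Int.cast_add,
    Int.cast_one, add_smul, one_smul]
  abel

/-- Iterates $[\delta_z^*,z]=-1$. For `k = 0` the truncated exponent is harmless since its
coefficient vanishes. -/
lemma deltaAdj_iterate_zmul (k : ℕ) (v : ℤ → Fin N → R) :
    J.deltaAdj^[k] (zmul v) = zmul (J.deltaAdj^[k] v) - (k : R) • J.deltaAdj^[k - 1] v := by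
  induction k with
  | zero => simp
  | succ k ih =>
    rw [Function.iterate_succ_apply', ih, deltaAdj_sub, deltaAdj_zmul, deltaAdj_natCast_smul,
      ← Function.iterate_succ_apply' J.deltaAdj k, sub_sub]
    congr 1
    rcases k with _ | k
    · simp
    · rw [Nat.add_sub_cancel, Nat.add_sub_cancel, ← Function.iterate_succ_apply' J.deltaAdj k]
      push_cast
      module

lemma cov_deltaAdj_iterate {D : Derivation 𝕜 R R} (hD : J.IsVF D) (k : ℕ) (v : ℤ → Fin N → R) :
    J.cov D (J.deltaAdj^[k] v) = J.deltaAdj^[k] (J.cov D v) := by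
  induction k with
  | zero => rfl
  | succ k ih => rw [Function.iterate_succ_apply', Function.iterate_succ_apply', cov_deltaAdj J hD, ih]

/-- The series `(δ_z^*)^k (z s(z))`. -/
def virasoroSeries (k : ℕ) : ℤ → Fin N → R := J.deltaAdj^[k] (zmul J.s)

/-- The operator $\delta_z^*$ never lowers the index, and $zs$ starts at index $0$. Hence `trunc`
leaves these series unchanged. -/
lemma virasoroSeries_of_neg (k : ℕ) {n : ℤ} (hn : n < 0) : J.virasoroSeries k n = 0 := by
  induction k generalizing n with
  | zero => exact J.s_of_nonpos (by omega)
  | succ k ih =>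
    rw [virasoroSeries, Function.iterate_succ_apply']
    change J.deltaAdj (J.virasoroSeries k) n = 0
    rw [deltaAdj, ih hn, ih (by omega)]
    simp

/-- `virasoro k` is the vector field `L_{k-1}`. -/
def virasoro (k : ℕ) : Derivation 𝕜 R R := J.flow (J.virasoroSeries k)

/-- The derivative passes through $(\delta_z^*)^k$ and $z$ and turns $s$ into the series generating
the flow; moving $z$ to the front yields the second term. -/
lemma cov_virasoro_virasoroSeries (j k : ℕ) :
    J.cov (J.virasoro j) (J.virasoroSeries k)
      = zmul (J.virasoroSeries (j + k)) - (k : R) • J.virasoroSeries (j + k - 1) := by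
  have h : trunc (J.virasoroSeries j) = J.virasoroSeries j := by
    ext n : 1
    unfold trunc
    split_ifs with hn
    · rfl
    · exact (J.virasoroSeries_of_neg j (by omega)).symm
  have h2 : ∀ k, J.deltaAdj^[k] (J.virasoroSeries j) = J.virasoroSeries (j + k) := fun k => by
    rw [virasoroSeries, ← Function.iterate_add_apply, add_comm k j, virasoroSeries]
  rw [virasoroSeries, virasoro, J.cov_deltaAdj_iterate (J.isVF_flow _), cov_zmul, cov_flow_s, h,
    deltaAdj_iterate_zmul, h2, h2]
  rcases k with _ | k
  · simp
  · rw [Nat.add_sub_cancel, ← add_assoc, Nat.add_sub_cancel]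

lemma coef_natCast_smul (l : ℕ) (k : ℕ) (v : ℤ → Fin N → R) :
    J.coef l ((k : R) • v) = (k : R) • J.coef l v := by
  induction l generalizing v with
  | zero => simp [coef, Matrix.smul_vecMul]
  | succ l ih =>
    have h1 : ∀ v : Fin N → R, J.tot.vec ((k : R) • v) = (k : R) • J.tot.vec v := fun v => by
      exact_mod_cast J.tot.vec_intCast_smul v k
    have h : J.cov J.tot ((k : R) • v) = (k : R) • J.cov J.tot v := by
      ext n : 1
      simp only [cov, Pi.smul_apply, h1, Matrix.smul_vecMul, smul_sub]
    rw [coef, coef, h, ih, ih, h1, smul_sub]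

lemma flow_natCast_smul (k : ℕ) (v : ℤ → Fin N → R) :
    J.flow ((k : R) • v) = (k : R) • J.flow v := by
  refine Derivation.ext fun f => ?_
  obtain ⟨n, hn⟩ := J.p_fin f
  rw [Derivation.smul_apply, flow, flow, J.vf_eq_sum _ hn, J.vf_eq_sum _ hn]
  simp only [coef_natCast_smul, Pi.smul_apply, smul_eq_mul, Finset.mul_sum, mul_assoc]

/-- The Virasoro relations. -/
theorem virasoro_lie (j k : ℕ) :
    ⁅J.virasoro j, J.virasoro k⁆ = ((j : R) - (k : R)) • J.virasoro (j + k - 1) := by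
  have h := J.flow_lie_flow (J.virasoroSeries j) (J.virasoroSeries k)
  rw [← virasoro, ← virasoro, cov_virasoro_virasoroSeries, cov_virasoro_virasoroSeries,
    add_comm k j, sub_sub_sub_cancel_left, flow_sub, flow_natCast_smul, flow_natCast_smul] at h
  rw [h, sub_smul]
  rfl

end JetCalculus

namespace JetCalculus

variable {𝕜 R : Type*} [CommRing 𝕜] [CommRing R] [Algebra 𝕜 R] {N : ℕ} (J : JetCalculus 𝕜 R N)

/-! ### Faà di Bruno polynomials -/

/-- The coefficient of `z^m` in `(∂ + z𝒳)^l 𝒳`. -/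
def P : ℕ → ℤ → Matrix (Fin N) (Fin N) R
  | 0 => fun m => if m = 0 then J.X else 0
  | l + 1 => fun m => J.tot.mat (P l m) + J.X * P l (m - 1)

lemma P_succ (l : ℕ) (m : ℤ) : J.P (l + 1) m = J.tot.mat (J.P l m) + J.X * J.P l (m - 1) := rfl

lemma P_of_neg (l : ℕ) {m : ℤ} (hm : m < 0) : J.P l m = 0 := by
  induction l generalizing m with
  | zero => exact if_neg (by omega)
  | succ l ih =>
    rw [P_succ, ih hm, ih (by omega)]
    ext
    simp

lemma P_of_gt {l : ℕ} {m : ℤ} (hm : l < m) : J.P l m = 0 := by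
  induction l generalizing m with
  | zero => exact if_neg (by omega)
  | succ l ih =>
    rw [P_succ, ih (by omega), ih (by omega)]
    ext
    simp

lemma P_self (l : ℕ) : J.P l l = J.X ^ (l + 1) := by
  induction l with
  | zero => simp [P]
  | succ l ih =>
    rw [P_succ, J.P_of_gt (by omega), show ((l + 1 : ℕ) : ℤ) - 1 = l by simp, ih, ← pow_succ']
    ext
    simp

/-- Identifies the recursive components of `flow` with the Faà di Bruno polynomials: by the product
rule the terms with $\partial w_m$ cancel, leaving the recursion for `P`. -/
lemma coef_eq_sum (l : ℕ) (w : ℤ → Fin N → R) :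
    J.coef l w = ∑ m ∈ Finset.range (l + 1), w m ᵥ* J.P l m := by
  induction l generalizing w with
  | zero => simp [coef, P]
  | succ l ih =>
    simp only [coef, ih, Derivation.vec_finset_sum, P, Matrix.vecMul_add, Finset.sum_add_distrib]
    -- After the shift of index the unmatched end terms contain $\mathcal P_{\ell+1}$ in degrees
    -- $\ell+1$ and $-1$, both zero.
    rw [Finset.sum_range_succ (fun m : ℕ => w m ᵥ* J.tot.mat (J.P l m)), J.P_of_gt (m := (l + 1 : ℕ))
      (by omega), Finset.sum_range_succ' (fun m : ℕ => w m ᵥ* (J.X * J.P l (m - 1))),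
      J.P_of_neg (m := ((0 : ℕ) : ℤ) - 1) l (by simp), ← Finset.sum_sub_distrib]
    have h0 : J.tot.mat (0 : Matrix (Fin N) (Fin N) R) = 0 := by
      ext
      simp
    rw [h0, Matrix.mul_zero, Matrix.vecMul_zero, Matrix.vecMul_zero, add_zero, add_zero,
      ← Finset.sum_add_distrib]
    refine Finset.sum_congr rfl fun m _ => ?_
    rw [Derivation.vec_vecMul, cov, J.tot_vec_x 0, Nat.cast_succ, add_sub_cancel_right,
      Matrix.sub_vecMul, Matrix.vecMul_vecMul, zero_add]
    abel

/-- The components of the coefficient of `z^m` in `σ(z) f`. -/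
def sigma (f : R) (m : ℤ) : Fin N → R := fun a => J.vf (fun l => J.P l m a) f

lemma sigma_eq_sum {f : R} {n : ℕ} (hf : ∀ l, n ≤ l → ∀ a, J.p l a f = 0) (m : ℤ) :
    J.sigma f m = ∑ l ∈ Finset.range n, J.P l m *ᵥ fun b => J.p l b f := by
  ext a
  rw [sigma, J.vf_eq_sum _ hf]
  simp [Matrix.mulVec, dotProduct]

lemma sigma_of_neg (f : R) {m : ℤ} (hm : m < 0) : J.sigma f m = 0 := by
  obtain ⟨n, hn⟩ := J.p_fin f
  rw [J.sigma_eq_sum hn]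
  simp [J.P_of_neg _ hm]

lemma sigma_of_ge {f : R} {n : ℕ} (hf : ∀ l, n ≤ l → ∀ a, J.p l a f = 0) {m : ℤ} (hm : n ≤ m) :
    J.sigma f m = 0 := by
  rw [J.sigma_eq_sum hf]
  refine Finset.sum_eq_zero fun l hl => ?_
  rw [Finset.mem_range] at hl
  rw [J.P_of_gt (by omega), Matrix.zero_mulVec]

lemma support_sigma (f : R) : (Function.support (J.sigma f)).Finite := by
  obtain ⟨n, hn⟩ := J.p_fin f
  refine (Set.finite_Icc (0 : ℤ) n).subset fun m hm => ?_
  by_contra h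
  rw [Set.mem_Icc, not_and_or, not_le, not_le] at h
  exact hm (h.elim (J.sigma_of_neg f) fun h => J.sigma_of_ge hn h.le)

lemma flow_eq_finsum (w : ℤ → Fin N → R) (f : R) :
    J.flow w f = ∑ᶠ m : ℤ, w m ⬝ᵥ J.sigma f m := by
  obtain ⟨n, hn⟩ := J.p_fin f
  have h1 : ∑ᶠ m : ℤ, w m ⬝ᵥ J.sigma f m
      = ∑ m ∈ (Finset.range n).map Nat.castEmbedding, w m ⬝ᵥ J.sigma f m := by
    refine finsum_eq_sum_of_support_subset _ fun m hm => ?_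
    by_contra h
    refine hm ?_
    rcases lt_or_ge m 0 with h0 | h0
    · simp [J.sigma_of_neg f h0]
    · obtain ⟨k, rfl⟩ := Int.eq_ofNat_of_zero_le h0
      have : n ≤ k := by simpa using h
      simp [J.sigma_of_ge hn (show (n : ℤ) ≤ k by omega)]
  have h2 : ∀ l ∈ Finset.range n, J.coef l w = ∑ m ∈ Finset.range n, w m ᵥ* J.P l m := by
    intro l hl
    rw [coef_eq_sum]
    refine Finset.sum_subset (Finset.range_mono (by simpa using hl)) fun m _ hm => ?_
    rw [J.P_of_gt (by simpa using hm), Matrix.vecMul_zero]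
  rw [h1, Finset.sum_map, flow, J.vf_eq_sum _ hn]
  simp only [J.sigma_eq_sum hn, dotProduct_sum, Nat.castEmbedding_apply]
  conv_rhs => rw [Finset.sum_comm]
  refine Finset.sum_congr rfl fun l hl => ?_
  change J.coef l w ⬝ᵥ (fun b => J.p l b f) = _
  rw [h2 l hl, sum_dotProduct]
  exact Finset.sum_congr rfl fun (m : ℕ) _ =>
    (Matrix.dotProduct_mulVec (w m) (J.P l m) fun b => J.p l b f).symm

/-- The basis series $z^{-k-1}\partial_a$ isolates a single vector field $\sigma_{k,a}$. -/
lemma flow_single (f : R) (k : ℤ) (a : Fin N) :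
    J.flow (Pi.single k (Pi.single a 1)) f = J.sigma f k a := by
  rw [flow_eq_finsum, finsum_eq_single (fun m => (Pi.single k (Pi.single a 1) : ℤ → Fin N → R) m
    ⬝ᵥ J.sigma f m) k]
  · simp
  · intro m hm
    simp [hm]

/-! ### The potential in components -/

/-- This is `cov_flow_s` on $z^{-k-1}\partial_a$. Only $k=0$ moves $u_0$, hence only then does the
multiplication term appear. -/
lemma sigma_s (k : ℕ) (m : ℤ) (a c : Fin N) :
    J.sigma (J.s m c) k a = (if (k : ℤ) = m ∧ a = c then 1 else 0)
      + (if k = 0 then (J.s (m + 1) ᵥ* J.mul (J.X a)) c else 0) := by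
  have h := congrFun (congrFun (J.cov_flow_s (Pi.single (k : ℤ) (Pi.single a 1))) m) c
  rw [cov, flow_vec_x, coef, Pi.sub_apply, Derivation.vec_apply, flow_single, sub_eq_iff_eq_add] at h
  rw [h]
  congr 1
  · unfold trunc
    rcases eq_or_ne (k : ℤ) m with rfl | hk
    · simp [Pi.single_apply, eq_comm]
    · simp [hk]
  · rcases eq_or_ne k 0 with rfl | hk
    · simp [Matrix.row]
    · have : (0 : ℤ) ≠ k := by omega
      simp [hk, mul]

/-! ### Dilaton degree and uniqueness of the potential. -/

/-- The dilaton vector field. -/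
def dil : Derivation 𝕜 R R := J.vf fun l a => (l : R) * J.x l a

lemma isVF_dil : J.IsVF J.dil := J.isVF_vf _

lemma dil_vec_x (l : ℕ) : J.dil.vec (J.x l) = (l : R) • J.x l := by
  ext a
  exact J.vf_x _ l a

lemma dil_lie_tot : ⁅J.dil, J.tot⁆ = J.tot := by
  refine (J.isVF_dil.lie J.isVF_tot).ext J.isVF_tot fun l a => ?_
  have h : ∀ l, J.dil (J.x l a) = (l : R) * J.x l a := fun l => J.vf_x _ l a
  rw [Derivation.commutator_apply, tot_x, h, h, Derivation.leibniz, Derivation.map_natCast, tot_x,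
    smul_eq_mul, smul_zero]
  push_cast
  ring

/-- Closedness of $\mathcal A$ on $\partial,\mathcal Q$, where $\mathcal Q u_0=0$ and $[\mathcal
Q,\partial]=\partial$: thus $\mathcal X$ has degree $1$. -/
lemma dil_mat_X : J.dil.mat J.X = J.X := by
  have h := J.isVF_tot.mat_mul_sub J.isVF_dil
  have h0 : J.dil.vec (J.x 0) = 0 := by simp [dil_vec_x]
  have h1 : (⁅J.tot, J.dil⁆ : Derivation 𝕜 R R).vec (J.x 0) = -J.x 1 := by
    rw [← lie_skew, dil_lie_tot]
    ext a
    simp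
  have h2 : J.mul (0 : Fin N → R) = 0 := by simp [mul]
  have h3 : J.mul (-J.x 1) = -J.X := by simp [mul]
  have h4 : J.tot.mat (0 : Matrix (Fin N) (Fin N) R) = 0 := by
    ext
    simp
  rw [h0, h1, h2, h3, h4, J.tot_vec_x 0, zero_sub, neg_inj] at h
  exact h

/-- Degree count: $(\mathcal X^*)^{-1}e$ has degree $-1$, and $\partial$ and $(\mathcal X^*)^{-1}$
shift the degree by $+1$ and $-1$. -/
lemma dil_vec_sPos (k : ℕ) : J.dil.vec (J.sPos k) = -J.sPos k := by
  induction k with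
  | zero =>
    refine J.eq_of_vecMul_X ?_
    have h := J.dil.vec_vecMul (J.sPos 0) J.X
    have h1 : J.sPos 0 ᵥ* J.X = -J.e := by
      simp [sPos, Matrix.neg_vecMul, Matrix.vecMul_vecMul, Xi_mul]
    rw [h1, dil_mat_X, h1, Derivation.vec_neg, J.vec_e J.isVF_dil, neg_zero] at h
    rw [Matrix.neg_vecMul, h1]
    exact (eq_neg_of_add_eq_zero_left h.symm)
  | succ k ih =>
    refine J.eq_of_vecMul_X ?_
    have h := J.dil.vec_vecMul (J.sPos (k + 1)) J.X
    have h1 : J.sPos (k + 1) ᵥ* J.X = J.tot.vec (J.sPos k) := by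
      simp [sPos, Matrix.vecMul_vecMul, Xi_mul]
    have h2 : J.dil.vec (J.tot.vec (J.sPos k)) = 0 := by
      have := J.dil.vec_lie J.tot (J.sPos k)
      rw [dil_lie_tot, ih, Derivation.vec_neg, sub_neg_eq_add, eq_comm, add_eq_right] at this
      exact this
    rw [h1, dil_mat_X, h1, h2] at h
    rw [Matrix.neg_vecMul, h1]
    exact (eq_neg_of_add_eq_zero_left h.symm)

lemma dil_s (m : ℤ) (c : Fin N) : J.dil (J.s m c) = -J.s m c := by
  unfold s
  split_ifs
  · exact congrFun (J.dil_vec_sPos _) c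
  · simp

/-- Descent on the highest jet order: if $n+1$ is the last order that can occur in $f$, then
$\sigma_{n+1}f=\mathcal X^{n+2}\partial_{n+1}f$, because lower orders contribute nothing in that
degree. -/
lemma p_eq_zero_of_sigma {f : R} (h : ∀ (k : ℕ), 1 ≤ k → J.sigma f k = 0) (l : ℕ) (a : Fin N) :
    J.p (l + 1) a f = 0 := by
  have key : ∀ n : ℕ, (∀ l, n + 1 ≤ l → ∀ a, J.p l a f = 0) → ∀ l, 1 ≤ l → ∀ a, J.p l a f = 0 := by
    intro n
    induction n with
    | zero => exact fun h => h
    | succ n ih =>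
      refine fun hn => ih fun l hl => ?_
      rcases hl.eq_or_lt with rfl | hl
      · have h1 := h (n + 1) (by omega)
        rw [J.sigma_eq_sum hn, Finset.sum_range_succ, Finset.sum_eq_zero, zero_add, P_self] at h1
        · have h2 : J.Xi ^ (n + 2) * J.X ^ (n + 2) = 1 := by
            rw [← (show Commute J.Xi J.X from J.Xi_mul.trans J.X_mul.symm).mul_pow, Xi_mul, one_pow]
          have h3 := congrArg (J.Xi ^ (n + 2) *ᵥ ·) h1
          simp only [Matrix.mulVec_mulVec, h2, Matrix.one_mulVec, Matrix.mulVec_zero] at h3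
          exact congrFun h3
        · intro l hl
          rw [Finset.mem_range] at hl
          rw [J.P_of_gt (by omega), Matrix.zero_mulVec]
      · exact hn l hl
  obtain ⟨n, hn⟩ := J.p_fin f
  exact key n (fun l hl => hn l (by omega)) (l + 1) (by omega) a

/-- A function of $u_0$ alone has dilaton degree $0$, so degree $-1$ forces it to vanish. -/
lemma eq_zero_of_sigma_of_dil {f : R} (h : ∀ (k : ℕ), 1 ≤ k → J.sigma f k = 0)
    (hf : J.dil f = -f) : f = 0 := by
  have h0 := J.isVF_dil.apply_base (J.p_eq_zero_of_sigma h)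
  have h1 : ∀ a, J.dil (J.x 0 a) = 0 := fun a => by
    have := congrFun (J.dil_vec_x 0) a
    simpa using this
  simp only [h1, zero_mul, Finset.sum_const_zero, hf, neg_eq_zero] at h0
  exact h0

lemma sigma_sub (f g : R) (m : ℤ) : J.sigma (f - g) m = J.sigma f m - J.sigma g m := by
  ext a
  simp [sigma]

theorem potential_unique {s' : ℤ → Fin N → R} (hdil : ∀ m c, J.dil (s' m c) = -s' m c)
    (hsigma : ∀ (k : ℕ) (m : ℤ) (a c : Fin N), J.sigma (s' m c) k a
      = (if (k : ℤ) = m ∧ a = c then 1 else 0)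
        + (if k = 0 then (s' (m + 1) ᵥ* J.mul (J.X a)) c else 0)) : s' = J.s := by
  ext m c
  refine sub_eq_zero.1 (J.eq_zero_of_sigma_of_dil (fun k hk => ?_) ?_)
  · ext a
    rw [sigma_sub, Pi.sub_apply, hsigma, sigma_s, if_neg (by omega : ¬k = 0),
      if_neg (by omega : ¬k = 0), sub_self, Pi.zero_apply]
  · rw [map_sub, hdil, dil_s, neg_sub_neg, neg_sub]

/-! ### The operators `L_k` as residues -/

/-- The operator `δ_z`. -/
def delta (h : ℤ → Fin N → R) : ℤ → Fin N → R :=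
  fun m => ((m + 1 : ℤ) : R) • h (m + 1) + J.nu *ᵥ h (m + 1) + J.U *ᵥ h m

lemma support_delta {h : ℤ → Fin N → R} (hh : (Function.support h).Finite) :
    (Function.support (J.delta h)).Finite := by
  refine (hh.union (hh.preimage ((add_left_injective (1 : ℤ)).injOn))).subset fun m hm => ?_
  by_contra hc
  simp only [Set.mem_union, Set.mem_preimage, Function.mem_support, ne_eq, not_or, not_not] at hc
  refine hm ?_
  simp [delta, hc.1, hc.2]

lemma support_dotProduct {w h : ℤ → Fin N → R} (hh : (Function.support h).Finite) :
    (Function.support fun m => w m ⬝ᵥ h m).Finite :=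
  hh.subset fun m hm hc => hm (by simp [hc])

/-- Integration by parts under the residue: a shift of index moves $\delta_z$ to the other factor.
Finite support allows the sum to be split. -/
lemma finsum_dotProduct_delta (w : ℤ → Fin N → R) {h : ℤ → Fin N → R}
    (hh : (Function.support h).Finite) :
    ∑ᶠ m, w m ⬝ᵥ J.delta h m = ∑ᶠ m, J.deltaAdj w m ⬝ᵥ h m := by
  have h1 : ∀ m, w m ⬝ᵥ J.delta h m
      = (((m + 1 : ℤ) : R) • w m + w m ᵥ* J.nu) ⬝ᵥ h (m + 1) + (w m ᵥ* J.U) ⬝ᵥ h m := fun m => by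
    simp only [delta, dotProduct_add, add_dotProduct, Matrix.dotProduct_mulVec, dotProduct_smul,
      smul_dotProduct]
  have h2 : ∀ m, J.deltaAdj w m ⬝ᵥ h m
      = ((m : R) • w (m - 1) + w (m - 1) ᵥ* J.nu) ⬝ᵥ h m + (w m ᵥ* J.U) ⬝ᵥ h m := fun m => by
    simp only [deltaAdj, add_dotProduct]
  simp only [h1, h2]
  have hs : (Function.support fun m => h (m + 1)).Finite :=
    hh.preimage ((add_left_injective (1 : ℤ)).injOn)
  rw [finsum_add_distrib (support_dotProduct hs) (support_dotProduct hh),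
    finsum_add_distrib (support_dotProduct hh) (support_dotProduct hh)]
  congr 1
  refine finsum_eq_of_bijective (· + 1) (Equiv.addRight (1 : ℤ)).bijective fun m => ?_
  simp

theorem virasoro_eq_finsum (k : ℕ) (f : R) :
    J.virasoro k f = ∑ᶠ m : ℤ, J.s (m + 1) ⬝ᵥ J.delta^[k] (J.sigma f) m := by
  have key : ∀ (k : ℕ) (w h : ℤ → Fin N → R), (Function.support h).Finite →
      ∑ᶠ m : ℤ, w m ⬝ᵥ J.delta^[k] h m = ∑ᶠ m : ℤ, J.deltaAdj^[k] w m ⬝ᵥ h m := by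
    intro k
    induction k with
    | zero => exact fun w h _ => rfl
    | succ k ih =>
      intro w h hh
      rw [Function.iterate_succ_apply, ih _ _ (J.support_delta hh),
        J.finsum_dotProduct_delta _ hh, Function.iterate_succ_apply']
  rw [virasoro, flow_eq_finsum, virasoroSeries, ← key _ _ _ (J.support_sigma f)]
  rfl

end JetCalculus

/-! ## The algebra of jet functions -/

namespace FlatData

variable {𝕜 : Type*} [RCLike 𝕜] {N : ℕ}

/-- The equations satisfied by a conformal Dubrovin manifold in flat coordinates. -/
structure IsConformal (G : FlatData 𝕜 N) : Prop where
  isOpen_dom : IsOpen G.dom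
  contDiffOn_A : ∀ a b c, ContDiffOn 𝕜 ∞ (fun u => G.A u a b c) G.dom
  contDiffOn_e : ∀ c, ContDiffOn 𝕜 ∞ (fun u => G.e u c) G.dom
  contDiffOn_E : ∀ c, ContDiffOn 𝕜 ∞ (fun u => G.E u c) G.dom
  A_comm : ∀ u ∈ G.dom, ∀ a b c, G.A u a b c = G.A u b a c
  A_mul_comm : ∀ u ∈ G.dom, ∀ a b, G.A u a * G.A u b = G.A u b * G.A u a
  A_flat : ∀ u ∈ G.dom, ∀ a b c d, fderiv 𝕜 (fun v => G.A v a b c) u (Pi.single d 1)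
    = fderiv 𝕜 (fun v => G.A v d b c) u (Pi.single a 1)
  e_const : ∀ u ∈ G.dom, ∀ a c, fderiv 𝕜 (fun v => G.e v c) u (Pi.single a 1) = 0
  e_unit : ∀ u ∈ G.dom, ∑ a, G.e u a • G.A u a = 1
  E_linear : ∀ u ∈ G.dom, ∀ a b c, fderiv 𝕜 (fun v => fderiv 𝕜 (fun w => G.E w c) v
    (Pi.single b 1)) u (Pi.single a 1) = 0
  euler : ∀ u ∈ G.dom, ∀ a b c,
    ∑ d, (G.E u d * fderiv 𝕜 (fun v => G.A v a b c) u (Pi.single d 1)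
      - G.A u a b d * fderiv 𝕜 (fun v => G.E v c) u (Pi.single d 1))
    = G.A u a b c - ∑ d, (fderiv 𝕜 (fun v => G.E v d) u (Pi.single a 1) * G.A u d b c
      + fderiv 𝕜 (fun v => G.E v d) u (Pi.single b 1) * G.A u a d c)

variable {G : FlatData 𝕜 N}

lemma isOpen_J0 (hG : G.IsConformal) : IsOpen G.J0 := by
  have h0 : Continuous fun u : Jet 𝕜 N => u 0 := continuous_apply 0
  have hX : ContinuousOn (fun u : Jet 𝕜 N => (G.X u).det) {u | u 0 ∈ G.dom} := by
    have hc : ∀ b c, ContinuousOn (fun u : Jet 𝕜 N => G.X u b c) {u | u 0 ∈ G.dom} := by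
      intro b c
      simp only [X, Matrix.sum_apply, Matrix.smul_apply, smul_eq_mul]
      refine continuousOn_finsetSum _ fun a _ => ContinuousOn.mul ?_ ?_
      · exact (continuous_apply_apply (1 : ℕ) a).continuousOn
      · exact (hG.contDiffOn_A a b c).continuousOn.comp h0.continuousOn fun u hu => hu
    simp only [Matrix.det_apply]
    exact continuousOn_finsetSum _ fun σ _ =>
      (continuousOn_finsetProd _ fun i _ => hc _ _).const_smul _
  have := hX.isOpen_inter_preimage (hG.isOpen_dom.preimage h0) (isOpen_compl_singleton (x := (0 : 𝕜)))
  convert! this using 1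
  ext u
  simp [J0, isUnit_iff_ne_zero]

/-- The restriction of a jet to its first `n + 1` coordinates. -/
def restr (n : ℕ) (u : Jet 𝕜 N) : Fin (n + 1) → Fin N → 𝕜 := fun i => u i

/-- Near the restriction of $u$, a finite jet is completed by the higher coordinates of $u$; this
section is continuous, so it stays in the open set `J0`. -/
lemma isOpen_restr_image (hG : G.IsConformal) (n : ℕ) : IsOpen (restr n '' G.J0) := by
  rw [isOpen_iff_mem_nhds]
  rintro _ ⟨u, hu, rfl⟩
  let s : (Fin (n + 1) → Fin N → 𝕜) → Jet 𝕜 N :=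
    fun v l => if h : l < n + 1 then v ⟨l, h⟩ else u l
  have hs : Continuous s := by
    refine continuous_pi fun l => ?_
    by_cases h : l < n + 1
    · simpa only [s, h, dite_true] using continuous_apply _
    · simpa only [s, h, dite_false] using continuous_const
  have hsu : s (restr n u) = u := by
    ext l : 1
    simp [s, restr]
  have : s ⁻¹' G.J0 ∈ nhds (restr n u) :=
    hs.continuousAt.preimage_mem_nhds (by rw [hsu]; exact (isOpen_J0 hG).mem_nhds hu)
  refine Filter.mem_of_superset this fun v hv => ⟨s v, hv, ?_⟩
  ext i : 1
  exact dif_pos i.2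

variable (G) in
/-- The jet function `f` is represented by the function `g` of the first `n + 1` coordinates. -/
def Rep (f : Jet 𝕜 N → 𝕜) (n : ℕ) (g : (Fin (n + 1) → Fin N → 𝕜) → 𝕜) : Prop :=
  ContDiffOn 𝕜 ∞ g (restr n '' G.J0) ∧ ∀ u ∈ G.J0, f u = g (restr n u)

lemma isJetFunction_iff {f : Jet 𝕜 N → 𝕜} : G.IsJetFunction f ↔ ∃ n g, G.Rep f n g := Iff.rfl

lemma Rep.mono {f : Jet 𝕜 N → 𝕜} {n m : ℕ} {g : (Fin (n + 1) → Fin N → 𝕜) → 𝕜}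
    (h : G.Rep f n g) (hnm : n ≤ m) :
    G.Rep f m fun v => g fun i => v (Fin.castLE (Nat.add_le_add_right hnm 1) i) := by
  refine ⟨h.1.comp (ContDiff.contDiffOn (contDiff_pi.2 fun i => contDiff_apply _ _ _)) ?_, h.2⟩
  rintro _ ⟨u, hu, rfl⟩
  exact ⟨u, hu, rfl⟩

lemma Rep.contDiffAt {f : Jet 𝕜 N → 𝕜} {n : ℕ} {g : (Fin (n + 1) → Fin N → 𝕜) → 𝕜}
    (hG : G.IsConformal) (h : G.Rep f n g) {u : Jet 𝕜 N} (hu : u ∈ G.J0) :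
    ContDiffAt 𝕜 ∞ g (restr n u) :=
  h.1.contDiffAt ((isOpen_restr_image hG n).mem_nhds ⟨u, hu, rfl⟩)

lemma eventually_mem_J0 (hG : G.IsConformal) {u : Jet 𝕜 N} (hu : u ∈ G.J0) (v : Jet 𝕜 N) :
    ∀ᶠ t : 𝕜 in nhds 0, u + t • v ∈ G.J0 := by
  have h : Continuous fun t : 𝕜 => u + t • v := by fun_prop
  exact h.continuousAt.eventually (by simpa using (isOpen_J0 hG).mem_nhds hu)

/-- Reduces directional derivatives on the infinite jet-space to Fréchet derivatives in finitely
many variables. -/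
lemma Rep.hasLineDerivAt {f : Jet 𝕜 N → 𝕜} {n : ℕ} {g : (Fin (n + 1) → Fin N → 𝕜) → 𝕜}
    (hG : G.IsConformal) (h : G.Rep f n g) {u : Jet 𝕜 N} (hu : u ∈ G.J0) (v : Jet 𝕜 N) :
    HasLineDerivAt 𝕜 f (fderiv 𝕜 g (restr n u) (restr n v)) u v := by
  have hd : DifferentiableAt 𝕜 g (restr n u) := (h.contDiffAt hG hu).differentiableAt (by simp)
  have h1 : HasLineDerivAt 𝕜 g (fderiv 𝕜 g (restr n u) (restr n v)) (restr n u) (restr n v) :=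
    hd.hasFDerivAt.hasLineDerivAt _
  refine HasDerivAt.congr_of_eventuallyEq h1 ?_
  filter_upwards [eventually_mem_J0 hG hu v] with t ht
  exact h.2 _ ht

lemma Rep.jetPartial {f : Jet 𝕜 N → 𝕜} {n : ℕ} {g : (Fin (n + 1) → Fin N → 𝕜) → 𝕜}
    (hG : G.IsConformal) (h : G.Rep f n g) (l : ℕ) (a : Fin N) :
    G.Rep (jetPartial l a f) n
      fun v => fderiv 𝕜 g v (restr n (Pi.single l (Pi.single a 1))) := by
  refine ⟨?_, fun u hu => (h.hasLineDerivAt hG hu _).lineDeriv⟩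
  have := h.1.fderiv_of_isOpen (isOpen_restr_image hG n) (m := ∞) (by simp)
  exact this.clm_apply contDiffOn_const

lemma restr_single_of_lt {n l : ℕ} (h : n < l) (w : Fin N → 𝕜) :
    restr n (Pi.single l w : Jet 𝕜 N) = 0 := by
  ext i : 1
  exact Pi.single_eq_of_ne (by omega) _

lemma Rep.jetPartial_eq_zero {f : Jet 𝕜 N → 𝕜} {n : ℕ} {g : (Fin (n + 1) → Fin N → 𝕜) → 𝕜}
    (hG : G.IsConformal) (h : G.Rep f n g) {l : ℕ} (hl : n < l) (a : Fin N) {u : Jet 𝕜 N}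
    (hu : u ∈ G.J0) : _root_.jetPartial l a f u = 0 := by
  rw [(h.jetPartial hG l a).2 u hu]
  beta_reduce
  rw [restr_single_of_lt hl, map_zero]

lemma Rep.jetPartial_comm {f : Jet 𝕜 N → 𝕜} {n : ℕ} {g : (Fin (n + 1) → Fin N → 𝕜) → 𝕜}
    (hG : G.IsConformal) (h : G.Rep f n g) (l l' : ℕ) (a a' : Fin N) {u : Jet 𝕜 N}
    (hu : u ∈ G.J0) : _root_.jetPartial l a (_root_.jetPartial l' a' f) u
      = _root_.jetPartial l' a' (_root_.jetPartial l a f) u := by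
  rw [((h.jetPartial hG l' a').jetPartial hG l a).2 u hu,
    ((h.jetPartial hG l a).jetPartial hG l' a').2 u hu]
  have hg := h.contDiffAt hG hu
  have hd : DifferentiableAt 𝕜 (fderiv 𝕜 g) (restr n u) :=
    (hg.fderiv_right (m := ∞) (by simp)).differentiableAt (by simp)
  have hsymm : IsSymmSndFDerivAt 𝕜 g (restr n u) :=
    hg.isSymmSndFDerivAt (by simpa using WithTop.coe_le_coe.2 (le_top : (2 : ℕ∞) ≤ ⊤))
  beta_reduce
  rw [fderiv_clm_apply hd (by fun_prop), fderiv_clm_apply hd (by fun_prop)]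
  simpa using hsymm.eq _ _

/-! ### The algebra $\mathcal O_{\infty,0}$ and its partial derivatives. -/

section algebra

variable (G)

/-- Extension by zero of a function on `J^∞_0 M`. -/
def extend (f : G.J0 → 𝕜) : Jet 𝕜 N → 𝕜 := by
  classical
  exact fun u => if h : u ∈ G.J0 then f ⟨u, h⟩ else 0

lemma extend_of_mem (f : G.J0 → 𝕜) {u : Jet 𝕜 N} (hu : u ∈ G.J0) : G.extend f u = f ⟨u, hu⟩ := by
  simp [extend, hu]

lemma extend_add (f g : G.J0 → 𝕜) : G.extend (f + g) = G.extend f + G.extend g := by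
  ext u
  by_cases hu : u ∈ G.J0 <;> simp [extend, hu]

lemma extend_mul (f g : G.J0 → 𝕜) : G.extend (f * g) = G.extend f * G.extend g := by
  ext u
  by_cases hu : u ∈ G.J0 <;> simp [extend, hu]

lemma extend_smul (r : 𝕜) (f : G.J0 → 𝕜) : G.extend (r • f) = r • G.extend f := by
  ext u
  by_cases hu : u ∈ G.J0 <;> simp [extend, hu]

variable {G}

lemma IsJetFunction.congr {f g : Jet 𝕜 N → 𝕜} (hf : G.IsJetFunction f)
    (h : ∀ u ∈ G.J0, g u = f u) : G.IsJetFunction g := by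
  obtain ⟨n, k, hk, hfk⟩ := hf
  exact ⟨n, k, hk, fun u hu => (h u hu).trans (hfk u hu)⟩

lemma IsJetFunction.exists_common {f g : Jet 𝕜 N → 𝕜} (hf : G.IsJetFunction f)
    (hg : G.IsJetFunction g) : ∃ n k k', G.Rep f n k ∧ G.Rep g n k' := by
  obtain ⟨n, k, h⟩ := isJetFunction_iff.1 hf
  obtain ⟨n', k', h'⟩ := isJetFunction_iff.1 hg
  exact ⟨max n n', _, _, h.mono (le_max_left _ _), h'.mono (le_max_right _ _)⟩

lemma IsJetFunction.add {f g : Jet 𝕜 N → 𝕜} (hf : G.IsJetFunction f) (hg : G.IsJetFunction g) :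
    G.IsJetFunction (f + g) := by
  obtain ⟨n, k, k', h, h'⟩ := hf.exists_common hg
  exact ⟨n, k + k', h.1.add h'.1, fun u hu => congrArg₂ (· + ·) (h.2 u hu) (h'.2 u hu)⟩

lemma IsJetFunction.mul {f g : Jet 𝕜 N → 𝕜} (hf : G.IsJetFunction f) (hg : G.IsJetFunction g) :
    G.IsJetFunction (f * g) := by
  obtain ⟨n, k, k', h, h'⟩ := hf.exists_common hg
  exact ⟨n, k * k', h.1.mul h'.1, fun u hu => congrArg₂ (· * ·) (h.2 u hu) (h'.2 u hu)⟩

lemma IsJetFunction.inv {f : Jet 𝕜 N → 𝕜} (hf : G.IsJetFunction f) (h0 : ∀ u ∈ G.J0, f u ≠ 0) :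
    G.IsJetFunction (f⁻¹) := by
  obtain ⟨n, k, h⟩ := isJetFunction_iff.1 hf
  refine ⟨n, k⁻¹, h.1.inv ?_, fun u hu => congrArg _ (h.2 u hu)⟩
  rintro _ ⟨u, hu, rfl⟩
  rw [← h.2 u hu]
  exact h0 u hu

lemma IsJetFunction.jetPartial (hG : G.IsConformal) {f : Jet 𝕜 N → 𝕜} (hf : G.IsJetFunction f)
    (l : ℕ) (a : Fin N) : G.IsJetFunction (jetPartial l a f) := by
  obtain ⟨n, k, h⟩ := isJetFunction_iff.1 hf
  exact ⟨n, _, h.jetPartial hG l a⟩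

lemma isJetFunction_const (r : 𝕜) : G.IsJetFunction fun _ => r :=
  ⟨0, fun _ => r, contDiffOn_const, fun _ _ => rfl⟩

lemma isJetFunction_coord (l : ℕ) (a : Fin N) : G.IsJetFunction fun u => u l a :=
  ⟨l, fun v => v (Fin.last l) a,
    ContDiff.contDiffOn (contDiff_apply_apply _ _ _ _), fun u _ => by simp⟩

lemma isJetFunction_base {F : (Fin N → 𝕜) → 𝕜} (hF : ContDiffOn 𝕜 ∞ F G.dom) :
    G.IsJetFunction fun u => F (u 0) := by
  refine ⟨0, fun v => F (v 0), hF.comp (ContDiff.contDiffOn (contDiff_apply _ _ _)) ?_,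
    fun u _ => rfl⟩
  rintro _ ⟨u, hu, rfl⟩
  exact hu.1

variable (G)

/-- The algebra `𝒪_{∞,0}`. -/
def jetAlgebra : Subalgebra 𝕜 (G.J0 → 𝕜) where
  carrier := {f | G.IsJetFunction (G.extend f)}
  mul_mem' {f g} hf hg := by
    simp only [Set.mem_ofPred_eq] at hf hg ⊢
    rw [extend_mul]
    exact hf.mul hg
  add_mem' {f g} hf hg := by
    simp only [Set.mem_ofPred_eq] at hf hg ⊢
    rw [extend_add]
    exact hf.add hg
  algebraMap_mem' r := (isJetFunction_const r).congr fun u hu => G.extend_of_mem _ hu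

variable {G}

/-- The element of `𝒪_{∞,0}` given by a jet function. -/
def ofFun (f : Jet 𝕜 N → 𝕜) (hf : G.IsJetFunction f) : G.jetAlgebra :=
  ⟨fun u => f u, hf.congr fun _ hu => G.extend_of_mem _ hu⟩

@[simp] lemma ofFun_apply (f : Jet 𝕜 N → 𝕜) (hf : G.IsJetFunction f) (u : G.J0) :
    (ofFun f hf).1 u = f u := rfl

lemma jetAlgebra_ext {f g : G.jetAlgebra} (h : ∀ u, f.1 u = g.1 u) : f = g :=
  Subtype.ext (funext h)

lemma isJetFunction_of_agree {f : Jet 𝕜 N → 𝕜} (F : G.jetAlgebra)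
    (h : ∀ u : G.J0, f u = F.1 u) : G.IsJetFunction f :=
  IsJetFunction.congr F.2 fun u hu => by rw [h ⟨u, hu⟩, G.extend_of_mem _ hu]

lemma exists_agree {f : Jet 𝕜 N → 𝕜} (hf : G.IsJetFunction f) :
    ∃ F : G.jetAlgebra, ∀ u : G.J0, f u = F.1 u := ⟨ofFun f hf, fun _ => rfl⟩

/-- Openness of `J0` keeps short segments inside, so arbitrary values outside do not affect the
derivative. -/
lemma jetPartial_congr (hG : G.IsConformal) {f g : Jet 𝕜 N → 𝕜} (h : ∀ u ∈ G.J0, f u = g u)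
    (l : ℕ) (a : Fin N) {u : Jet 𝕜 N} (hu : u ∈ G.J0) : jetPartial l a f u = jetPartial l a g u := by
  refine Filter.EventuallyEq.deriv_eq ?_
  filter_upwards [eventually_mem_J0 hG hu (Pi.single l (Pi.single a 1))] with t ht
  exact h _ ht

lemma hasLineDerivAt_extend (hG : G.IsConformal) (F : G.jetAlgebra) {u : Jet 𝕜 N}
    (hu : u ∈ G.J0) (l : ℕ) (a : Fin N) :
    HasDerivAt (fun t : 𝕜 => G.extend F.1 (u + t • (Pi.single l (Pi.single a 1) : Jet 𝕜 N)))
      (jetPartial l a (G.extend F.1) u) 0 := by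
  obtain ⟨n, k, h⟩ := isJetFunction_iff.1 F.2
  exact (h.hasLineDerivAt hG hu _).lineDifferentiableAt.hasLineDerivAt

/-- The derivation `∂_{l,a}` of `𝒪_{∞,0}`. -/
def partialDer (hG : G.IsConformal) (l : ℕ) (a : Fin N) :
    Derivation 𝕜 G.jetAlgebra G.jetAlgebra :=
  Derivation.mk'
    { toFun := fun F => ofFun (jetPartial l a (G.extend F.1)) (IsJetFunction.jetPartial hG F.2 l a)
      map_add' := fun F F' => jetAlgebra_ext fun u => by
        change jetPartial l a (G.extend (F.1 + F'.1)) u.1 = jetPartial l a (G.extend F.1) u.1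
          + jetPartial l a (G.extend F'.1) u.1
        rw [extend_add]
        exact ((hasLineDerivAt_extend hG F u.2 l a).add (hasLineDerivAt_extend hG F' u.2 l a)).deriv
      map_smul' := fun r F => jetAlgebra_ext fun u => by
        change jetPartial l a (G.extend (r • F.1)) u.1 = r • jetPartial l a (G.extend F.1) u.1
        rw [extend_smul]
        exact ((hasLineDerivAt_extend hG F u.2 l a).const_smul r).deriv }
    (fun F F' => jetAlgebra_ext fun u => by
      change jetPartial l a (G.extend (F.1 * F'.1)) u.1
        = F.1 u * jetPartial l a (G.extend F'.1) u.1 + F'.1 u * jetPartial l a (G.extend F.1) u.1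
      rw [extend_mul]
      have := ((hasLineDerivAt_extend hG F u.2 l a).mul (hasLineDerivAt_extend hG F' u.2 l a)).deriv
      rw [zero_smul, add_zero, G.extend_of_mem _ u.2, G.extend_of_mem _ u.2] at this
      refine this.trans ?_
      ring)

lemma jetPartial_eq (hG : G.IsConformal) {f : Jet 𝕜 N → 𝕜} {F : G.jetAlgebra}
    (h : ∀ u : G.J0, f u = F.1 u) (l : ℕ) (a : Fin N) (u : G.J0) :
    jetPartial l a f u = (partialDer hG l a F).1 u :=
  jetPartial_congr hG (fun v hv => by rw [h ⟨v, hv⟩, G.extend_of_mem _ hv]) l a u.2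

lemma partialDer_comm (hG : G.IsConformal) (l : ℕ) (a : Fin N) (l' : ℕ) (a' : Fin N)
    (F : G.jetAlgebra) :
    partialDer hG l a (partialDer hG l' a' F) = partialDer hG l' a' (partialDer hG l a F) := by
  refine jetAlgebra_ext fun u => ?_
  obtain ⟨n, k, h⟩ := isJetFunction_iff.1 F.2
  have h1 : ∀ l a, ∀ u : G.J0, jetPartial l a (G.extend F.1) u = (partialDer hG l a F).1 u :=
    fun l a u => rfl
  rw [← jetPartial_eq hG (h1 l' a'), ← jetPartial_eq hG (h1 l a)]
  exact h.jetPartial_comm hG l l' a a' u.2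

lemma partialDer_fin (hG : G.IsConformal) (F : G.jetAlgebra) :
    ∃ n, ∀ l, n ≤ l → ∀ a, partialDer hG l a F = 0 := by
  obtain ⟨n, k, h⟩ := isJetFunction_iff.1 F.2
  exact ⟨n + 1, fun l hl a => jetAlgebra_ext fun u => h.jetPartial_eq_zero hG hl a u.2⟩

lemma partialDer_coord (hG : G.IsConformal) (l : ℕ) (a : Fin N) (l' : ℕ) (a' : Fin N) :
    partialDer hG l a (ofFun (fun u => u l' a') (isJetFunction_coord l' a'))
      = if l = l' ∧ a = a' then 1 else 0 := by
  refine jetAlgebra_ext fun u => ?_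
  rw [← jetPartial_eq hG (f := fun u => u l' a') (fun _ => rfl)]
  change lineDeriv 𝕜 _ _ _ = _
  have h : HasDerivAt (fun t : 𝕜 => (u.1 + t • (Pi.single l (Pi.single a 1) : Jet 𝕜 N)) l' a')
      ((Pi.single l (Pi.single a 1) : Jet 𝕜 N) l' a') 0 := by
    simpa using ((hasDerivAt_id (0 : 𝕜)).mul_const
      ((Pi.single l (Pi.single a 1) : Jet 𝕜 N) l' a')).const_add (u.1 l' a')
  refine h.deriv.trans ?_
  by_cases hl : l = l'
  · subst hl
    by_cases ha : a = a'
    · subst ha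
      simp
    · simp [ha, Ne.symm ha]
  · have : l' ≠ l := Ne.symm hl
    simp [hl]

lemma jetPartial_base {F : (Fin N → 𝕜) → 𝕜} {u : Jet 𝕜 N} (hF : DifferentiableAt 𝕜 F (u 0))
    (a : Fin N) : jetPartial 0 a (fun u => F (u 0)) u = fderiv 𝕜 F (u 0) (Pi.single a 1) := by
  rw [← hF.lineDeriv_eq_fderiv]
  unfold jetPartial lineDeriv
  simp

lemma jetPartial_succ_base (F : (Fin N → 𝕜) → 𝕜) (u : Jet 𝕜 N) (l : ℕ) (a : Fin N) :
    jetPartial (l + 1) a (fun u => F (u 0)) u = 0 := by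
  unfold jetPartial lineDeriv
  simp

end algebra

end FlatData

namespace FlatData

variable {𝕜 : Type*} [RCLike 𝕜] {N : ℕ} {G : FlatData 𝕜 N}

/-! ## The jet calculus of a conformal Dubrovin manifold -/

namespace IsConformal

variable (hG : G.IsConformal)
include hG

lemma contDiffOn_fderiv_E (a c : Fin N) :
    ContDiffOn 𝕜 ∞ (fun u => fderiv 𝕜 (fun v => G.E v c) u (Pi.single a 1)) G.dom :=
  ((hG.contDiffOn_E c).fderiv_of_isOpen hG.isOpen_dom (m := ∞) (by simp)).clm_apply
    contDiffOn_const

lemma contDiffOn_nu (a b : Fin N) : ContDiffOn 𝕜 ∞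
    (fun u => (G.mu u + (1 / 2 : 𝕜) • (1 : Matrix (Fin N) (Fin N) 𝕜)) a b) G.dom := by
  simp only [mu, Matrix.add_apply, Matrix.of_apply, Matrix.smul_apply]
  exact (contDiffOn_const.sub (hG.contDiffOn_fderiv_E a b)).add contDiffOn_const

lemma contDiffOn_U (b c : Fin N) : ContDiffOn 𝕜 ∞ (fun u => G.U u b c) G.dom := by
  simp only [U, Matrix.sum_apply, Matrix.smul_apply, smul_eq_mul]
  exact ContDiffOn.sum fun a _ => (hG.contDiffOn_E a).mul (hG.contDiffOn_A a b c)

lemma differentiableAt {F : (Fin N → 𝕜) → 𝕜} (hF : ContDiffOn 𝕜 ∞ F G.dom) {u : Fin N → 𝕜}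
    (hu : u ∈ G.dom) : DifferentiableAt 𝕜 F u :=
  (hF.contDiffAt (hG.isOpen_dom.mem_nhds hu)).differentiableAt (by simp)

lemma U_mul_comm {u : Fin N → 𝕜} (hu : u ∈ G.dom) (a : Fin N) :
    G.U u * G.A u a = G.A u a * G.U u := by
  simp only [U, Finset.sum_mul, Finset.mul_sum, Matrix.smul_mul, Matrix.mul_smul,
    hG.A_mul_comm u hu _ a]

lemma nu_const {u : Fin N → 𝕜} (hu : u ∈ G.dom) (a b c : Fin N) :
    fderiv 𝕜 (fun u => (G.mu u + (1 / 2 : 𝕜) • (1 : Matrix (Fin N) (Fin N) 𝕜)) b c) u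
      (Pi.single a 1) = 0 := by
  have h := hG.differentiableAt (hG.contDiffOn_fderiv_E b c) hu
  simp only [mu, Matrix.add_apply, Matrix.of_apply, Matrix.smul_apply]
  rw [fderiv_add_const, fderiv_const_sub, neg_apply, hG.E_linear u hu, neg_zero]

/-- In $\partial_c(E^d\mathcal A_d)$ the symmetry $\partial_c\mathcal A_d=\partial_d\mathcal A_c$
produces $E^d\partial_d\mathcal A_c$, which the Euler equation evaluates. The scalar part of
$\mu+\frac12$ drops out of the commutator. -/
lemma U_flat {u : Fin N → 𝕜} (hu : u ∈ G.dom) (c a b : Fin N) :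
    fderiv 𝕜 (fun u => G.U u a b) u (Pi.single c 1)
      = (G.A u c + ((G.mu u + (1 / 2 : 𝕜) • (1 : Matrix (Fin N) (Fin N) 𝕜)) * G.A u c
        - G.A u c * (G.mu u + (1 / 2 : 𝕜) • (1 : Matrix (Fin N) (Fin N) 𝕜)))) a b := by
  have hA := fun d => hG.differentiableAt (hG.contDiffOn_A d a b) hu
  have hE := fun d => hG.differentiableAt (hG.contDiffOn_E d) hu
  have h1 : fderiv 𝕜 (fun u => G.U u a b) u (Pi.single c 1)
      = ∑ d, (G.E u d * fderiv 𝕜 (fun v => G.A v d a b) u (Pi.single c 1)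
        + G.A u d a b * fderiv 𝕜 (fun v => G.E v d) u (Pi.single c 1)) := by
    simp only [U, Matrix.sum_apply, Matrix.smul_apply, smul_eq_mul]
    rw [fderiv_fun_sum (A := fun d u => G.E u d * G.A u d a b) fun d _ => (hE d).fun_mul (hA d),
      sum_apply]
    refine Finset.sum_congr rfl fun d _ => ?_
    rw [fderiv_fun_mul (hE d) (hA d)]
    simp
  have h2 := hG.euler u hu c a b
  have h3 : (G.mu u * G.A u c) a b = (1 - (G.r : 𝕜) / 2) * G.A u c a b
      - ∑ d, fderiv 𝕜 (fun v => G.E v d) u (Pi.single a 1) * G.A u c d b := by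
    simp [mu, Matrix.mul_apply, sub_mul, Finset.sum_sub_distrib]
  have h4 : (G.A u c * G.mu u) a b = G.A u c a b * (1 - (G.r : 𝕜) / 2)
      - ∑ d, G.A u c a d * fderiv 𝕜 (fun v => G.E v b) u (Pi.single d 1) := by
    simp [mu, Matrix.mul_apply, mul_sub, Finset.sum_sub_distrib]
  rw [h1]
  simp only [Matrix.add_apply, Matrix.sub_apply, add_mul, mul_add, Matrix.smul_mul,
    Matrix.mul_smul, one_mul, mul_one, h3, h4, hG.A_flat u hu _ a b c]
  simp only [Finset.sum_add_distrib, Finset.sum_sub_distrib] at h2 ⊢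
  have h5 : ∑ d, G.A u d a b * fderiv 𝕜 (fun v => G.E v d) u (Pi.single c 1)
      = ∑ d, fderiv 𝕜 (fun v => G.E v d) u (Pi.single c 1) * G.A u d a b :=
    Finset.sum_congr rfl fun d _ => mul_comm _ _
  rw [h5]
  linear_combination h2

end IsConformal

lemma isJetFunction_X (hG : G.IsConformal) (b c : Fin N) : G.IsJetFunction fun u => G.X u b c := by
  refine isJetFunction_of_agree (∑ a, ofFun _ (isJetFunction_coord 1 a)
    * ofFun _ (isJetFunction_base (hG.contDiffOn_A a b c))) fun u => ?_
  simp [X, Matrix.sum_apply]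

/-- The matrix over `𝒪_{∞,0}` given by a matrix of jet functions. -/
def ofMat (B : Jet 𝕜 N → Matrix (Fin N) (Fin N) 𝕜) (hB : ∀ b c, G.IsJetFunction fun u => B u b c) :
    Matrix (Fin N) (Fin N) G.jetAlgebra := Matrix.of fun b c => ofFun _ (hB b c)

/-- Evaluation of jet functions at a point. -/
def evalAt (u : G.J0) : G.jetAlgebra →+* 𝕜 :=
  (Pi.evalRingHom (fun _ : G.J0 => 𝕜) u).comp G.jetAlgebra.val.toRingHom

@[simp] lemma evalAt_apply (u : G.J0) (F : G.jetAlgebra) : evalAt u F = F.1 u := rfl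

/-- Cramer's rule: the determinant does not vanish on `J0`, and the adjugate is polynomial in the
entries. -/
lemma isJetFunction_X_inv (hG : G.IsConformal) (b c : Fin N) :
    G.IsJetFunction fun u => (G.X u)⁻¹ b c := by
  let B : Matrix (Fin N) (Fin N) G.jetAlgebra := ofMat G.X (isJetFunction_X hG)
  have hB : ∀ u : G.J0, (evalAt u).mapMatrix B = G.X u := fun u => rfl
  have hdet : ∀ u : G.J0, B.det.1 u = (G.X u).det := fun u => by
    rw [← evalAt_apply, RingHom.map_det, hB]
  have hinv : G.IsJetFunction (G.extend B.det.1)⁻¹ := B.det.2.inv fun u hu => by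
    rw [G.extend_of_mem _ hu, hdet ⟨u, hu⟩]
    exact hu.2.ne_zero
  refine isJetFunction_of_agree (ofFun _ hinv * B.adjugate b c) fun u => ?_
  have hadj : (B.adjugate b c).1 u = (G.X u).adjugate b c := by
    have := (evalAt u).map_adjugate B
    rw [hB] at this
    exact congrFun (congrFun this b) c
  change _ = (G.extend B.det.1 u)⁻¹ * (B.adjugate b c).1 u
  rw [G.extend_of_mem _ u.2, hdet, hadj, Matrix.inv_def, Ring.inverse_eq_inv']
  rfl

lemma partialDer_base (hG : G.IsConformal) {F : (Fin N → 𝕜) → 𝕜} (hF : ContDiffOn 𝕜 ∞ F G.dom)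
    (a : Fin N) (u : G.J0) : (partialDer hG 0 a (ofFun _ (isJetFunction_base hF))).1 u
      = fderiv 𝕜 F (u.1 0) (Pi.single a 1) := by
  rw [← jetPartial_eq hG (f := fun u => F (u 0)) (fun _ => rfl)]
  exact jetPartial_base (hG.differentiableAt hF u.2.1) a

lemma partialDer_succ_base (hG : G.IsConformal) {F : (Fin N → 𝕜) → 𝕜}
    (hF : ContDiffOn 𝕜 ∞ F G.dom) (l : ℕ) (a : Fin N) :
    partialDer hG (l + 1) a (ofFun _ (isJetFunction_base hF)) = 0 := by
  refine jetAlgebra_ext fun u => ?_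
  rw [← jetPartial_eq hG (f := fun u => F (u 0)) (fun _ => rfl)]
  exact jetPartial_succ_base F u l a

/-- Evaluation of matrices of jet functions at a point. -/
abbrev matAt (u : G.J0) :
    Matrix (Fin N) (Fin N) G.jetAlgebra →+* Matrix (Fin N) (Fin N) 𝕜 := (evalAt u).mapMatrix

lemma matAt_ofMat (B : Jet 𝕜 N → Matrix (Fin N) (Fin N) 𝕜)
    (hB : ∀ b c, G.IsJetFunction fun u => B u b c) (u : G.J0) : matAt u (ofMat B hB) = B u := rfl

lemma matAt_smul (u : G.J0) (f : G.jetAlgebra) (B : Matrix (Fin N) (Fin N) G.jetAlgebra) :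
    matAt u (f • B) = f.1 u • matAt u B := rfl

lemma jetMatrix_ext {B C : Matrix (Fin N) (Fin N) G.jetAlgebra}
    (h : ∀ u, matAt u B = matAt u C) : B = C := by
  refine Matrix.ext fun b c => jetAlgebra_ext fun u => ?_
  exact congrFun (congrFun (h u) b) c

/-- The jet calculus on `𝒪_{∞,0}`. -/
def calculus (hG : G.IsConformal) : JetCalculus 𝕜 G.jetAlgebra N where
  p := partialDer hG
  x l a := ofFun _ (isJetFunction_coord l a)
  p_comm := partialDer_comm hG
  p_fin := partialDer_fin hG
  p_x := partialDer_coord hG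
  A a := ofMat (fun u => G.A (u 0) a) fun b c => isJetFunction_base (hG.contDiffOn_A a b c)
  A_comm a b c := jetAlgebra_ext fun u => hG.A_comm _ u.2.1 a b c
  A_mul_comm a b := jetMatrix_ext fun u => by
    simpa only [map_mul, matAt_ofMat] using hG.A_mul_comm _ u.2.1 a b
  A_base l d a b c := partialDer_succ_base hG (hG.contDiffOn_A a b c) l d
  A_flat d a b c := jetAlgebra_ext fun u =>
    (partialDer_base hG (hG.contDiffOn_A a b c) d u).trans
      ((hG.A_flat _ u.2.1 a b c d).trans (partialDer_base hG (hG.contDiffOn_A d b c) a u).symm)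
  e c := ofFun _ (isJetFunction_base (hG.contDiffOn_e c))
  e_const l a c := by
    rcases l with _ | l
    · exact jetAlgebra_ext fun u =>
        (partialDer_base hG (hG.contDiffOn_e c) a u).trans (hG.e_const _ u.2.1 a c)
    · exact partialDer_succ_base hG (hG.contDiffOn_e c) l a
  e_unit := jetMatrix_ext fun u => by
    simpa only [map_sum, matAt_smul, matAt_ofMat, map_one, ofFun_apply] using hG.e_unit _ u.2.1
  U := ofMat (fun u => G.U (u 0)) fun b c => isJetFunction_base (hG.contDiffOn_U b c)
  nu := ofMat (fun u => G.mu (u 0) + (1 / 2 : 𝕜) • (1 : Matrix (Fin N) (Fin N) 𝕜))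
    fun b c => isJetFunction_base (hG.contDiffOn_nu b c)
  U_base l d b c := partialDer_succ_base hG (hG.contDiffOn_U b c) l d
  nu_const l a b c := by
    rcases l with _ | l
    · exact jetAlgebra_ext fun u =>
        (partialDer_base hG (hG.contDiffOn_nu b c) a u).trans (hG.nu_const u.2.1 a b c)
    · exact partialDer_succ_base hG (hG.contDiffOn_nu b c) l a
  U_comm a := jetMatrix_ext fun u => by
    simpa only [map_mul, matAt_ofMat] using hG.U_mul_comm u.2.1 a
  U_flat c := jetMatrix_ext fun u => by
    simp only [map_mul, map_add, map_sub, matAt_ofMat]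
    ext a b
    exact (partialDer_base hG (hG.contDiffOn_U a b) c u).trans (hG.U_flat u.2.1 c a b)
  Xi := ofMat (fun u => (G.X u)⁻¹) (isJetFunction_X_inv hG)
  X_mul_Xi := jetMatrix_ext fun u => by
    simp only [map_mul, map_sum, matAt_smul, matAt_ofMat, map_one, ofFun_apply]
    exact Matrix.mul_nonsing_inv (G.X u) u.2.2

end FlatData

namespace FlatData

variable {𝕜 : Type*} [RCLike 𝕜] {N : ℕ} {G : FlatData 𝕜 N} (hG : G.IsConformal)

/-! ## Comparison of jet functions with elements of the jet algebra -/

/-- Evaluation of vectors of jet functions at a point. -/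
def vecAt (u : G.J0) (v : Fin N → G.jetAlgebra) : Fin N → 𝕜 := fun a => (v a).1 u

lemma vecAt_vecMul (u : G.J0) (v : Fin N → G.jetAlgebra)
    (B : Matrix (Fin N) (Fin N) G.jetAlgebra) : vecAt u (v ᵥ* B) = vecAt u v ᵥ* matAt u B :=
  funext fun c => (evalAt u).map_vecMul B v c

lemma vecAt_mulVec (u : G.J0) (v : Fin N → G.jetAlgebra)
    (B : Matrix (Fin N) (Fin N) G.jetAlgebra) : vecAt u (B *ᵥ v) = matAt u B *ᵥ vecAt u v :=
  funext fun c => (evalAt u).map_mulVec B v c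

lemma vecAt_dotProduct (u : G.J0) (v w : Fin N → G.jetAlgebra) :
    (v ⬝ᵥ w).1 u = vecAt u v ⬝ᵥ vecAt u w :=
  (evalAt u).map_dotProduct v w

lemma vecAt_add (u : G.J0) (v w : Fin N → G.jetAlgebra) :
    vecAt u (v + w) = vecAt u v + vecAt u w := rfl

lemma vecAt_neg (u : G.J0) (v : Fin N → G.jetAlgebra) : vecAt u (-v) = -vecAt u v := rfl

lemma vecAt_intCast_smul (u : G.J0) (n : ℤ) (v : Fin N → G.jetAlgebra) :
    vecAt u ((n : G.jetAlgebra) • v) = (n : 𝕜) • vecAt u v := by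
  ext a
  change evalAt u ((n : G.jetAlgebra) * v a) = (n : 𝕜) * _
  rw [map_mul, map_intCast]
  rfl

lemma vf_val (c : ℕ → Fin N → G.jetAlgebra) (F : G.jetAlgebra) (u : G.J0) :
    ((calculus hG).vf c F).1 u
      = ∑ᶠ l, ∑ a, (c l a).1 u * (partialDer hG l a F).1 u := by
  obtain ⟨n, hn⟩ := (calculus hG).p_fin F
  have h := ((calculus hG).support_subset c hn)
  change evalAt u (∑ᶠ l, ∑ a, c l a * (calculus hG).p l a F) = _
  refine ((evalAt u).toAddMonoidHom.map_finsum ((Finset.finite_toSet _).subset h)).trans ?_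
  refine finsum_congr fun l => ?_
  rw [map_sum]
  rfl

variable {hG}

lemma jetD_eq {f : Jet 𝕜 N → 𝕜} {F : G.jetAlgebra} (h : ∀ u : G.J0, f u = F.1 u) (u : G.J0) :
    jetD f u = ((calculus hG).tot F).1 u := by
  rw [JetCalculus.tot, vf_val]
  simp only [jetD, jetPartial_eq hG h]
  rfl

lemma dilaton_eq {f : Jet 𝕜 N → 𝕜} {F : G.jetAlgebra} (h : ∀ u : G.J0, f u = F.1 u) (u : G.J0) :
    dilaton f u = ((calculus hG).dil F).1 u := by
  rw [JetCalculus.dil, vf_val]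
  simp only [dilaton, jetPartial_eq hG h]
  refine finsum_congr fun l => Finset.sum_congr rfl fun a _ => ?_
  congr 1

lemma X_eq (u : G.J0) : G.X u = matAt u (calculus hG).X := by
  simp only [JetCalculus.X, JetCalculus.mul, map_sum, matAt_smul]
  rfl

lemma P_eq (l : ℕ) (m : ℤ) (u : G.J0) : G.P l m u = matAt u ((calculus hG).P l m) := by
  induction l generalizing m u with
  | zero =>
    simp only [P, JetCalculus.P]
    split_ifs
    · exact X_eq u
    · rw [map_zero]
      rfl
  | succ l ih =>
    rw [JetCalculus.P_succ, map_add, map_mul, ← ih, ← X_eq]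
    change jetDMat (G.P l m) u + _ = _
    congr 1
    ext b c
    exact jetD_eq (fun v => congrFun (congrFun (ih m v) b) c) u

lemma sigma_eq {f : Jet 𝕜 N → 𝕜} {F : G.jetAlgebra} (h : ∀ u : G.J0, f u = F.1 u) (m : ℤ)
    (u : G.J0) : G.sigma f m u = vecAt u ((calculus hG).sigma F m) := by
  obtain ⟨n, hn⟩ := (calculus hG).p_fin F
  rw [JetCalculus.sigma_eq_sum _ hn, sigma]
  have h1 : ∀ l, (fun b => jetPartial l b f u) = vecAt u fun b => (calculus hG).p l b F :=
    fun l => funext fun b => jetPartial_eq hG h l b u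
  simp only [h1, P_eq (hG := hG), ← vecAt_mulVec]
  rw [finsum_eq_sum_of_support_subset (s := Finset.range n)]
  · ext a
    change _ = evalAt u ((∑ l ∈ Finset.range n, _ : Fin N → G.jetAlgebra) a)
    rw [Finset.sum_apply, Finset.sum_apply, map_sum]
    rfl
  · intro l hl
    by_contra hl'
    refine hl ?_
    have : (fun b => (calculus hG).p l b F) = 0 := funext (hn l (by simpa using hl'))
    beta_reduce
    rw [this, Matrix.mulVec_zero]
    rfl

lemma sPos_eq (k : ℕ) (u : G.J0) : G.sPos k u = vecAt u ((calculus hG).sPos k) := by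
  induction k generalizing u with
  | zero =>
    rw [JetCalculus.sPos, vecAt_neg, vecAt_vecMul]
    rfl
  | succ k ih =>
    rw [JetCalculus.sPos, vecAt_vecMul]
    change jetDVec (G.sPos k) u ᵥ* _ = _
    congr 1
    ext a
    exact jetD_eq (fun v => congrFun (ih v) a) u

lemma s_eq (k : ℤ) (u : G.J0) : G.s k u = vecAt u ((calculus hG).s k) := by
  unfold s JetCalculus.s
  split_ifs
  · exact sPos_eq _ u
  · rfl

lemma delta_iterate_eq {h : ℤ → Jet 𝕜 N → Fin N → 𝕜} {H : ℤ → Fin N → G.jetAlgebra}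
    (hH : ∀ (m : ℤ) (u : G.J0), h m u = vecAt u (H m)) (k : ℕ) (m : ℤ) (u : G.J0) :
    G.delta^[k] h m u = vecAt u ((calculus hG).delta^[k] H m) := by
  induction k generalizing m u with
  | zero => exact hH m u
  | succ k ih =>
    rw [Function.iterate_succ_apply', Function.iterate_succ_apply', JetCalculus.delta, vecAt_add,
      vecAt_add, vecAt_mulVec, vecAt_mulVec, vecAt_intCast_smul, ← ih, ← ih, Int.cast_add,
      Int.cast_one]
    rfl

/-- Any function agreeing with `F` on `J0` is allowed, so that the lemma applies again to its own
output in the compositions $L_jL_k$. -/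
lemma L_eq {f : Jet 𝕜 N → 𝕜} {F : G.jetAlgebra} (h : ∀ u : G.J0, f u = F.1 u) (k : ℤ)
    (u : G.J0) : G.L k f u = ((calculus hG).virasoro (k + 1).toNat F).1 u := by
  have hs : (Function.support fun m : ℤ => (calculus hG).s (m + 1)
      ⬝ᵥ (calculus hG).delta^[(k + 1).toNat] ((calculus hG).sigma F) m).Finite := by
    refine JetCalculus.support_dotProduct ?_
    generalize (k + 1).toNat = n
    induction n with
    | zero => exact JetCalculus.support_sigma _ F
    | succ n ih =>
      rw [Function.iterate_succ_apply']
      exact JetCalculus.support_delta _ ih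
  rw [JetCalculus.virasoro_eq_finsum]
  refine Eq.trans ?_ ((evalAt u).toAddMonoidHom.map_finsum hs).symm
  refine finsum_congr fun m => ?_
  change _ = (((calculus hG).s (m + 1)
      ⬝ᵥ (calculus hG).delta^[(k + 1).toNat] ((calculus hG).sigma F) m)).1 u
  rw [vecAt_dotProduct, ← s_eq, ← delta_iterate_eq (sigma_eq h)]

variable (hG)
include hG

lemma mul_X_row_eq (a : Fin N) (u : G.J0) :
    ∑ b, G.X u a b • G.A (u.1 0) b = matAt u ((calculus hG).mul ((calculus hG).X a)) := by
  rw [JetCalculus.mul, map_sum, X_eq (hG := hG)]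
  rfl

theorem isPotential_s : G.IsPotential G.s where
  isJetFunction m c := isJetFunction_of_agree ((calculus hG).s m c) fun u => congrFun (s_eq m u) c
  dilaton m c u hu := by
    rw [dilaton_eq (hG := hG) (F := (calculus hG).s m c) (fun v => congrFun (s_eq m v) c) ⟨u, hu⟩,
      JetCalculus.dil_s]
    exact congrArg Neg.neg (congrFun (s_eq m ⟨u, hu⟩) c).symm
  sigma k m a c u hu := by
    have h := congrArg (evalAt ⟨u, hu⟩) ((calculus hG).sigma_s k m a c)
    rw [map_add] at h
    refine (congrFun (sigma_eq (hG := hG) (F := (calculus hG).s m c)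
      (fun v => congrFun (s_eq m v) c) k ⟨u, hu⟩) a).trans (h.trans ?_)
    congr 1
    · split_ifs <;> simp
    · split_ifs
      · rw [mul_X_row_eq hG a ⟨u, hu⟩, s_eq (hG := hG) _ ⟨u, hu⟩, ← vecAt_vecMul]
        rfl
      · rw [map_zero]

theorem isPotential_unique {s' : ℤ → Jet 𝕜 N → Fin N → 𝕜} (hs : G.IsPotential s') (m : ℤ)
    {u : Jet 𝕜 N} (hu : u ∈ G.J0) : s' m u = G.s m u := by
  let S : ℤ → Fin N → G.jetAlgebra := fun m c => ofFun _ (hs.isJetFunction m c)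
  have hS : ∀ (m : ℤ) (u : G.J0), s' m u = vecAt u (S m) := fun m u => rfl
  have key : S = (calculus hG).s := by
    refine JetCalculus.potential_unique _ (fun m c => jetAlgebra_ext fun u => ?_)
      fun k m a c => jetAlgebra_ext fun u => ?_
    · rw [← dilaton_eq (f := fun v => s' m v c) (fun v => congrFun (hS m v) c)]
      exact hs.dilaton m c u u.2
    · refine (congrFun (sigma_eq (f := fun v => s' m v c) (fun v => congrFun (hS m v) c) k u) a).symm.trans
        ((hs.sigma k m a c u u.2).trans ?_)
      rw [← evalAt_apply, map_add]
      congr 1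
      · split_ifs <;> simp
      · split_ifs
        · rw [mul_X_row_eq hG a u, hS, ← vecAt_vecMul]
          rfl
        · rw [map_zero]
  rw [hS m ⟨u, hu⟩, key, ← s_eq]

theorem isJetFunction_L (k : ℤ) {f : Jet 𝕜 N → 𝕜} (hf : G.IsJetFunction f) :
    G.IsJetFunction (G.L k f) := by
  obtain ⟨F, hF⟩ := exists_agree hf
  exact isJetFunction_of_agree _ (L_eq (hG := hG) hF k)

theorem L_commutator {j k : ℤ} (hj : -1 ≤ j) (hk : -1 ≤ k) {f : Jet 𝕜 N → 𝕜}
    (hf : G.IsJetFunction f) {u : Jet 𝕜 N} (hu : u ∈ G.J0) :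
    G.L j (G.L k f) u - G.L k (G.L j f) u = ((j : 𝕜) - (k : 𝕜)) * G.L (j + k) f u := by
  obtain ⟨F, hF⟩ := exists_agree hf
  rw [L_eq (L_eq (hG := hG) hF k) j ⟨u, hu⟩, L_eq (L_eq (hG := hG) hF j) k ⟨u, hu⟩,
    L_eq (hG := hG) hF (j + k) ⟨u, hu⟩]
  obtain ⟨j, rfl⟩ : ∃ n : ℕ, j = n - 1 := ⟨(j + 1).toNat, by omega⟩
  obtain ⟨k, rfl⟩ : ∃ n : ℕ, k = n - 1 := ⟨(k + 1).toNat, by omega⟩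
  have h := congrArg (evalAt ⟨u, hu⟩) (DFunLike.congr_fun ((calculus hG).virasoro_lie j k) F)
  rw [Derivation.commutator_apply, Derivation.smul_apply, smul_eq_mul, map_mul, map_sub, map_sub,
    map_natCast, map_natCast] at h
  have h1 : ∀ n : ℕ, ((n : ℤ) - 1 + 1).toNat = n := fun n => by omega
  -- After the shift by one, both sides truncate to $0$ when both indices are $0$; that operator is
  -- multiplied by zero.
  have h2 : ((j : ℤ) - 1 + (k - 1) + 1).toNat = j + k - 1 := by omega
  rw [h1, h1, h2]
  push_cast
  rw [sub_sub_sub_cancel_right]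
  exact h

end FlatData

/-! ## Vector fields on Dubrovin manifolds -/

section Manifold

variable {𝕜 : Type*} [RCLike 𝕜] {N : ℕ} {M : Type*} [TopologicalSpace M]
  [ChartedSpace (Fin N → 𝕜) M] [IsManifold 𝓘(𝕜, Fin N → 𝕜) ∞ M]

section Smooth

variable {X Y : VField 𝕜 N M} {x : M}

lemma SmoothVFieldAt.mdifferentiableAt (hX : SmoothVFieldAt X x) :
    MDifferentiableAt 𝓘(𝕜, Fin N → 𝕜) (𝓘(𝕜, Fin N → 𝕜).prod 𝓘(𝕜, Fin N → 𝕜))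
      (fun y => (⟨y, X y⟩ : TangentBundle 𝓘(𝕜, Fin N → 𝕜) M)) x :=
  ContMDiffAt.mdifferentiableAt hX (by simp)

lemma SmoothVFieldAt.add (hX : SmoothVFieldAt X x) (hY : SmoothVFieldAt Y x) :
    SmoothVFieldAt (X + Y) x :=
  ContMDiffAt.add_section hX hY

lemma SmoothVFieldAt.const_smul (c : 𝕜) (hX : SmoothVFieldAt X x) :
    SmoothVFieldAt (c • X) x :=
  ContMDiffAt.const_smul_section hX

end Smooth

namespace DubrovinManifold

variable (D : DubrovinManifold 𝕜 N M) {X Y Z W : VField 𝕜 N M} {x : M}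

/-- The product of vector fields. -/
def prod (X Y : VField 𝕜 N M) : VField 𝕜 N M := fun y => D.mul y (X y) (Y y)

/-- The covariant derivative `∇_X Y`. -/
def covDer (X Y : VField 𝕜 N M) : VField 𝕜 N M := fun y => D.nabla Y y (X y)

lemma nabla_add (hX : SmoothVFieldAt X x) (hY : SmoothVFieldAt Y x) :
    D.nabla (X + Y) x = D.nabla X x + D.nabla Y x :=
  D.nabla.isCovariantDerivativeOnUniv.add hX.mdifferentiableAt hY.mdifferentiableAt

lemma nabla_const_smul (c : 𝕜) (hX : SmoothVFieldAt X x) :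
    D.nabla (c • X) x = c • D.nabla X x :=
  D.nabla.isCovariantDerivativeOnUniv.smul_const c hX.mdifferentiableAt

lemma nabla_sub (hX : SmoothVFieldAt X x) (hY : SmoothVFieldAt Y x) :
    D.nabla (X - Y) x = D.nabla X x - D.nabla Y x := by
  have h := D.nabla_add hX (hY.const_smul (-1))
  rw [D.nabla_const_smul _ hY, neg_one_smul, neg_one_smul, ← sub_eq_add_neg, ← sub_eq_add_neg] at h
  exact h

lemma mlieBracket_eq (hX : SmoothVFieldAt X x) (hY : SmoothVFieldAt Y x) :
    VectorField.mlieBracket 𝓘(𝕜, Fin N → 𝕜) X Y x = D.covDer X Y x - D.covDer Y X x := by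
  have h := D.torsion_free 0 X Y x hX hY
  rw [zero_smul, zero_smul, sub_zero, sub_zero] at h
  exact h.symm

lemma prod_comm_apply (hX : SmoothVFieldAt X x) (hY : SmoothVFieldAt Y x) :
    D.prod X Y x = D.prod Y X x := by
  have h := D.torsion_free 1 X Y x hX hY
  rw [D.mlieBracket_eq hX hY, one_smul, one_smul, sub_sub_sub_comm] at h
  exact sub_eq_zero.1 (sub_eq_self.1 h)

lemma pencil_apply (z : 𝕜) (hY : SmoothVFieldAt Y x)
    (hZ : SmoothVFieldAt Z x) :
    (D.nabla (fun y => D.nabla Z y (Y y) - z • D.mul y (Y y) (Z y)) x (X x)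
      - z • D.mul x (X x) (D.nabla Z x (Y x) - z • D.mul x (Y x) (Z x)))
    = D.covDer X (D.covDer Y Z) x
      - z • (D.covDer X (D.prod Y Z) x + D.prod X (D.covDer Y Z) x)
      + (z * z) • D.prod X (D.prod Y Z) x := by
  have h1 : SmoothVFieldAt (D.covDer Y Z) x := D.smooth_nabla Y Z x hY hZ
  have h2 : SmoothVFieldAt (D.prod Y Z) x := D.smooth_mul Y Z x hY hZ
  have h3 : D.nabla (fun y => D.nabla Z y (Y y) - z • D.mul y (Y y) (Z y)) x
      = D.nabla (D.covDer Y Z) x - z • D.nabla (D.prod Y Z) x := by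
    rw [← D.nabla_const_smul z h2, ← D.nabla_sub h1 (h2.const_smul z)]
    rfl
  rw [h3, ContinuousLinearMap.map_sub, ContinuousLinearMap.map_smul]
  change D.covDer X (D.covDer Y Z) x - z • D.covDer X (D.prod Y Z) x
    - z • (D.prod X (D.covDer Y Z) x - z • D.prod X (D.prod Y Z) x) = _
  module

lemma curvature (z : 𝕜) (hX : SmoothVFieldAt X x) (hY : SmoothVFieldAt Y x)
    (hZ : SmoothVFieldAt Z x) :
    (D.covDer X (D.covDer Y Z) x - D.covDer Y (D.covDer X Z) x
        - D.covDer (VectorField.mlieBracket 𝓘(𝕜, Fin N → 𝕜) X Y) Z x)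
      - z • (D.covDer X (D.prod Y Z) x + D.prod X (D.covDer Y Z) x
          - D.covDer Y (D.prod X Z) x - D.prod Y (D.covDer X Z) x
          - D.prod (VectorField.mlieBracket 𝓘(𝕜, Fin N → 𝕜) X Y) Z x)
      + (z * z) • (D.prod X (D.prod Y Z) x - D.prod Y (D.prod X Z) x) = 0 := by
  have h := D.flat z X Y Z x hX hY hZ
  dsimp only at h
  rw [D.pencil_apply z hY hZ, D.pencil_apply z hX hZ] at h
  rw [← h]
  change _ = _ - (D.covDer (VectorField.mlieBracket 𝓘(𝕜, Fin N → 𝕜) X Y) Z x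
    - z • D.prod (VectorField.mlieBracket 𝓘(𝕜, Fin N → 𝕜) X Y) Z x)
  module

lemma prod_assoc_apply (hX : SmoothVFieldAt X x) (hY : SmoothVFieldAt Y x)
    (hZ : SmoothVFieldAt Z x) : D.prod X (D.prod Y Z) x = D.prod Y (D.prod X Z) x := by
  have h0 := D.curvature 0 hX hY hZ
  have h1 := D.curvature 1 hX hY hZ
  have h2 := D.curvature (-1) hX hY hZ
  rw [← sub_eq_zero]
  -- The curvature is quadratic in $z$; the second difference at $0,\pm1$ isolates the coefficient
  -- of $z^2$.
  have h : (2 : 𝕜) • (D.prod X (D.prod Y Z) x - D.prod Y (D.prod X Z) x) = 0 := by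
    linear_combination (norm := module) h1 + h2 - (2 : 𝕜) • h0
  exact (smul_eq_zero.1 h).resolve_left two_ne_zero

lemma covDer_prod_symm (hX : SmoothVFieldAt X x) (hY : SmoothVFieldAt Y x)
    (hZ : SmoothVFieldAt Z x) :
    D.covDer X (D.prod Y Z) x + D.prod X (D.covDer Y Z) x
      = D.covDer Y (D.prod X Z) x + D.prod Y (D.covDer X Z) x
        + D.prod (VectorField.mlieBracket 𝓘(𝕜, Fin N → 𝕜) X Y) Z x := by
  have h1 := D.curvature 1 hX hY hZ
  have h2 := D.curvature (-1) hX hY hZ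
  rw [← sub_eq_zero]
  -- The difference of the values at $z=-1$ and $z=1$ isolates the linear coefficient.
  have h : (2 : 𝕜) • (D.covDer X (D.prod Y Z) x + D.prod X (D.covDer Y Z) x
      - (D.covDer Y (D.prod X Z) x + D.prod Y (D.covDer X Z) x
        + D.prod (VectorField.mlieBracket 𝓘(𝕜, Fin N → 𝕜) X Y) Z x)) = 0 := by
    linear_combination (norm := module) h2 - h1
  exact (smul_eq_zero.1 h).resolve_left two_ne_zero

end DubrovinManifold

end Manifold

/-! ## Powers of the Euler vector field -/

section HertlingManin

variable {S : Type*} [CommRing S] (nab : S → S → S)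

/-- The covariant derivative of the product. -/
def covMul (X Y Z : S) : S := nab X (Y * Z) - nab X Y * Z - Y * nab X Z

/-- The bracket of a torsion-free connection. -/
def torsionFreeBracket (X Y : S) : S := nab X Y - nab Y X

/-- The Lie derivative of the product. -/
def lieMul (X Y Z : S) : S :=
  torsionFreeBracket nab X (Y * Z) - torsionFreeBracket nab X Y * Z
    - Y * torsionFreeBracket nab X Z

variable {nab}

lemma torsionFreeBracket_swap (X Y : S) :
    torsionFreeBracket nab X Y = -torsionFreeBracket nab Y X := by
  simp [torsionFreeBracket]

/-- Covariant differentiation along $X$ of $(Y\circ Z)\circ W=Y\circ(Z\circ W)$. -/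
lemma covMul_assoc (X Y Z W : S) : covMul nab X (Y * Z) W
    = covMul nab X Y (Z * W) + Y * covMul nab X Z W - W * covMul nab X Y Z := by
  unfold covMul
  rw [mul_assoc Y Z W]
  ring

/-- The identity of Hertling and Manin. -/
lemma lieMul_mul (h : ∀ X Y Z, covMul nab X Y Z = covMul nab Y X Z) (X W Y Z : S) :
    lieMul nab (X * W) Y Z = X * lieMul nab W Y Z + W * lieMul nab X Y Z := by
  have e1 : ∀ X Y Z, nab X (Y * Z) = covMul nab X Y Z + nab X Y * Z + Y * nab X Z := fun X Y Z => by
    unfold covMul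
    ring
  have a1 := covMul_assoc (nab := nab) X Y Z W
  have a2 := covMul_assoc (nab := nab) Y X W Z
  rw [h X Y, mul_comm Z W] at a1
  unfold lieMul torsionFreeBracket
  rw [e1 (X * W) Y Z, e1 (Y * Z) X W, e1 Y X W, e1 Z X W, e1 W Y Z, e1 X Y Z]
  -- Both differentiated associativity laws contain $(\nabla_Y\circ)(X,W\circ Z)$, which the
  -- difference eliminates; the rest matches by symmetry of $\nabla\circ$.
  linear_combination a2 - a1 + h (X * W) Y Z - h (Y * Z) X W + Y * h Z X W + X * h Y W Z

variable {E : S}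

lemma lieMul_pow (h : ∀ X Y Z, covMul nab X Y Z = covMul nab Y X Z)
    (hE : ∀ X Y, lieMul nab E X Y = X * Y) (n : ℕ) (X Y : S) :
    lieMul nab (E ^ n) X Y = n * E ^ (n - 1) * (X * Y) := by
  induction n with
  | zero =>
    -- With both factors equal to the unit, the identity reads $a=a+a$, so $\mathcal L_e(\circ)=0$.
    have := lieMul_mul h 1 1 X Y
    rw [one_mul, one_mul, left_eq_add] at this
    rw [pow_zero, this]
    simp
  | succ n ih =>
    rw [pow_succ', lieMul_mul h, ih, hE, Nat.add_sub_cancel]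
    rcases n with _ | n
    · simp
    · rw [Nat.add_sub_cancel]
      push_cast
      ring

lemma torsionFreeBracket_pow (h : ∀ X Y Z, covMul nab X Y Z = covMul nab Y X Z)
    (hE : ∀ X Y, lieMul nab E X Y = X * Y) (n k : ℕ) :
    torsionFreeBracket nab (E ^ n) (E ^ k) = ((k : S) - n) * E ^ (n + k - 1) := by
  have hb : ∀ X Y Z, torsionFreeBracket nab X (Y * Z)
      = lieMul nab X Y Z + torsionFreeBracket nab X Y * Z + Y * torsionFreeBracket nab X Z :=
    fun X Y Z => by
      unfold lieMul
      ring
  -- From $e=e\circ e$; in particular $[E,e]=-e$, the start of the next induction.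
  have h1 : ∀ X, torsionFreeBracket nab X 1 = -lieMul nab X 1 1 := fun X => by
    have := hb X 1 1
    rw [one_mul] at this
    linear_combination -this
  have hEk : ∀ k : ℕ, torsionFreeBracket nab E (E ^ k) = ((k : S) - 1) * E ^ k := by
    intro k
    induction k with
    | zero =>
      rw [pow_zero, h1, hE]
      simp
    | succ k ih =>
      rw [pow_succ', hb, hE, ih, show torsionFreeBracket nab E E = 0 from sub_self _]
      push_cast
      ring
  induction k with
  | zero =>
    rw [pow_zero, h1, lieMul_pow h hE]
    simp
  | succ k ih =>
    rw [pow_succ' E k, hb, lieMul_pow h hE, ih, torsionFreeBracket_swap _ E, hEk]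
    rcases n with _ | n
    · rcases k with _ | k
      · simp
      · rw [zero_add, zero_add, Nat.add_sub_cancel, Nat.add_sub_cancel]
        push_cast
        ring
    · rw [Nat.add_sub_cancel, show n + 1 + k - 1 = n + k by omega,
        show n + 1 + (k + 1) - 1 = n + k + 1 by omega]
      push_cast
      ring

end HertlingManin

/-! ### The ring of smooth vector fields. -/

section Manifold

variable {𝕜 : Type*} [RCLike 𝕜] {N : ℕ} {M : Type*} [TopologicalSpace M]
  [ChartedSpace (Fin N → 𝕜) M] [IsManifold 𝓘(𝕜, Fin N → 𝕜) ∞ M]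

namespace DubrovinManifold

variable (D : DubrovinManifold 𝕜 N M)

/-- The group of smooth vector fields. -/
def smoothFields : AddSubgroup (VField 𝕜 N M) where
  carrier := {X | ∀ x, SmoothVFieldAt X x}
  add_mem' hX hY x := (hX x).add (hY x)
  zero_mem' x := by
    have := (D.smooth_one x).const_smul 0
    rwa [zero_smul] at this
  neg_mem' {X} hX x := by
    have := (hX x).const_smul (-1)
    rwa [neg_one_smul] at this

/-- The smooth vector fields, as a ring with the product `∘`. -/
def SmoothField : Type _ := D.smoothFields

instance : AddCommGroup D.SmoothField := inferInstanceAs (AddCommGroup D.smoothFields)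

variable {D}

lemma SmoothField.ext {X Y : D.SmoothField} (h : ∀ x, X.1 x = Y.1 x) : X = Y :=
  Subtype.ext (funext h)

instance : Mul D.SmoothField :=
  ⟨fun X Y => ⟨D.prod X.1 Y.1, fun x => D.smooth_mul _ _ x (X.2 x) (Y.2 x)⟩⟩

instance : One D.SmoothField := ⟨⟨D.one, D.smooth_one⟩⟩

lemma SmoothField.mul_val (X Y : D.SmoothField) : (X * Y).1 = D.prod X.1 Y.1 := rfl

lemma SmoothField.mul_comm' (X Y : D.SmoothField) : X * Y = Y * X :=
  SmoothField.ext fun x => D.prod_comm_apply (X.2 x) (Y.2 x)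

lemma SmoothField.mul_left_comm' (X Y Z : D.SmoothField) : X * (Y * Z) = Y * (X * Z) :=
  SmoothField.ext fun x => D.prod_assoc_apply (X.2 x) (Y.2 x) (Z.2 x)

lemma SmoothField.mul_add' (X Y Z : D.SmoothField) : X * (Y + Z) = X * Y + X * Z :=
  SmoothField.ext fun x => (D.mul x (X.1 x)).map_add (Y.1 x) (Z.1 x)

lemma SmoothField.one_mul' (X : D.SmoothField) : 1 * X = X :=
  SmoothField.ext fun x => D.one_mul x (X.1 x)

instance : CommRing D.SmoothField :=
  { (inferInstance : AddCommGroup D.SmoothField),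
    (inferInstance : Mul D.SmoothField),
    (inferInstance : One D.SmoothField) with
    left_distrib := SmoothField.mul_add'
    right_distrib := fun X Y Z => by
      rw [SmoothField.mul_comm', SmoothField.mul_add', SmoothField.mul_comm' Z,
        SmoothField.mul_comm' Z]
    zero_mul := fun X => by
      have := SmoothField.mul_add' X 0 0
      rw [add_zero, left_eq_add] at this
      rw [SmoothField.mul_comm', this]
    mul_zero := fun X => by
      have := SmoothField.mul_add' X 0 0
      rwa [add_zero, left_eq_add] at this
    mul_assoc := fun X Y Z => by
      rw [SmoothField.mul_comm', SmoothField.mul_left_comm', SmoothField.mul_comm' Z]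
    one_mul := SmoothField.one_mul'
    mul_one := fun X => by rw [SmoothField.mul_comm', SmoothField.one_mul']
    mul_comm := SmoothField.mul_comm' }

/-- The connection `∇` on smooth vector fields. -/
def SmoothField.nab (X Y : D.SmoothField) : D.SmoothField :=
  ⟨D.covDer X.1 Y.1, fun x => D.smooth_nabla _ _ x (X.2 x) (Y.2 x)⟩

/-- The part of the curvature linear in $z$, with the bracket written as $\nabla_XY-\nabla_YX$. -/
lemma SmoothField.covMul_symm (X Y Z : D.SmoothField) :
    covMul SmoothField.nab X Y Z = covMul SmoothField.nab Y X Z := by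
  have h : nab X (Y * Z) + X * nab Y Z
      = nab Y (X * Z) + Y * nab X Z + (nab X Y - nab Y X) * Z := by
    refine SmoothField.ext fun x => ?_
    refine (D.covDer_prod_symm (X.2 x) (Y.2 x) (Z.2 x)).trans ?_
    have : D.prod (VectorField.mlieBracket 𝓘(𝕜, Fin N → 𝕜) X.1 Y.1) Z.1 x
        = D.mul x (D.covDer X.1 Y.1 x - D.covDer Y.1 X.1 x) (Z.1 x) := by
      rw [prod, D.mlieBracket_eq (X.2 x) (Y.2 x)]
    rw [this]
    rfl
  unfold covMul
  linear_combination h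

lemma SmoothField.bracket_apply (X Y : D.SmoothField) (x : M) :
    VectorField.mlieBracket 𝓘(𝕜, Fin N → 𝕜) X.1 Y.1 x
      = (torsionFreeBracket SmoothField.nab X Y).1 x :=
  D.mlieBracket_eq (X.2 x) (Y.2 x)

end DubrovinManifold

namespace ConformalDubrovinManifold

open DubrovinManifold

variable (D : ConformalDubrovinManifold 𝕜 N M)

/-- The Euler vector field as a smooth vector field. -/
def eulerField : D.toDubrovinManifold.SmoothField := ⟨D.euler, D.smooth_euler⟩

lemma eulerPow_eq (n : ℕ) : eulerPow D n = (D.eulerField ^ n).1 := by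
  induction n with
  | zero => rfl
  | succ n ih =>
    rw [pow_succ', SmoothField.mul_val, ← ih]
    rfl

lemma lieMul_eulerField (X Y : D.toDubrovinManifold.SmoothField) :
    lieMul SmoothField.nab D.eulerField X Y = X * Y := by
  have h : torsionFreeBracket SmoothField.nab D.eulerField (X * Y)
      = torsionFreeBracket SmoothField.nab D.eulerField X * Y
        + X * torsionFreeBracket SmoothField.nab D.eulerField Y + X * Y := by
    refine SmoothField.ext fun x => ?_
    rw [← SmoothField.bracket_apply]
    refine (D.euler_mul X.1 Y.1 x (X.2 x) (Y.2 x)).trans ?_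
    have h1 := SmoothField.bracket_apply D.eulerField X x
    have h2 := SmoothField.bracket_apply D.eulerField Y x
    change VectorField.mlieBracket _ D.euler X.1 x = _ at h1
    change VectorField.mlieBracket _ D.euler Y.1 x = _ at h2
    rw [h1, h2]
    rfl
  unfold lieMul
  linear_combination h

/-- An integer in the ring of vector fields is a multiple of $e$, so multiplying by it is pointwise
scaling. -/
lemma intCast_mul_apply (n : ℤ) (X : D.toDubrovinManifold.SmoothField) (x : M) :
    ((n : D.toDubrovinManifold.SmoothField) * X).1 x = (n : 𝕜) • X.1 x := by
  let f : D.toDubrovinManifold.SmoothField →+ TangentSpace 𝓘(𝕜, Fin N → 𝕜) x :=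
    { toFun := fun X => X.1 x
      map_zero' := rfl
      map_add' := fun _ _ => rfl }
  rw [← zsmul_eq_mul, Int.cast_smul_eq_zsmul]
  exact map_zsmul f n X

theorem mlieBracket_eulerPow (j k : ℕ) (x : M) :
    VectorField.mlieBracket 𝓘(𝕜, Fin N → 𝕜) (eulerPow D j) (eulerPow D k) x
      = ((k : 𝕜) - (j : 𝕜)) • eulerPow D (j + k - 1) x := by
  rw [eulerPow_eq, eulerPow_eq, eulerPow_eq, SmoothField.bracket_apply,
    torsionFreeBracket_pow SmoothField.covMul_symm D.lieMul_eulerField]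
  have := D.intCast_mul_apply ((k : ℤ) - j) (D.eulerField ^ (j + k - 1)) x
  push_cast at this
  exact this

end ConformalDubrovinManifold

end Manifold

/-! ## Flat charts -/

section Manifold

variable {𝕜 : Type*} [RCLike 𝕜] {N : ℕ} {M : Type*} [TopologicalSpace M]
  [ChartedSpace (Fin N → 𝕜) M]

/-- The components of a vector field as functions of the coordinates. -/
def chartField (φ : OpenPartialHomeomorph M (Fin N → 𝕜)) (Y : VField 𝕜 N M) (u : Fin N → 𝕜) :
    Fin N → 𝕜 :=
  chartComp φ (φ.symm u) (Y (φ.symm u))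

lemma chartComp_sub (φ : OpenPartialHomeomorph M (Fin N → 𝕜)) {x : M}
    (v w : TangentSpace 𝓘(𝕜, Fin N → 𝕜) x) :
    chartComp φ x (v - w) = chartComp φ x v - chartComp φ x w :=
  (mfderiv 𝓘(𝕜, Fin N → 𝕜) 𝓘(𝕜, Fin N → 𝕜) φ x).map_sub v w

lemma chartComp_add (φ : OpenPartialHomeomorph M (Fin N → 𝕜)) {x : M}
    (v w : TangentSpace 𝓘(𝕜, Fin N → 𝕜) x) :
    chartComp φ x (v + w) = chartComp φ x v + chartComp φ x w :=
  (mfderiv 𝓘(𝕜, Fin N → 𝕜) 𝓘(𝕜, Fin N → 𝕜) φ x).map_add v w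

lemma chartComp_zero (φ : OpenPartialHomeomorph M (Fin N → 𝕜)) (x : M) :
    chartComp φ x (0 : TangentSpace 𝓘(𝕜, Fin N → 𝕜) x) = 0 :=
  (mfderiv 𝓘(𝕜, Fin N → 𝕜) 𝓘(𝕜, Fin N → 𝕜) φ x).map_zero

lemma chartComp_sum_smul (φ : OpenPartialHomeomorph M (Fin N → 𝕜)) {x : M} {ι : Type*}
    (s : Finset ι) (c : ι → 𝕜) (v : ι → TangentSpace 𝓘(𝕜, Fin N → 𝕜) x) :
    chartComp φ x (∑ i ∈ s, c i • v i) = ∑ i ∈ s, c i • chartComp φ x (v i) := by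
  refine (map_sum (mfderiv 𝓘(𝕜, Fin N → 𝕜) 𝓘(𝕜, Fin N → 𝕜) φ x) _ _).trans ?_
  exact Finset.sum_congr rfl fun i _ =>
    (mfderiv 𝓘(𝕜, Fin N → 𝕜) 𝓘(𝕜, Fin N → 𝕜) φ x).map_smul _ _

lemma chartField_apply {φ : OpenPartialHomeomorph M (Fin N → 𝕜)} {x : M} (hx : x ∈ φ.source)
    (Y : VField 𝕜 N M) : chartField φ Y (φ x) = chartComp φ x (Y x) := by
  rw [chartField, φ.left_inv hx]

lemma mdifferentiable_of_mem_maximalAtlas {φ : OpenPartialHomeomorph M (Fin N → 𝕜)}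
    (hφ : φ ∈ IsManifold.maximalAtlas 𝓘(𝕜, Fin N → 𝕜) ∞ M) :
    φ.MDifferentiable 𝓘(𝕜, Fin N → 𝕜) 𝓘(𝕜, Fin N → 𝕜) :=
  ⟨(contMDiffOn_of_mem_maximalAtlas hφ).mdifferentiableOn (by simp),
    (contMDiffOn_symm_of_mem_maximalAtlas hφ).mdifferentiableOn (by simp)⟩

section Chart

variable {φ : OpenPartialHomeomorph M (Fin N → 𝕜)}
  (hφ : φ ∈ IsManifold.maximalAtlas 𝓘(𝕜, Fin N → 𝕜) ∞ M)
include hφ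

lemma mfderiv_symm_chartComp {x : M} (hx : x ∈ φ.source)
    (v : TangentSpace 𝓘(𝕜, Fin N → 𝕜) x) :
    mfderiv 𝓘(𝕜, Fin N → 𝕜) 𝓘(𝕜, Fin N → 𝕜) φ.symm (φ x) (chartComp φ x v) = v :=
  ((mdifferentiable_of_mem_maximalAtlas hφ).mfderiv hx).symm_apply_apply v

lemma chartComp_mfderiv_symm {x : M} (hx : x ∈ φ.source) (w : Fin N → 𝕜) :
    chartComp φ x (mfderiv 𝓘(𝕜, Fin N → 𝕜) 𝓘(𝕜, Fin N → 𝕜) φ.symm (φ x) w) = w :=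
  ((mdifferentiable_of_mem_maximalAtlas hφ).mfderiv hx).apply_symm_apply w

lemma chartComp_chartFrame {x : M} (hx : x ∈ φ.source) (a : Fin N) :
    chartComp φ x (chartFrame φ a x) = Pi.single a 1 :=
  chartComp_mfderiv_symm hφ hx _

lemma sum_chartComp_smul_chartFrame {x : M} (hx : x ∈ φ.source)
    (v : TangentSpace 𝓘(𝕜, Fin N → 𝕜) x) : ∑ a, chartComp φ x v a • chartFrame φ a x = v := by
  conv_rhs => rw [← mfderiv_symm_chartComp hφ hx v, pi_eq_sum_univ' (chartComp φ x v)]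
  refine Eq.trans ?_ (map_sum (mfderiv 𝓘(𝕜, Fin N → 𝕜) 𝓘(𝕜, Fin N → 𝕜) φ.symm (φ x)) _ _).symm
  refine Finset.sum_congr rfl fun a _ => ?_
  refine Eq.trans ?_ ((mfderiv 𝓘(𝕜, Fin N → 𝕜) 𝓘(𝕜, Fin N → 𝕜) φ.symm (φ x)).map_smul _ _).symm
  congr 2

lemma isInvertible_mfderiv {x : M} (hx : x ∈ φ.source) :
    (mfderiv 𝓘(𝕜, Fin N → 𝕜) 𝓘(𝕜, Fin N → 𝕜) φ x).IsInvertible :=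
  ⟨(mdifferentiable_of_mem_maximalAtlas hφ).mfderiv hx, rfl⟩

lemma inverse_mfderiv {x : M} (hx : x ∈ φ.source) :
    (mfderiv 𝓘(𝕜, Fin N → 𝕜) 𝓘(𝕜, Fin N → 𝕜) φ x).inverse
      = mfderiv 𝓘(𝕜, Fin N → 𝕜) 𝓘(𝕜, Fin N → 𝕜) φ.symm (φ x) :=
  ContinuousLinearMap.inverse_equiv ((mdifferentiable_of_mem_maximalAtlas hφ).mfderiv hx)

lemma isInvertible_mfderiv_symm {u : Fin N → 𝕜} (hu : u ∈ φ.target) :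
    (mfderiv 𝓘(𝕜, Fin N → 𝕜) 𝓘(𝕜, Fin N → 𝕜) φ.symm u).IsInvertible :=
  ⟨(mdifferentiable_of_mem_maximalAtlas hφ).symm.mfderiv hu, rfl⟩

lemma inverse_mfderiv_symm {u : Fin N → 𝕜} (hu : u ∈ φ.target) :
    (mfderiv 𝓘(𝕜, Fin N → 𝕜) 𝓘(𝕜, Fin N → 𝕜) φ.symm u).inverse
      = mfderiv 𝓘(𝕜, Fin N → 𝕜) 𝓘(𝕜, Fin N → 𝕜) φ (φ.symm u) :=
  ContinuousLinearMap.inverse_equiv ((mdifferentiable_of_mem_maximalAtlas hφ).symm.mfderiv hu)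

variable [IsManifold 𝓘(𝕜, Fin N → 𝕜) ∞ M]

/-- Near $x$ the frame field is the pull-back under $\varphi$ of a constant field. -/
lemma smoothVFieldAt_chartFrame {x : M} (hx : x ∈ φ.source) (a : Fin N) :
    SmoothVFieldAt (chartFrame φ a) x := by
  have h := ContMDiffAt.mpullback_vectorField_preimage (m := ∞) (n := ∞) (f := φ) (x₀ := x)
    (V := fun _ => (Pi.single a 1 : Fin N → 𝕜))
    (contMDiffAt_vectorSpace_iff_contDiffAt.2 contDiffAt_const)
    (contMDiffAt_of_mem_maximalAtlas hφ hx) (isInvertible_mfderiv hφ hx) (by simp)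
  refine ContMDiffAt.congr_of_eventuallyEq h ?_
  filter_upwards [φ.open_source.mem_nhds hx] with y hy
  change (⟨y, chartFrame φ a y⟩ : TangentBundle 𝓘(𝕜, Fin N → 𝕜) M)
    = ⟨y, (mfderiv 𝓘(𝕜, Fin N → 𝕜) 𝓘(𝕜, Fin N → 𝕜) φ y).inverse (Pi.single a 1 : Fin N → 𝕜)⟩
  rw [inverse_mfderiv hφ hy]
  rfl

lemma contDiffAt_chartField {Y : VField 𝕜 N M} {u : Fin N → 𝕜} (hu : u ∈ φ.target)
    (hY : SmoothVFieldAt Y (φ.symm u)) : ContDiffAt 𝕜 ∞ (chartField φ Y) u := by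
  have h := ContMDiffAt.mpullback_vectorField_preimage (m := ∞) (n := ∞) (f := φ.symm) (x₀ := u)
    (V := Y) hY (contMDiffAt_symm_of_mem_maximalAtlas hφ hu) (isInvertible_mfderiv_symm hφ hu)
    (by simp)
  refine (contMDiffAt_vectorSpace_iff_contDiffAt.1 h).congr_of_eventuallyEq ?_
  filter_upwards [φ.open_target.mem_nhds hu] with v hv
  rw [VectorField.mpullback, inverse_mfderiv_symm hφ hv]
  rfl

end Chart

namespace DubrovinManifold

variable [IsManifold 𝓘(𝕜, Fin N → 𝕜) ∞ M]
variable {D : DubrovinManifold 𝕜 N M} {φ : OpenPartialHomeomorph M (Fin N → 𝕜)}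

lemma nabla_sum {ι : Type*} (s : Finset ι) (Y : ι → VField 𝕜 N M) {x : M}
    (hY : ∀ i ∈ s, MDifferentiableAt 𝓘(𝕜, Fin N → 𝕜) (𝓘(𝕜, Fin N → 𝕜).prod 𝓘(𝕜, Fin N → 𝕜))
      (fun y => (⟨y, Y i y⟩ : TangentBundle 𝓘(𝕜, Fin N → 𝕜) M)) x) :
    D.nabla (∑ i ∈ s, Y i) x = ∑ i ∈ s, D.nabla (Y i) x := by
  classical
  induction s using Finset.induction_on with
  | empty =>
    rw [Finset.sum_empty, Finset.sum_empty, CovariantDerivative.zero]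
    rfl
  | insert i s hi ih =>
    rw [Finset.sum_insert hi, Finset.sum_insert hi, ← ih fun j hj => hY j (by simp [hj])]
    refine D.nabla.isCovariantDerivativeOnUniv.add (hY i (by simp)) ?_
    have := MDifferentiableAt.sum_section (s := s) (t := Y) (x₀ := x)
      fun j hj => hY j (by simp [hj])
    convert! this using 3
    rw [Finset.sum_apply]

/-- In flat coordinates the connection acts componentwise. -/
lemma chartComp_nabla (h : IsFlatChart D φ) {Y : VField 𝕜 N M} {x : M}
    (hx : x ∈ φ.source) (hY : SmoothVFieldAt Y x) (v : TangentSpace 𝓘(𝕜, Fin N → 𝕜) x) :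
    chartComp φ x (D.nabla Y x v) = fderiv 𝕜 (chartField φ Y) (φ x) (chartComp φ x v) := by
  have hφ := h.1
  let g : Fin N → M → 𝕜 := fun a y => chartField φ Y (φ y) a
  have hc : DifferentiableAt 𝕜 (chartField φ Y) (φ x) :=
    (contDiffAt_chartField hφ (φ.map_source hx) (by rwa [φ.left_inv hx])).differentiableAt (by simp)
  have hca : ∀ a, HasFDerivAt (fun w => chartField φ Y w a)
      ((ContinuousLinearMap.proj a).comp (fderiv 𝕜 (chartField φ Y) (φ x))) (φ x) :=
    fun a => hasFDerivAt_pi'.1 hc.hasFDerivAt a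
  have hφd : HasMFDerivAt 𝓘(𝕜, Fin N → 𝕜) 𝓘(𝕜, Fin N → 𝕜) φ x
      (mfderiv 𝓘(𝕜, Fin N → 𝕜) 𝓘(𝕜, Fin N → 𝕜) φ x) :=
    ((mdifferentiable_of_mem_maximalAtlas hφ).mdifferentiableAt hx).hasMFDerivAt
  have hg : ∀ a, HasMFDerivAt 𝓘(𝕜, Fin N → 𝕜) 𝓘(𝕜, 𝕜) (g a) x
      (((ContinuousLinearMap.proj a).comp (fderiv 𝕜 (chartField φ Y) (φ x))).comp
        (mfderiv 𝓘(𝕜, Fin N → 𝕜) 𝓘(𝕜, Fin N → 𝕜) φ x)) :=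
    fun a => HasMFDerivAt.comp x (hca a).hasMFDerivAt hφd
  have hframe := fun a => (smoothVFieldAt_chartFrame hφ hx a).mdifferentiableAt
  have hterm := fun a => MDifferentiableAt.smul_section (hg a).mdifferentiableAt (hframe a)
  have hsum : D.nabla (∑ a, g a • chartFrame φ a) x = ∑ a, D.nabla (g a • chartFrame φ a) x :=
    nabla_sum _ _ fun a _ => hterm a
  -- The frame expansion of $Y$ holds only on the chart domain, which suffices because a connection
  -- is local.
  have hcongr : D.nabla Y x = D.nabla (∑ a, g a • chartFrame φ a) x := by
    refine D.nabla.isCovariantDerivativeOnUniv.congr_of_eventuallyEq hY.mdifferentiableAt ?_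
      Filter.univ_mem ?_
    · have := MDifferentiableAt.sum_section (s := Finset.univ)
        (t := fun a => g a • chartFrame φ a) (x₀ := x) fun a _ => hterm a
      convert! this using 3
      rw [Finset.sum_apply]
    · filter_upwards [φ.open_source.mem_nhds hx] with y hy
      rw [Finset.sum_apply]
      conv_lhs => rw [← sum_chartComp_smul_chartFrame hφ hy (Y y)]
      refine Finset.sum_congr rfl fun a _ => ?_
      change _ = chartComp φ (φ.symm (φ y)) (Y (φ.symm (φ y))) a • chartFrame φ a y
      rw [φ.left_inv hy]
  have hleib : ∀ a, D.nabla (g a • chartFrame φ a) x v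
      = fderiv 𝕜 (chartField φ Y) (φ x) (chartComp φ x v) a • chartFrame φ a x := fun a => by
    rw [D.nabla.isCovariantDerivativeOnUniv.leibniz (hframe a) (hg a).mdifferentiableAt]
    have h0 := h.2 a x hx v
    have h1 : mvfderiv 𝓘(𝕜, Fin N → 𝕜) (g a) x v
        = fderiv 𝕜 (chartField φ Y) (φ x) (chartComp φ x v) a := by
      rw [mvfderiv, (hg a).mfderiv]
      rfl
    change g a x • D.nabla (chartFrame φ a) x v + mvfderiv 𝓘(𝕜, Fin N → 𝕜) (g a) x v •
      chartFrame φ a x = _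
    rw [h0, smul_zero, zero_add, h1]
  have hcw := chartComp_mfderiv_symm hφ hx (fderiv 𝕜 (chartField φ Y) (φ x) (chartComp φ x v))
  refine Eq.trans (congrArg (chartComp φ x) ?_) hcw
  rw [← sum_chartComp_smul_chartFrame hφ hx (mfderiv 𝓘(𝕜, Fin N → 𝕜) 𝓘(𝕜, Fin N → 𝕜) φ.symm (φ x)
    (fderiv 𝕜 (chartField φ Y) (φ x) (chartComp φ x v))), hcw, hcongr, hsum]
  refine (sum_apply _ _ _).trans ?_
  exact Finset.sum_congr rfl fun a _ => hleib a

end DubrovinManifold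

end Manifold

/-! ### The structure equations in a flat chart. -/

section Manifold

variable {𝕜 : Type*} [RCLike 𝕜] {N : ℕ} {M : Type*} [TopologicalSpace M]
  [ChartedSpace (Fin N → 𝕜) M] [IsManifold 𝓘(𝕜, Fin N → 𝕜) ∞ M]

lemma fderiv_apply_eq_sum {f : (Fin N → 𝕜) → Fin N → 𝕜} {u : Fin N → 𝕜}
    (hf : DifferentiableAt 𝕜 f u) (w : Fin N → 𝕜) (c : Fin N) :
    fderiv 𝕜 f u w c = ∑ d, w d * fderiv 𝕜 (fun v => f v c) u (Pi.single d 1) := by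
  have h : fderiv 𝕜 (fun v => f v c) u = (ContinuousLinearMap.proj c).comp (fderiv 𝕜 f u) :=
    (hasFDerivAt_pi'.1 hf.hasFDerivAt c).fderiv
  conv_lhs => rw [pi_eq_sum_univ' w, map_sum, Finset.sum_apply]
  refine Finset.sum_congr rfl fun d _ => ?_
  rw [map_smul, h]
  rfl

lemma fderiv_component {f : (Fin N → 𝕜) → Fin N → 𝕜} {u : Fin N → 𝕜}
    (hf : DifferentiableAt 𝕜 f u) (w : Fin N → 𝕜) (c : Fin N) :
    fderiv 𝕜 (fun v => f v c) u w = fderiv 𝕜 f u w c := by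
  rw [(hasFDerivAt_pi'.1 hf.hasFDerivAt c).fderiv]
  rfl

lemma ContinuousLinearMap.map_sum_smul {R E F ι : Type*} [Semiring R] [AddCommMonoid E]
    [AddCommMonoid F] [Module R E] [Module R F] [TopologicalSpace E] [TopologicalSpace F]
    (L : E →L[R] F) (s : Finset ι) (c : ι → R) (v : ι → E) :
    L (∑ i ∈ s, c i • v i) = ∑ i ∈ s, c i • L (v i) := by
  simp

namespace ConformalDubrovinManifold

variable {D : ConformalDubrovinManifold 𝕜 N M} {φ : OpenPartialHomeomorph M (Fin N → 𝕜)}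
  {x : M}

lemma chartComp_mul_chartFrame_chartFrame (hx : x ∈ φ.source) (a b : Fin N) :
    chartComp φ x (D.mul x (chartFrame φ a x) (chartFrame φ b x))
      = (D.inChart φ).A (φ x) a b :=
  (chartField_apply hx (D.prod (chartFrame φ a) (chartFrame φ b))).symm

lemma chartComp_mul (hφ : φ ∈ IsManifold.maximalAtlas 𝓘(𝕜, Fin N → 𝕜) ∞ M) (hx : x ∈ φ.source)
    (v w : TangentSpace 𝓘(𝕜, Fin N → 𝕜) x) :
    chartComp φ x (D.mul x v w)
      = chartComp φ x w ᵥ* ∑ a, chartComp φ x v a • (D.inChart φ).A (φ x) a := by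
  have h1 : D.mul x v w
      = ∑ a, chartComp φ x v a • D.mul x (chartFrame φ a x) w := by
    conv_lhs => rw [← sum_chartComp_smul_chartFrame hφ hx v]
    rw [ContinuousLinearMap.map_sum_smul]
    exact sum_apply _ _ _
  have h2 : ∀ a, D.mul x (chartFrame φ a x) w
      = ∑ b, chartComp φ x w b • D.mul x (chartFrame φ a x) (chartFrame φ b x) := fun a => by
    conv_lhs => rw [← sum_chartComp_smul_chartFrame hφ hx w]
    rw [ContinuousLinearMap.map_sum_smul]
  rw [h1, chartComp_sum_smul, Matrix.vecMul_sum]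
  refine Finset.sum_congr rfl fun a _ => ?_
  rw [h2, chartComp_sum_smul, Matrix.vecMul_smul, Matrix.vecMul_eq_sum]
  simp only [chartComp_mul_chartFrame_chartFrame hx]

lemma chartComp_chartFrame_mul (hφ : φ ∈ IsManifold.maximalAtlas 𝓘(𝕜, Fin N → 𝕜) ∞ M)
    (hx : x ∈ φ.source) (a : Fin N) (w : TangentSpace 𝓘(𝕜, Fin N → 𝕜) x) :
    chartComp φ x (D.mul x (chartFrame φ a x) w)
      = chartComp φ x w ᵥ* (D.inChart φ).A (φ x) a := by
  rw [chartComp_mul hφ hx, chartComp_chartFrame hφ hx]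
  simp [Pi.single_apply]

lemma chartComp_mul_chartFrame (hφ : φ ∈ IsManifold.maximalAtlas 𝓘(𝕜, Fin N → 𝕜) ∞ M)
    (hx : x ∈ φ.source) (v : TangentSpace 𝓘(𝕜, Fin N → 𝕜) x) (b c : Fin N) :
    chartComp φ x (D.mul x v (chartFrame φ b x)) c
      = ∑ d, chartComp φ x v d * (D.inChart φ).A (φ x) d b c := by
  rw [chartComp_mul hφ hx, chartComp_chartFrame hφ hx, Matrix.single_one_vecMul, Matrix.row_apply,
    Matrix.sum_apply]
  rfl

section FlatChart

variable (h : IsFlatChart D.toDubrovinManifold φ)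
include h

lemma smooth_frame_prod (hx : x ∈ φ.source) (a b : Fin N) :
    SmoothVFieldAt (D.prod (chartFrame φ a) (chartFrame φ b)) x :=
  D.smooth_mul _ _ x (smoothVFieldAt_chartFrame h.1 hx a) (smoothVFieldAt_chartFrame h.1 hx b)

lemma chartComp_nabla_chartFrame (hx : x ∈ φ.source) {Y : VField 𝕜 N M}
    (hY : SmoothVFieldAt Y x) (a : Fin N) :
    chartComp φ x (D.nabla Y x (chartFrame φ a x))
      = fderiv 𝕜 (chartField φ Y) (φ x) (Pi.single a 1) := by
  rw [DubrovinManifold.chartComp_nabla h hx hY, chartComp_chartFrame h.1 hx]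

lemma differentiableAt_chartField (hx : x ∈ φ.source) {Y : VField 𝕜 N M}
    (hY : SmoothVFieldAt Y x) : DifferentiableAt 𝕜 (chartField φ Y) (φ x) :=
  (contDiffAt_chartField h.1 (φ.map_source hx) (by rwa [φ.left_inv hx])).differentiableAt (by simp)

lemma mlieBracket_chartFrame (hx : x ∈ φ.source) (a : Fin N) {Y : VField 𝕜 N M}
    (hY : SmoothVFieldAt Y x) :
    VectorField.mlieBracket 𝓘(𝕜, Fin N → 𝕜) Y (chartFrame φ a) x
      = -D.nabla Y x (chartFrame φ a x) := by
  rw [D.mlieBracket_eq hY (smoothVFieldAt_chartFrame h.1 hx a), ← zero_sub]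
  exact congrArg (· - D.nabla Y x (chartFrame φ a x)) (h.2 a x hx (Y x))

lemma inChart_A_comm (hx : x ∈ φ.source) (a b c : Fin N) :
    (D.inChart φ).A (φ x) a b c = (D.inChart φ).A (φ x) b a c := by
  rw [← chartComp_mul_chartFrame_chartFrame hx, ← chartComp_mul_chartFrame_chartFrame hx]
  exact congrArg (fun v => chartComp φ x v c)
    (D.prod_comm_apply (smoothVFieldAt_chartFrame h.1 hx a) (smoothVFieldAt_chartFrame h.1 hx b))

lemma inChart_A_mul_comm (hx : x ∈ φ.source) (a b : Fin N) :
    (D.inChart φ).A (φ x) a * (D.inChart φ).A (φ x) b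
      = (D.inChart φ).A (φ x) b * (D.inChart φ).A (φ x) a := by
  -- Rows of the matrix product are iterated products of frame fields, so commutation is the
  -- $z^2$-part of flatness.
  have hrow : ∀ a b c, ((D.inChart φ).A (φ x) a * (D.inChart φ).A (φ x) b) c
      = chartComp φ x (D.prod (chartFrame φ b) (D.prod (chartFrame φ a) (chartFrame φ c)) x) :=
    fun a b c => by
      rw [DubrovinManifold.prod, chartComp_chartFrame_mul h.1 hx, DubrovinManifold.prod,
        chartComp_mul_chartFrame_chartFrame hx]
      rfl
  funext c
  rw [hrow, hrow, D.prod_assoc_apply (smoothVFieldAt_chartFrame h.1 hx b)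
    (smoothVFieldAt_chartFrame h.1 hx a) (smoothVFieldAt_chartFrame h.1 hx c)]

/-- In a parallel frame every term of `covDer_prod_symm` vanishes except the two derivatives of
products. -/
lemma inChart_A_flat (hx : x ∈ φ.source) (a b c d : Fin N) :
    fderiv 𝕜 (fun v => (D.inChart φ).A v a b c) (φ x) (Pi.single d 1)
      = fderiv 𝕜 (fun v => (D.inChart φ).A v d b c) (φ x) (Pi.single a 1) := by
  have hf := fun a => smoothVFieldAt_chartFrame h.1 hx a
  have hp := smooth_frame_prod h hx
  have hz : ∀ a b, D.covDer (chartFrame φ a) (chartFrame φ b) x = 0 := fun a b => h.2 b x hx _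
  have h1 := D.covDer_prod_symm (hf d) (hf a) (hf b)
  have h2 : D.covDer (chartFrame φ d) (D.prod (chartFrame φ a) (chartFrame φ b)) x
      = D.covDer (chartFrame φ a) (D.prod (chartFrame φ d) (chartFrame φ b)) x := by
    have h3 : ∀ a b c, D.prod (chartFrame φ a) (D.covDer (chartFrame φ b) (chartFrame φ c)) x = 0 :=
      fun a b c => by rw [DubrovinManifold.prod, hz, ContinuousLinearMap.map_zero]
    have h4 : D.prod (VectorField.mlieBracket 𝓘(𝕜, Fin N → 𝕜) (chartFrame φ d) (chartFrame φ a))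
        (chartFrame φ b) x = 0 := by
      rw [DubrovinManifold.prod, D.mlieBracket_eq (hf d) (hf a), hz, hz, sub_zero, ContinuousLinearMap.map_zero]
      rfl
    rw [h3, h3, h4, add_zero, add_zero, add_zero] at h1
    exact h1
  have h5 := congrArg (chartComp φ x) h2
  rw [DubrovinManifold.covDer, DubrovinManifold.covDer,
    chartComp_nabla_chartFrame h hx (hp a b), chartComp_nabla_chartFrame h hx (hp d b)] at h5
  have h6 := congrFun h5 c
  rw [← fderiv_component (differentiableAt_chartField h hx (hp a b)),
    ← fderiv_component (differentiableAt_chartField h hx (hp d b))] at h6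
  exact h6

lemma inChart_e_const (hx : x ∈ φ.source) (a c : Fin N) :
    fderiv 𝕜 (fun v => (D.inChart φ).e v c) (φ x) (Pi.single a 1) = 0 := by
  have h1 := chartComp_nabla_chartFrame h hx (D.smooth_one x) a
  rw [D.flat_one, chartComp_zero] at h1
  refine (fderiv_component (differentiableAt_chartField h hx (D.smooth_one x)) _ c).trans ?_
  rw [← h1]
  rfl

lemma inChart_e_unit (hx : x ∈ φ.source) :
    ∑ a, (D.inChart φ).e (φ x) a • (D.inChart φ).A (φ x) a = 1 := by
  have h1 : ∀ b, chartComp φ x (D.mul x (D.one x) (chartFrame φ b x)) = Pi.single b 1 := fun b => by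
    rw [D.one_mul, chartComp_chartFrame h.1 hx]
  have h2 : (D.inChart φ).e (φ x) = chartComp φ x (D.one x) := chartField_apply hx D.one
  ext b c
  rw [Matrix.sum_apply, h2]
  refine (chartComp_mul_chartFrame h.1 hx _ b c).symm.trans ?_
  rw [h1, Matrix.one_eq_pi_single]

lemma inChart_E_linear (hx : x ∈ φ.source) (a b c : Fin N) :
    fderiv 𝕜 (fun v => fderiv 𝕜 (fun w => (D.inChart φ).E w c) v (Pi.single b 1)) (φ x)
      (Pi.single a 1) = 0 := by
  have hf := fun a => smoothVFieldAt_chartFrame h.1 hx a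
  have hs : SmoothVFieldAt (D.covDer (chartFrame φ b) D.euler) x :=
    D.smooth_nabla _ _ x (hf b) (D.smooth_euler x)
  have h1 := D.linear_euler (chartFrame φ a) (chartFrame φ b) x (hf a) (hf b)
  rw [h.2 b x hx, ContinuousLinearMap.map_zero] at h1
  have h2 := chartComp_nabla_chartFrame h hx hs a
  have h3 : D.nabla (D.covDer (chartFrame φ b) D.euler) x (chartFrame φ a x) = 0 := h1
  rw [h3, chartComp_zero] at h2
  -- The first derivative must be identified on a whole neighbourhood before it is differentiated
  -- again.
  have h4 : (fun v => fderiv 𝕜 (fun w => (D.inChart φ).E w c) v (Pi.single b 1))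
      =ᶠ[nhds (φ x)] fun v => chartField φ (D.covDer (chartFrame φ b) D.euler) v c := by
    filter_upwards [φ.open_target.mem_nhds (φ.map_source hx)] with v hv
    obtain ⟨y, hy, rfl⟩ : ∃ y ∈ φ.source, φ y = v := ⟨φ.symm v, φ.map_target hv, φ.right_inv hv⟩
    rw [chartField_apply hy, DubrovinManifold.covDer,
      chartComp_nabla_chartFrame h hy (D.smooth_euler y)]
    exact fderiv_component (differentiableAt_chartField h hy (D.smooth_euler y)) _ c
  rw [h4.fderiv_eq, fderiv_component (differentiableAt_chartField h hx hs), ← h2]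
  rfl

/-- The Euler identity on frame fields, where $[E,\partial_a]=-\nabla_{\partial_a}E$ and $\nabla$
acts on components. -/
lemma inChart_euler (hx : x ∈ φ.source) (a b c : Fin N) :
    ∑ d, ((D.inChart φ).E (φ x) d
          * fderiv 𝕜 (fun v => (D.inChart φ).A v a b c) (φ x) (Pi.single d 1)
        - (D.inChart φ).A (φ x) a b d
          * fderiv 𝕜 (fun v => (D.inChart φ).E v c) (φ x) (Pi.single d 1))
      = (D.inChart φ).A (φ x) a b c
        - ∑ d, (fderiv 𝕜 (fun v => (D.inChart φ).E v d) (φ x) (Pi.single a 1)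
              * (D.inChart φ).A (φ x) d b c
            + fderiv 𝕜 (fun v => (D.inChart φ).E v d) (φ x) (Pi.single b 1)
              * (D.inChart φ).A (φ x) a d c) := by
  have hf := fun a => smoothVFieldAt_chartFrame h.1 hx a
  have hp := smooth_frame_prod h hx a b
  have hE := D.smooth_euler x
  have hEe : (D.inChart φ).E (φ x) = chartComp φ x (D.euler x) := chartField_apply hx D.euler
  have hdE : ∀ a d, fderiv 𝕜 (fun v => (D.inChart φ).E v d) (φ x) (Pi.single a 1)
      = chartComp φ x (D.nabla D.euler x (chartFrame φ a x)) d := fun a d => by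
    rw [chartComp_nabla_chartFrame h hx hE]
    exact fderiv_component (differentiableAt_chartField h hx hE) _ d
  have h1 := D.euler_mul (chartFrame φ a) (chartFrame φ b) x (hf a) (hf b)
  rw [mlieBracket_chartFrame h hx a hE, mlieBracket_chartFrame h hx b hE] at h1
  have h2 := (D.mlieBracket_eq hE hp).symm.trans h1
  have h3 := congrFun (congrArg (chartComp φ x) h2) c
  have h4 : chartComp φ x (D.covDer D.euler (D.prod (chartFrame φ a) (chartFrame φ b)) x) c
      = ∑ d, (D.inChart φ).E (φ x) d
          * fderiv 𝕜 (fun v => (D.inChart φ).A v a b c) (φ x) (Pi.single d 1) := by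
    rw [DubrovinManifold.covDer, DubrovinManifold.chartComp_nabla h hx hp, hEe]
    exact fderiv_apply_eq_sum (differentiableAt_chartField h hx hp) _ c
  have h5 : chartComp φ x (D.covDer (D.prod (chartFrame φ a) (chartFrame φ b)) D.euler x) c
      = ∑ d, (D.inChart φ).A (φ x) a b d
          * fderiv 𝕜 (fun v => (D.inChart φ).E v c) (φ x) (Pi.single d 1) := by
    rw [DubrovinManifold.covDer, DubrovinManifold.chartComp_nabla h hx hE, DubrovinManifold.prod,
      chartComp_mul_chartFrame_chartFrame hx]
    exact fderiv_apply_eq_sum (differentiableAt_chartField h hx hE) _ c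
  have h6 : chartComp φ x (D.mul x (D.nabla D.euler x (chartFrame φ a x)) (chartFrame φ b x)) c
      = ∑ d, fderiv 𝕜 (fun v => (D.inChart φ).E v d) (φ x) (Pi.single a 1)
              * (D.inChart φ).A (φ x) d b c := by
    rw [chartComp_mul_chartFrame h.1 hx]
    simp only [hdE]
  have h7 : chartComp φ x (D.mul x (chartFrame φ a x) (D.nabla D.euler x (chartFrame φ b x))) c
      = ∑ d, fderiv 𝕜 (fun v => (D.inChart φ).E v d) (φ x) (Pi.single b 1)
              * (D.inChart φ).A (φ x) a d c := by
    rw [chartComp_chartFrame_mul h.1 hx]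
    simp only [hdE]
    rfl
  have h8 : D.mul x (-D.nabla D.euler x (chartFrame φ a x)) (chartFrame φ b x)
        + D.mul x (chartFrame φ a x) (-D.nabla D.euler x (chartFrame φ b x))
        + D.mul x (chartFrame φ a x) (chartFrame φ b x)
      = D.mul x (chartFrame φ a x) (chartFrame φ b x)
        - (D.mul x (D.nabla D.euler x (chartFrame φ a x)) (chartFrame φ b x)
          + D.mul x (chartFrame φ a x) (D.nabla D.euler x (chartFrame φ b x))) := by
    rw [ContinuousLinearMap.map_neg, ContinuousLinearMap.map_neg]
    change -D.mul x (D.nabla D.euler x (chartFrame φ a x)) (chartFrame φ b x) + _ + _ = _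
    abel
  rw [h8, chartComp_sub, chartComp_sub, chartComp_add,
    chartComp_mul_chartFrame_chartFrame hx] at h3
  rw [Finset.sum_sub_distrib, Finset.sum_add_distrib, ← h4, ← h5, ← h6, ← h7]
  exact h3

/-- The structure functions of a conformal Dubrovin manifold in a flat chart. -/
lemma isConformal_inChart : (D.inChart φ).IsConformal := by
  have key : ∀ {P : (Fin N → 𝕜) → Prop}, (∀ x ∈ φ.source, P (φ x)) →
      ∀ u ∈ (D.inChart φ).dom, P u := fun hP u hu => by
    have := hP (φ.symm u) (φ.map_target hu)
    rwa [φ.right_inv hu] at this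
  have smooth : ∀ {Y : VField 𝕜 N M}, (∀ x ∈ φ.source, SmoothVFieldAt Y x) → ∀ c,
      ContDiffOn 𝕜 ∞ (fun u => chartField φ Y u c) φ.target := fun hY c u hu =>
    (contDiffAt_pi.1 (contDiffAt_chartField h.1 hu
      (hY _ (φ.map_target hu))) c).contDiffWithinAt
  exact
    { isOpen_dom := φ.open_target
      contDiffOn_A := fun a b c => smooth (fun x hx => smooth_frame_prod h hx a b) c
      contDiffOn_e := fun c => smooth (fun x _ => D.smooth_one x) c
      contDiffOn_E := fun c => smooth (fun x _ => D.smooth_euler x) c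
      A_comm := key fun x hx => inChart_A_comm h hx
      A_mul_comm := key fun x hx => inChart_A_mul_comm h hx
      A_flat := key fun x hx => inChart_A_flat h hx
      e_const := key fun x hx => inChart_e_const h hx
      e_unit := key fun x hx => inChart_e_unit h hx
      E_linear := key fun x hx => inChart_E_linear h hx
      euler := key fun x hx => inChart_euler h hx }

end FlatChart

end ConformalDubrovinManifold

end Manifold

end

theorem mainTheorem5 {𝕜 : Type*} [RCLike 𝕜] {N : ℕ} {M : Type*} [TopologicalSpace M]
    [ChartedSpace (Fin N → 𝕜) M] [IsManifold 𝓘(𝕜, Fin N → 𝕜) ∞ M]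
    (D : ConformalDubrovinManifold 𝕜 N M) :
    (∀ φ : OpenPartialHomeomorph M (Fin N → 𝕜), IsFlatChart D.toDubrovinManifold φ →
      ((D.inChart φ).IsPotential (D.inChart φ).s ∧
        ∀ s' : ℤ → Jet 𝕜 N → Fin N → 𝕜, (D.inChart φ).IsPotential s' →
          ∀ (m : ℤ), ∀ u ∈ (D.inChart φ).J0, s' m u = (D.inChart φ).s m u) ∧
      (∀ k : ℤ, -1 ≤ k → ∀ f : Jet 𝕜 N → 𝕜, (D.inChart φ).IsJetFunction f →
        (D.inChart φ).IsJetFunction ((D.inChart φ).L k f)) ∧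
      (∀ j k : ℤ, -1 ≤ j → -1 ≤ k →
        ∀ f : Jet 𝕜 N → 𝕜, (D.inChart φ).IsJetFunction f → ∀ u ∈ (D.inChart φ).J0,
          (D.inChart φ).L j ((D.inChart φ).L k f) u - (D.inChart φ).L k ((D.inChart φ).L j f) u
            = ((j : 𝕜) - (k : 𝕜)) * (D.inChart φ).L (j + k) f u)) ∧
    (∀ (j k : ℕ) (x : M),
      VectorField.mlieBracket 𝓘(𝕜, Fin N → 𝕜) (eulerPow D j) (eulerPow D k) x
        = ((k : 𝕜) - (j : 𝕜)) • eulerPow D (j + k - 1) x) := by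
  refine ⟨fun φ h => ?_, D.mlieBracket_eulerPow⟩
  have hG := ConformalDubrovinManifold.isConformal_inChart h
  exact ⟨⟨FlatData.isPotential_s hG, fun s' hs m u hu => FlatData.isPotential_unique hG hs m hu⟩,
    fun k _ f hf => FlatData.isJetFunction_L hG k hf,
    fun j k hj hk f hf u hu => FlatData.L_commutator hG hj hk hf hu⟩
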